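/- **Setting.** Let $H$ be a separable (infinite-dimensional, real) Hilbert space with norm $\|\cdot\|$, $S:H\to H$ a continuous map, and $u_k=S(u_{k-1})+\eta_k$ $(k\ge1)$, $u_0=u\in H$. Assume: (A) There are $\alpha,\beta,C>0$, $q\in(0,1)$ and a continuous $\varPhi:H\to\mathbb R_+$ with $1+\|u\|^\alpha\le\varPhi(u)\le C(1+\|u\|)^\beta$ and $\varPhi(S(u)+v)\le q\,\varPhi(u)+C\,\varPhi(v)$ for all $u,v\in H$. (B) There are a continuous function $\mathfrak p:H\to\mathbb R_+$ bounded on balls, an increasing sequence $\gamma_N>0$ $(N\ge 0)$ with $\gamma_N\to+\infty$, and an increasing sequence of finite-dimensional subspaces $E_N\subset H$ with dense union and $E_0=\{0\}$ such that, for all $u,v\in H$ and $N\ge0$, $\|(I-\Pi_N)(S(u)-S(v))\|\le\gamma_N^{-1}e^{\mathfrak p(u)+\mathfrak p(v)}\|u-v\|$, where $\Pi_N$ is the orthogonal projection onto $E_N$. (C) $\eta_k=\sum_{j\ge1}b_j\xi_{jk}e_j$, where $\{e_j\}_{j\ge1}$ is an orthonormal basis of $H$, the $\xi_{jk}$ are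 independent real random variables, the law of $\xi_{jk}$ has a positive $C^1$ density $\rho_j$ whose total variation (as a function on $\mathbb R$) is at most $1$, and $b_j\ge0$ satisfy $\sum_{j\ge1}\gamma_{j-1}b_j<\infty$. Moreover $\mathbb E\,e^{\delta(\varPhi(\eta_1)+\mathfrak p(\eta_1))}<\infty$ for some $\delta>0$. Let $H_N=\mathrm{span}\{e_1,\dots,e_N\}$, let $\mathsf P_N$ be the orthogonal projection onto $H_N$, put $\|u\|_U=\sup_{N\ge0}\gamma_N\|(I-\mathsf P_N)u\|$ and let $U=\{u\in H:\|u\|_U<\infty\}$. Assume further that $S(0)\in U$; that $\mathfrak p$ is stabilisable, i.e. there are an increasing continuous $Q:\mathbb R_+\to\mathbb R_+$ and $c,\delta'>0$ with $\mathbb E_u\exp\{\delta'(\mathfrak p(u_1)+\dots+\mathfrak p(u_k))\}\le Q(\|u\|)e^{ck}$ for all $k\ge1$, $u\in H$; that $Q(\|u\|)\le e^{\rho\varPhi(u)}$ for some $\rho>0$ and all $u\in H$; and that $b_j\ne0$ for all $j$. Fix an integer $\ell\ge1$ and let $\boldsymbol u_k$ be the process in $H^\ell$ that moves in one step from $[v^1,\dots,v^\ell]$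 to $[v^2,\dots,v^\ell,S(v^\ell)+\eta_k]$. For bounded continuous $V,f:H^\ell\to\mathbb R$ and $k\ge0$ put $$\mathfrak P^V_kf(\boldsymbol u)=\mathbb E_{\boldsymbol u}\Bigl\{f(\boldsymbol u_k)\exp\Bigl(\sum_{n=1}^kV(\boldsymbol u_n)\Bigr)\Bigr\}.$$ Let $\mathcal V$ be the set of functions on $H^\ell$ of the form $V(\boldsymbol u)=F(\mathsf P_Nu^1,\dots,\mathsf P_Nu^\ell)$, where $N\ge1$ and $F:H_N^\ell\to\mathbb R$ is $C^1$ and bounded together with its derivative. For $s\in(0,1]$ let $H_s=[H,U]_s$ be the complex interpolation space (of the complexified spaces) with norm $\|\cdot\|_s$, and for an integer $R\ge1$ let $X_R=\{u\in H:\|u\|_s\le R,\ \mathfrak p(u)\le R\}^\ell\subset H^\ell$ and $\|g\|_R=\sup_{X_R}|g|$. **Theorem.** For any $s\in(0,1]$ and any $V\in\mathcal V$ there is an integer $R_0\ge1$ such that, for every $f\in\mathcal V$ and every integer $R\ge R_0$, the sequence $\{\|\mathfrak P^V_k\mathbf 1\|_R^{-1}\,\mathfrak P^V_kf,\ k\ge0\}$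 is uniformly equicontinuous on $X_R$ with respect to the metric of $H^\ell$: for every $\varepsilon>0$ there is $\theta>0$ such that any two points of $X_R$ at distance less than $\theta$ have images at distance less than $\varepsilon$ under every member of the sequence. -/

import Mathlib

open MeasureTheory ProbabilityTheory Filter Topology
open scoped NNReal ENNReal

noncomputable section

namespace KickRDS

variable {H : Type*} [NormedAddCommGroup H] [InnerProductSpace ℝ H]

/-! ### The dynamical system and its generalised Markov semigroup -/

section Dynamics

variable {Ω : Type*}

/-- The trajectory of `u_{k+1} = S(u_k) + η_{k+1}`, `u_0 = u`.
Here `η k` is the kick at time `k + 1`, so the sequence of kicks is indexed from `0`. -/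
def traj (S : H → H) (η : ℕ → Ω → H) (u : H) : ℕ → Ω → H
  | 0, _ => u
  | k + 1, ω => S (traj S η u k ω) + η k ω

/-- The trajectory of the `ℓ`-process in `H^ℓ`: one step maps `[v¹, …, v^ℓ]` to
`[v², …, v^ℓ, S(v^ℓ) + η]`. -/
def blockTraj (S : H → H) (η : ℕ → Ω → H) {ℓ : ℕ} (u : Fin ℓ → H) : ℕ → Ω → (Fin ℓ → H)
  | 0, _ => u
  | k + 1, ω => fun i =>
      if h : (i : ℕ) + 1 < ℓ then blockTraj S η u k ω ⟨(i : ℕ) + 1, h⟩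
      else S (blockTraj S η u k ω i) + η k ω

/-- The generalised Markov (Feynman–Kac) semigroup
`𝔓_k^V f(u) = E_u f(u_k) exp(V(u_1) + ⋯ + V(u_k))` on functions on `H^ℓ`. -/
def fkSemigroup [MeasurableSpace Ω] (μ : Measure Ω) (S : H → H) (η : ℕ → Ω → H) {ℓ : ℕ}
    (V : (Fin ℓ → H) → ℝ) (k : ℕ) (f : (Fin ℓ → H) → ℝ) (u : Fin ℓ → H) : ℝ :=
  ∫ ω, f (blockTraj S η u k ω) *
    Real.exp (∑ n ∈ Finset.Icc 1 k, V (blockTraj S η u n ω)) ∂μ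

end Dynamics

/-! ### Hypotheses on `S` and on the noise -/

/-- Dissipativity. -/
structure Dissipative (S : H → H) (Φ : H → ℝ) : Prop where
  continuous : Continuous Φ
  bounds : ∃ α β C q : ℝ, 0 < α ∧ 0 < β ∧ 0 < C ∧ 0 < q ∧ q < 1 ∧
    (∀ u, 1 + ‖u‖ ^ α ≤ Φ u ∧ Φ u ≤ C * (1 + ‖u‖) ^ β) ∧
    (∀ u v, Φ (S u + v) ≤ q * Φ u + C * Φ v)

/-- Compactness, with respect to an increasing sequence `E` of finite-dimensional subspaces. -/
structure CompactnessCondition (S : H → H) (p : H → ℝ) (γ : ℕ → ℝ) (E : ℕ → Submodule ℝ H)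
    [∀ N, FiniteDimensional ℝ (E N)] : Prop where
  continuous : Continuous p
  nonneg : ∀ u, 0 ≤ p u
  bounded_on_balls : ∀ R : ℝ, BddAbove (p '' Metric.closedBall 0 R)
  gamma_pos : ∀ N, 0 < γ N
  gamma_mono : Monotone γ
  gamma_tendsto : Tendsto γ atTop atTop
  space_mono : Monotone E
  space_zero : E 0 = ⊥
  space_dense : Dense (⋃ N, (E N : Set H))
  contraction : ∀ (u v : H) (N : ℕ),
    ‖(S u - S v) - (E N).starProjection (S u - S v)‖
      ≤ (γ N)⁻¹ * Real.exp (p u + p v) * ‖u - v‖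

/-- The span `H_N` of the first `N` vectors of an orthonormal basis. -/
def coordSpan (e : HilbertBasis ℕ ℝ H) (N : ℕ) : Submodule ℝ H :=
  Submodule.span ℝ (Set.range fun i : Fin N => e i)

instance (e : HilbertBasis ℕ ℝ H) (N : ℕ) : FiniteDimensional ℝ (coordSpan e N) :=
  FiniteDimensional.span_of_finite ℝ (Set.finite_range _)

/-- Structure of the noise. The basis vectors, the coefficients and the densities are indexed
from `0`, so that the summability condition `∑_{j ≥ 1} γ_{j-1} b_j < ∞` becomes
`∑_j γ_j b_j < ∞`; `ξ j k` is the `j`-th coordinate of the kick `η k`. The bound on each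
density is a bound on its total variation as a function on the line. -/
structure NoiseCondition [MeasurableSpace H] {Ω : Type*} [MeasurableSpace Ω] (μ : Measure Ω)
    (Φ p : H → ℝ) (γ : ℕ → ℝ) (e : HilbertBasis ℕ ℝ H) (b : ℕ → ℝ) (dens : ℕ → ℝ → ℝ)
    (ξ : ℕ → ℕ → Ω → ℝ) (η : ℕ → Ω → H) : Prop where
  measurable_coord : ∀ j k, Measurable (ξ j k)
  measurable_kick : ∀ k, Measurable (η k)
  expansion : ∀ k, ∀ᵐ ω ∂μ, HasSum (fun j => (b j * ξ j k ω) • e j) (η k ω)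
  indep : iIndepFun (fun jk : ℕ × ℕ => ξ jk.1 jk.2) μ
  law : ∀ j k, μ.map (ξ j k) = volume.withDensity fun x => ENNReal.ofReal (dens j x)
  dens_smooth : ∀ j, ContDiff ℝ 1 (dens j)
  dens_pos : ∀ j x, 0 < dens j x
  dens_variation : ∀ j, eVariationOn (dens j) Set.univ ≤ 1
  coeff_nonneg : ∀ j, 0 ≤ b j
  coeff_summable : Summable fun j => γ j * b j
  exp_moment : ∃ δ : ℝ, 0 < δ ∧
    ∫⁻ u, ENNReal.ofReal (Real.exp (δ * (Φ u + p u))) ∂(μ.map (η 0)) < ∞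

/-- `p` is stabilisable for the Markov family of `u_{k+1} = S(u_k) + η_{k+1}`, with the
function `Q`. -/
def StabilisableWith {Ω : Type*} [MeasurableSpace Ω] (μ : Measure Ω) (S : H → H)
    (η : ℕ → Ω → H) (p : H → ℝ) (Q : ℝ≥0 → ℝ≥0) : Prop :=
  Continuous Q ∧ Monotone Q ∧ ∃ c δ : ℝ, 0 < c ∧ 0 < δ ∧ ∀ k : ℕ, 1 ≤ k → ∀ u : H,
    ∫⁻ ω, ENNReal.ofReal (Real.exp (δ * ∑ n ∈ Finset.Icc 1 k, p (traj S η u n ω))) ∂μ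
      ≤ Q ‖u‖₊ * ENNReal.ofReal (Real.exp (c * k))

/-! ### The space `U` and the complex interpolation spaces `H_s = [H, U]_s` -/

/-- The norm `‖u‖_U = sup_N γ_N ‖u - P_N u‖`, equal to `∞` outside `U`; here `P_N` is the
orthogonal projection onto the span of the first `N` vectors of the basis `e` of the noise. -/
def normU (γ : ℕ → ℝ) (e : HilbertBasis ℕ ℝ H) (u : H) : ℝ≥0∞ :=
  ⨆ N : ℕ, ENNReal.ofReal (γ N * ‖u - (coordSpan e N).starProjection u‖)

/-- The complexification of `H`, realised as `ℓ²(ℕ, ℂ)` by means of the coordinates in the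
orthonormal basis `e`; a vector `u` of `H` is the sequence of its real coordinates. -/
abbrev HC : Type := lp (fun _ : ℕ => ℂ) 2

/-- The norm of the complexification of `U`: `sup_N γ_N ‖x - P_N x‖`, where `P_N` keeps the
first `N` coordinates. -/
def normUC (γ : ℕ → ℝ) (x : HC) : ℝ≥0∞ :=
  ⨆ N : ℕ, ENNReal.ofReal (γ N * Real.sqrt (∑' j : ℕ, ‖x (N + j)‖ ^ 2))

/-- The functions used in complex interpolation between `H` and `U` (complexified):
holomorphic inside the strip `0 < Re z < 1`, continuous and bounded on the closed strip with
values in `H + U = H`, and such that `t ↦ f(1 + it)` is continuous and bounded with values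
in `U`. (On the line `Re z = 0` continuity and boundedness in `H` are part of this.) -/
structure InterpFunction (γ : ℕ → ℝ) (f : ℂ → HC) : Prop where
  holomorphic : DifferentiableOn ℂ f {z | 0 < z.re ∧ z.re < 1}
  continuousOn : ContinuousOn f {z | 0 ≤ z.re ∧ z.re ≤ 1}
  bounded : ∃ C : ℝ, ∀ z : ℂ, 0 ≤ z.re → z.re ≤ 1 → ‖f z‖ ≤ C
  bounded_right : ∃ C : ℝ≥0, ∀ t : ℝ, normUC γ (f (1 + t * Complex.I)) ≤ C
  continuous_right : ∀ t : ℝ, Tendsto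
    (fun t' : ℝ => normUC γ (f (1 + t' * Complex.I) - f (1 + t * Complex.I))) (𝓝 t) (𝓝 0)

/-- The norm of the complex interpolation space `H_s = [H, U]_s`, equal to `∞` outside `H_s`:
the infimum of `max (sup_t ‖f(it)‖) (sup_t ‖f(1 + it)‖_U)` over all interpolation functions
`f` with `f(s) = u`. -/
def interpNorm (γ : ℕ → ℝ) (e : HilbertBasis ℕ ℝ H) (s : ℝ) (u : H) : ℝ≥0∞ :=
  ⨅ (f : ℂ → HC) (_ : InterpFunction γ f)
    (_ : ∀ j : ℕ, f (s : ℂ) j = ((inner ℝ (e j) u : ℝ) : ℂ)),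
    max (⨆ t : ℝ, ‖f (t * Complex.I)‖ₑ) (⨆ t : ℝ, normUC γ (f (1 + t * Complex.I)))

/-- The set `X_R = (B_s(R) ∩ {p ≤ R})^ℓ` in `H^ℓ`. -/
def compactSet (γ : ℕ → ℝ) (e : HilbertBasis ℕ ℝ H) (p : H → ℝ) (s : ℝ) (ℓ R : ℕ) :
    Set (Fin ℓ → H) :=
  {u | ∀ i, interpNorm γ e s (u i) ≤ R ∧ p (u i) ≤ R}

/-! ### The function space `𝒱` and the sup norm on a set -/

/-- `V(u) = F(P_N u¹, …, P_N u^ℓ)` for some `N ≥ 1` and some `C¹` function `F` on `H_N^ℓ` that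
is bounded together with its derivative. -/
def IsCylinder (e : HilbertBasis ℕ ℝ H) {ℓ : ℕ} (V : (Fin ℓ → H) → ℝ) : Prop :=
  ∃ N : ℕ, 1 ≤ N ∧ ∃ F : (Fin ℓ → coordSpan e N) → ℝ,
    ContDiff ℝ 1 F ∧ (∃ C : ℝ, ∀ x, |F x| ≤ C) ∧ (∃ C : ℝ, ∀ x, ‖fderiv ℝ F x‖ ≤ C) ∧
    ∀ u, V u = F fun i => (coordSpan e N).orthogonalProjectionOnto (u i)

/-- `sup_{u ∈ X} |g(u)|`. -/
def supNormOn {α : Type*} (X : Set α) (g : α → ℝ) : ℝ :=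
  sSup ((fun u => |g u|) '' X)

end KickRDS

end

/-!
Write `lam` for the common law of the kicks. As the kicks are independent and identically
distributed, `𝔓_k^V` is the `k`-th iterate of the one-step operator
`fkOp lam S V g u = ∫ g (u') exp (V u') d lam`, where `u'` is the state after one step
(`NoiseCondition.fkSemigroup_eq_iterate`). Adding a constant to `V` multiplies the semigroup by
numbers that the normalisation cancels, so `V` may be taken with values in `[0, A]`. What has to
be shown is an estimate of Hölder type for `𝔓_k f`, uniform in `k` relative to `𝔓_k 1 (0)`: a set
`X_R` with `R ≥ p 0` contains the origin, hence `‖𝔓_k 1‖_R ≥ 𝔓_k 1 (0)`, and it is bounded in `H`,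
by the three lines theorem (`norm_le_of_interpNorm_le`).

*Weights.* Two Lyapunov functions are used (`NoiseCondition.exists_weightPair`). The small weight
is `m = exp (κ Φ)`; by dissipativity its drift beats every bounded potential outside a sublevel
set `{Φ ≤ R}`, and this yields the growth condition `𝔓_k 1 (u) ≤ N_k m (u^ℓ)`, where `N_k` is the
supremum of `𝔓_k 1` over the states with last component in `{Φ ≤ R}`
(`FKSetup.iterate_le_sup_mul`). The large weight `ω` combines `exp (κ Φ)`, `exp (θ p)` and the
discounted sum of the exponential moments of `p` along the trajectory, which is finite because `p`
is stabilisable. Its second moment after one step is at most `C exp (-2 θ p) ω²`.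

*Coupling.* Along finitely many coordinates of the noise the law `lam` is Lipschitz in total
variation with respect to shifts, since the densities have bounded variation. Hence two
trajectories that start at `x` and `y` can be driven by kicks `z` and `z + a`, with `a` the
projection of `S x - S y` onto the first modes, outside an event of probability
`O (exp (p x + p y) ‖x - y‖)`, and after the step they are at a distance at most `ε exp (p x + p y) ‖x - y‖`
(`CompactnessCondition.squeezingCoupling`). Raised to a small power `θ` and integrated against
`ω ⊗ ω`, the factor `exp (θ (p x + p y))` is absorbed by the weight. A distance on `H^ℓ` with
geometric weights makes the estimate contract also in the components that are only shifted, and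
induction on `k` gives `|𝔓_k f (u) - 𝔓_k f (v)| ≤ N_k K ω (u^ℓ) ω (v^ℓ) blockDist u v`
(`FKSetup.exists_holder`).

*Harnack inequality.* Finally `N_k ≤ c 𝔓_k 1 (0)` (`FKSetup.exists_sup_le_mul`). Up to a constant,
`𝔓_k 1` depends on the last component only. The image under `S` of the bounded set `{Φ ≤ R}` is
totally bounded, so by the Hölder estimate for `f = 1` the supremum `N_k` is attained, up to a
constant, at one of finitely many points that do not depend on `k`. The law `lam` charges every
ball, so the chain started at the origin reaches a neighbourhood of each of these points with
positive probability, and there `𝔓_k 1` is comparable with its value at the point, once more by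
the Hölder estimate.
-/

set_option linter.unusedSectionVars false

namespace KickRDS

/-! ### Independence and the law of the kicks -/

/-- Subfamilies of an independent family over disjoint, possibly infinite, sets of indices are
independent of each other. -/
theorem indepFun_restrict_of_disjoint {Ω ι : Type*} [MeasurableSpace Ω] {μ : Measure Ω}
    {f : ι → Ω → ℝ} (hf : ∀ i, Measurable (f i)) (h : iIndepFun f μ) {A B : Set ι}
    (hAB : Disjoint A B) :
    IndepFun (fun ω (i : A) => f i ω) (fun ω (i : B) => f i ω) μ := by
  have key : ∀ A : Set ι, (MeasurableSpace.pi.comap fun ω (i : A) => f i ω)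
      = ⨆ i ∈ A, MeasurableSpace.comap (f i) inferInstance := by
    intro A
    simp only [MeasurableSpace.pi, MeasurableSpace.comap_iSup, MeasurableSpace.comap_comp]
    rw [iSup_subtype']
    rfl
  rw [IndepFun_iff_Indep, key, key]
  exact indep_iSup_of_disjoint (fun i => (hf i).comap_le) h.iIndep hAB

section Noise

variable {H : Type*} [NormedAddCommGroup H] [InnerProductSpace ℝ H] [CompleteSpace H]
  [TopologicalSpace.SeparableSpace H] [MeasurableSpace H] [BorelSpace H]
  {Ω : Type*} [MeasurableSpace Ω] {μ : Measure Ω} [IsProbabilityMeasure μ]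
  {Φ p : H → ℝ} {γ : ℕ → ℝ} {e : HilbertBasis ℕ ℝ H} {b : ℕ → ℝ} {dens : ℕ → ℝ → ℝ}
  {ξ : ℕ → ℕ → Ω → ℝ} {η : ℕ → Ω → H}

theorem NoiseCondition.map_coords_eq (hC : NoiseCondition μ Φ p γ e b dens ξ η) (k : ℕ) :
    μ.map (fun ω j => ξ j k ω) = μ.map (fun ω j => ξ j 0 ω) := by
  have hk : ∀ k, iIndepFun (fun j => ξ j k) μ := fun k =>
    hC.indep.precomp (g := fun j => (j, k)) fun i j hij => (Prod.mk.inj hij).1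
  rw [(hk k).map_fun_eq_infinitePi_map fun j => hC.measurable_coord j k,
    (hk 0).map_fun_eq_infinitePi_map fun j => hC.measurable_coord j 0]
  simp_rw [hC.law]

/-- The kicks are one and the same measurable function of their coordinates. -/
theorem NoiseCondition.exists_kick_map (hC : NoiseCondition μ Φ p γ e b dens ξ η) :
    ∃ G : (ℕ → ℝ) → H, Measurable G ∧ ∀ k, η k =ᵐ[μ] fun ω => G fun j => ξ j k ω := by
  have hm : ∀ k, Measurable fun ω j => ξ j k ω := fun k =>
    measurable_pi_lambda _ fun j => hC.measurable_coord j k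
  let F : ℕ → (ℕ → ℝ) → H := fun n x => ∑ j ∈ Finset.range n, (b j * x j) • e j
  have hF : ∀ n, Measurable (F n) := fun n => by
    refine Finset.measurable_fun_sum _ fun j _ => ?_
    exact ((measurable_const.mul (measurable_pi_apply j)).smul_const _)
  have hlim : ∀ k, ∀ᵐ ω ∂μ, Tendsto (fun n => F n fun j => ξ j k ω) atTop (𝓝 (η k ω)) := by
    intro k
    filter_upwards [hC.expansion k] with ω hω using hω.tendsto_sum_nat
  have hex : MeasurableSet {x : ℕ → ℝ | ∃ l, Tendsto (fun n => F n x) atTop (𝓝 l)} :=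
    measurableSet_exists_tendsto hF
  have hlaw : ∀ᵐ x ∂(μ.map fun ω j => ξ j 0 ω), ∃ l, Tendsto (fun n => F n x) atTop (𝓝 l) := by
    rw [ae_map_iff (hm 0).aemeasurable hex]
    filter_upwards [hlim 0] with ω hω using ⟨_, hω⟩
  obtain ⟨G, hG, hGlim⟩ := measurable_limit_of_tendsto_metrizable_ae
    (fun n => (hF n).aemeasurable) hlaw
  refine ⟨G, hG, fun k => ?_⟩
  rw [← hC.map_coords_eq k] at hGlim
  filter_upwards [ae_of_ae_map (hm k).aemeasurable hGlim, hlim k] with ω h₁ h₂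
  exact tendsto_nhds_unique h₂ h₁

theorem NoiseCondition.map_kick_eq (hC : NoiseCondition μ Φ p γ e b dens ξ η) (k : ℕ) :
    μ.map (η k) = μ.map (η 0) := by
  obtain ⟨G, hG, hη⟩ := hC.exists_kick_map
  have hm : ∀ k, Measurable fun ω j => ξ j k ω := fun k =>
    measurable_pi_lambda _ fun j => hC.measurable_coord j k
  have h : ∀ k, μ.map (η k) = (μ.map fun ω j => ξ j k ω).map G := fun k => by
    rw [Measure.map_map hG (hm k)]
    exact Measure.map_congr (hη k)
  rw [h k, h 0, hC.map_coords_eq k]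

/-- Each kick is independent of the preceding ones. -/
theorem NoiseCondition.indepFun_past (hC : NoiseCondition μ Φ p γ e b dens ξ η) (k : ℕ) :
    IndepFun (fun ω (i : Fin k) => η i ω) (η k) μ := by
  obtain ⟨G, hG, hη⟩ := hC.exists_kick_map
  let A : Set (ℕ × ℕ) := {jk | jk.2 < k}
  let B : Set (ℕ × ℕ) := {jk | jk.2 = k}
  have hAB : Disjoint A B := Set.disjoint_left.2 fun x (hx : x.2 < k) (hx' : x.2 = k) => by omega
  have h := indepFun_restrict_of_disjoint (fun jk : ℕ × ℕ => hC.measurable_coord jk.1 jk.2)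
    hC.indep hAB
  have hφ : Measurable fun (x : A → ℝ) (i : Fin k) => G fun j => x ⟨(j, i), i.2⟩ :=
    measurable_pi_lambda _ fun i => hG.comp <| measurable_pi_lambda _ fun j =>
      measurable_pi_apply _
  have hψ : Measurable fun x : B → ℝ => G fun j => x ⟨(j, k), rfl⟩ :=
    hG.comp <| measurable_pi_lambda _ fun j => measurable_pi_apply _
  refine (h.comp hφ hψ).congr ?_ (hη k).symm
  have : ∀ᵐ ω ∂μ, ∀ i : Fin k, η i ω = G fun j => ξ j i ω := ae_all_iff.2 fun i => hη i
  filter_upwards [this] with ω hω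
  funext i
  exact (hω i).symm

/-- One coordinate of the kick can be split off as an independent summand with the given
density. -/
theorem NoiseCondition.exists_split (hC : NoiseCondition μ Φ p γ e b dens ξ η) (j : ℕ) :
    ∃ κ : Measure H, IsProbabilityMeasure κ ∧
      μ.map (η 0) = ((volume.withDensity fun x => ENNReal.ofReal (dens j x)).prod κ).map
        (fun z : ℝ × H => (b j * z.1) • e j + z.2) := by
  let B : Set (ℕ × ℕ) := {jk | jk ≠ (j, 0)}
  let F : ℕ → (B → ℝ) → H := fun n x =>
    ∑ i ∈ Finset.range n, if h : i = j then 0 else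
      (b i * x ⟨(i, 0), fun h' => h (Prod.mk.inj h').1⟩) • e i
  have hF : ∀ n, Measurable (F n) := fun n => by
    refine Finset.measurable_fun_sum _ fun i _ => ?_
    split_ifs with h
    · exact measurable_const
    · exact ((measurable_const.mul (measurable_pi_apply _)).smul_const _)
  let X : Ω → (B → ℝ) := fun ω i => ξ i.1.1 i.1.2 ω
  have hX : Measurable X := measurable_pi_lambda _ fun i => hC.measurable_coord _ _
  have hlim : ∀ᵐ ω ∂μ, Tendsto (fun n => F n (X ω)) atTop
      (𝓝 (η 0 ω - (b j * ξ j 0 ω) • e j)) := by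
    filter_upwards [hC.expansion 0] with ω hω
    have h1 := (hω.sub (hasSum_ite_eq j ((b j * ξ j 0 ω) • e j))).tendsto_sum_nat
    refine h1.congr fun n => Finset.sum_congr rfl fun i _ => ?_
    by_cases h : i = j
    · subst h; simp
    · simp [h, X]
  have hlaw : ∀ᵐ x ∂(μ.map X), ∃ l, Tendsto (fun n => F n x) atTop (𝓝 l) := by
    rw [ae_map_iff hX.aemeasurable (measurableSet_exists_tendsto hF)]
    filter_upwards [hlim] with ω hω using ⟨_, hω⟩
  obtain ⟨G, hG, hGlim⟩ := measurable_limit_of_tendsto_metrizable_ae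
    (fun n => (hF n).aemeasurable) hlaw
  have hη : ∀ᵐ ω ∂μ, η 0 ω = (b j * ξ j 0 ω) • e j + G (X ω) := by
    filter_upwards [ae_of_ae_map hX.aemeasurable hGlim, hlim] with ω h₁ h₂
    rw [tendsto_nhds_unique h₁ h₂]
    abel
  let A : Set (ℕ × ℕ) := {(j, 0)}
  have hAB : Disjoint A B := Set.disjoint_left.2 fun x hx hx' => hx' hx
  have hind := indepFun_restrict_of_disjoint (fun jk : ℕ × ℕ => hC.measurable_coord jk.1 jk.2)
    hC.indep hAB
  have hind' : IndepFun (ξ j 0) (fun ω => G (X ω)) μ :=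
    hind.comp (measurable_pi_apply (⟨(j, 0), rfl⟩ : A)) hG
  have hprod := (indepFun_iff_map_prod_eq_prod_map_map (hC.measurable_coord j 0).aemeasurable
    (hG.comp hX).aemeasurable).1 hind'
  refine ⟨μ.map fun ω => G (X ω), Measure.isProbabilityMeasure_map (hG.comp hX).aemeasurable, ?_⟩
  rw [← hC.law j 0]
  erw [← hprod]
  rw [Measure.map_map (by fun_prop) ((hC.measurable_coord j 0).prodMk (hG.comp hX))]
  exact Measure.map_congr hη

end Noise

/-! ### Shifts of the law of the noise -/

/-- A function of total variation at most `1` changes by at most `|h|` in `L¹` under the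
shift by `h`. -/
theorem lintegral_edist_shift_le {f : ℝ → ℝ} (hf : eVariationOn f Set.univ ≤ 1) (h : ℝ) :
    ∫⁻ x, edist (f (x + h)) (f x) ≤ ENNReal.ofReal |h| := by
  wlog hh : 0 ≤ h generalizing h
  · have := this (-h) (by linarith)
    rw [abs_neg] at this
    rw [← lintegral_add_right_eq_self _ h] at this
    simpa [edist_comm] using this
  have hv : ∀ x, eVariationOn f (Set.Iic x) ≤ 1 := fun x =>
    (eVariationOn.mono f (Set.subset_univ _)).trans hf
  have hvtop : ∀ x, eVariationOn f (Set.Iic x) ≠ ∞ := fun x =>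
    ne_top_of_le_ne_top ENNReal.one_ne_top (hv x)
  -- the variation function dominates the increments of `f`, and its increments telescope
  let v : ℝ → ℝ := fun x => (eVariationOn f (Set.Iic x)).toReal
  have hvm : Monotone v := fun x y hxy =>
    ENNReal.toReal_mono (hvtop y) (eVariationOn.mono f (Set.Iic_subset_Iic.2 hxy))
  have hv0 : ∀ x, 0 ≤ v x := fun x => ENNReal.toReal_nonneg
  have hv1 : ∀ x, v x ≤ 1 := fun x => by
    simpa using ENNReal.toReal_mono ENNReal.one_ne_top (hv x)
  have hinc : ∀ x, edist (f (x + h)) (f x) ≤ ENNReal.ofReal (v (x + h) - v x) := by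
    intro x
    have h1 := eVariationOn.add_le_union f (s := Set.Iic x) (t := Set.Icc x (x + h))
      fun y hy z hz => le_trans hy hz.1
    rw [Set.Iic_union_Icc_eq_Iic (by linarith)] at h1
    have h2 : edist (f (x + h)) (f x) ≤ eVariationOn f (Set.Icc x (x + h)) :=
      eVariationOn.edist_le f (Set.right_mem_Icc.2 (by linarith))
        (Set.left_mem_Icc.2 (by linarith))
    rw [ENNReal.ofReal_sub _ (hv0 x), ENNReal.ofReal_toReal (hvtop _),
      ENNReal.ofReal_toReal (hvtop _)]
    exact ENNReal.le_sub_of_add_le_left (hvtop x) ((add_le_add le_rfl h2).trans h1)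
  refine (lintegral_mono hinc).trans ?_
  rw [abs_of_nonneg hh]
  have hvh : Monotone fun x => v (x + h) := fun x y hxy => hvm (by linarith)
  have hcov : AECover (volume : Measure ℝ) atTop fun n : ℝ => Set.Ioc (-n) n :=
    aecover_Ioc tendsto_neg_atTop_atBot tendsto_id
  refine le_of_tendsto (hcov.lintegral_tendsto_of_countably_generated
    (hvh.measurable.sub hvm.measurable).ennreal_ofReal.aemeasurable) ?_
  filter_upwards [eventually_ge_atTop 0] with n hn
  have hi1 : IntervalIntegrable (fun x => v (x + h)) volume (-n) n := hvh.intervalIntegrable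
  have hi : ∀ c d, IntervalIntegrable v volume c d := fun c d => hvm.intervalIntegrable
  rw [← ofReal_integral_eq_lintegral_ofReal]
  · rw [← intervalIntegral.integral_of_le (by linarith), intervalIntegral.integral_sub hi1 (hi _ _),
      intervalIntegral.integral_comp_add_right]
    refine ENNReal.ofReal_le_ofReal ?_
    rw [intervalIntegral.integral_interval_sub_interval_comm (hi _ _) (hi _ _) (hi _ _),
      intervalIntegral.integral_symm, add_comm (-n) h]
    have h3 : ∫ x in n..n + h, v x ≤ ∫ x in n..n + h, (1 : ℝ) :=
      intervalIntegral.integral_mono_on (by linarith) (hi _ _) (by simp) fun x _ => hv1 x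
    have h4 : 0 ≤ ∫ x in (-n)..(h + -n), v x :=
      intervalIntegral.integral_nonneg (by linarith) fun x _ => hv0 x
    have h5 : ∫ x in n..n + h, (1 : ℝ) = h := by simp
    rw [intervalIntegral.integral_symm n]
    linarith
  · exact ((intervalIntegrable_iff_integrableOn_Ioc_of_le (by linarith)).1 (hi1.sub (hi _ _)))
  · exact ae_of_all _ fun x => sub_nonneg.2 (hvm (by linarith))

theorem withDensity_le_preimage_add {f : ℝ → ℝ} (hc : Continuous f)
    (hf : eVariationOn f Set.univ ≤ 1) (h : ℝ) {A : Set ℝ} (hA : MeasurableSet A) :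
    (volume.withDensity fun x => ENNReal.ofReal (f x)) A
      ≤ (volume.withDensity fun x => ENNReal.ofReal (f x)) ((fun x => x + h) ⁻¹' A)
        + ENNReal.ofReal |h| := by
  have hm : MeasurableSet ((fun x => x + h) ⁻¹' A) := hA.preimage (measurable_add_const h)
  rw [withDensity_apply _ hA, withDensity_apply _ hm]
  have h1 : ∫⁻ x in A, ENNReal.ofReal (f x)
      = ∫⁻ x in (fun x => x + h) ⁻¹' A, ENNReal.ofReal (f (x + h)) := by
    rw [← lintegral_indicator hA, ← lintegral_indicator hm, ← lintegral_add_right_eq_self _ h]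
    rfl
  rw [h1]
  calc ∫⁻ x in (fun x => x + h) ⁻¹' A, ENNReal.ofReal (f (x + h))
      ≤ ∫⁻ x in (fun x => x + h) ⁻¹' A,
          (ENNReal.ofReal (f x) + edist (f (x + h)) (f x)) := by
        refine lintegral_mono fun x => ?_
        rw [edist_dist, Real.dist_eq]
        refine (ENNReal.ofReal_le_ofReal ?_).trans ENNReal.ofReal_add_le
        linarith [le_abs_self (f (x + h) - f x)]
    _ = _ := lintegral_add_left hc.measurable.ennreal_ofReal _
    _ ≤ _ := add_le_add le_rfl
        ((setLIntegral_le_lintegral _ _).trans (lintegral_edist_shift_le hf h))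

section Noise

variable {H : Type*} [NormedAddCommGroup H] [InnerProductSpace ℝ H] [CompleteSpace H]
  [TopologicalSpace.SeparableSpace H] [MeasurableSpace H] [BorelSpace H]
  {Ω : Type*} [MeasurableSpace Ω] {μ : Measure Ω} [IsProbabilityMeasure μ]
  {Φ p : H → ℝ} {γ : ℕ → ℝ} {e : HilbertBasis ℕ ℝ H} {b : ℕ → ℝ} {dens : ℕ → ℝ → ℝ}
  {ξ : ℕ → ℕ → Ω → ℝ} {η : ℕ → Ω → H}

theorem NoiseCondition.map_le_preimage_add_smul (hC : NoiseCondition μ Φ p γ e b dens ξ η)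
    {j : ℕ} (hb : b j ≠ 0) (t : ℝ) {A : Set H} (hA : MeasurableSet A) :
    μ.map (η 0) A ≤ μ.map (η 0) ((fun y => y + t • e j) ⁻¹' A)
      + ENNReal.ofReal (|b j|⁻¹ * |t|) := by
  obtain ⟨κ, hκ, hsplit⟩ := hC.exists_split j
  set ν := volume.withDensity fun x => ENNReal.ofReal (dens j x) with hν
  have hνp : IsProbabilityMeasure ν := by
    rw [hν, ← hC.law j 0]
    exact Measure.isProbabilityMeasure_map (hC.measurable_coord j 0).aemeasurable
  have hm : Measurable fun z : ℝ × H => (b j * z.1) • e j + z.2 := by fun_prop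
  have hA' : MeasurableSet ((fun y => y + t • e j) ⁻¹' A) := hA.preimage (by fun_prop)
  rw [hsplit, Measure.map_apply hm hA, Measure.map_apply hm hA',
    Measure.prod_apply_symm (hA.preimage hm), Measure.prod_apply_symm (hA'.preimage hm)]
  calc _ ≤ ∫⁻ w, (ν ((fun x => (x, w)) ⁻¹' ((fun z : ℝ × H => (b j * z.1) • e j + z.2) ⁻¹'
            ((fun y => y + t • e j) ⁻¹' A))) + ENNReal.ofReal (|b j|⁻¹ * |t|)) ∂κ := by
        refine lintegral_mono fun w => ?_
        have hAw : MeasurableSet {x : ℝ | (b j * x) • e j + w ∈ A} := hA.preimage (by fun_prop)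
        have := withDensity_le_preimage_add (hC.dens_smooth j).continuous (hC.dens_variation j)
          ((b j)⁻¹ * t) hAw
        rw [abs_mul, abs_inv] at this
        refine this.trans (le_of_eq ?_)
        congr 2
        ext x
        simp only [Set.mem_preimage, Set.mem_ofPred_eq]
        rw [mul_add, mul_inv_cancel_left₀ hb, add_smul]
        congr! 1
        abel
    _ = _ := by
        rw [lintegral_add_right _ measurable_const, lintegral_const, measure_univ, mul_one]

/-- As the densities are positive, null sets of the law of the kick are stable under shifts along
the basis vectors. -/
theorem NoiseCondition.map_preimage_smul_eq_zero (hC : NoiseCondition μ Φ p γ e b dens ξ η)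
    {j : ℕ} (hb : b j ≠ 0) (t : ℝ) {A : Set H} (hA : MeasurableSet A)
    (h0 : μ.map (η 0) A = 0) : μ.map (η 0) ((fun y => y + t • e j) ⁻¹' A) = 0 := by
  obtain ⟨κ, hκ, hsplit⟩ := hC.exists_split j
  set ν := volume.withDensity fun x => ENNReal.ofReal (dens j x) with hν
  have hνp : IsProbabilityMeasure ν := by
    rw [hν, ← hC.law j 0]
    exact Measure.isProbabilityMeasure_map (hC.measurable_coord j 0).aemeasurable
  have hm : Measurable fun z : ℝ × H => (b j * z.1) • e j + z.2 := by fun_prop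
  have hA' : MeasurableSet ((fun y => y + t • e j) ⁻¹' A) := hA.preimage (by fun_prop)
  rw [hsplit, Measure.map_apply hm hA] at h0
  rw [hsplit, Measure.map_apply hm hA']
  rw [Measure.prod_apply_symm (hA.preimage hm),
    lintegral_eq_zero_iff (measurable_measure_prodMk_right (hA.preimage hm))] at h0
  rw [Measure.prod_apply_symm (hA'.preimage hm),
    lintegral_eq_zero_iff (measurable_measure_prodMk_right (hA'.preimage hm))]
  filter_upwards [h0] with w hw
  have hac : volume ≪ ν := withDensity_absolutelyContinuous'
    (hC.dens_smooth j).continuous.measurable.ennreal_ofReal.aemeasurable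
    (ae_of_all _ fun x => by simpa using hC.dens_pos j x)
  refine withDensity_absolutelyContinuous _ _ ?_
  have h1 := hac hw
  rw [← measure_preimage_add_right volume ((b j)⁻¹ * t)] at h1
  refine Eq.trans ?_ h1
  congr 1
  ext x
  simp only [Set.mem_preimage]
  rw [mul_add, mul_inv_cancel_left₀ hb, add_smul]
  congr! 1
  abel

/-- The law of the kick charges every ball. -/
theorem NoiseCondition.map_ball_pos (hC : NoiseCondition μ Φ p γ e b dens ξ η)
    (hb : ∀ j, b j ≠ 0) (z : H) {r : ℝ} (hr : 0 < r) : 0 < μ.map (η 0) (Metric.ball z r) := by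
  have : IsProbabilityMeasure (μ.map (η 0)) :=
    Measure.isProbabilityMeasure_map (hC.measurable_kick 0).aemeasurable
  rw [pos_iff_ne_zero]
  intro h0
  -- some ball of radius `r / 2` is charged; it is moved into `ball z r` along basis vectors
  obtain ⟨z₀, hz₀⟩ : ∃ z₀, μ.map (η 0) (Metric.ball z₀ (r / 2)) ≠ 0 := by
    by_contra! hcon
    obtain ⟨D, hDc, hDd⟩ := TopologicalSpace.exists_countable_dense H
    have hcov : (⋃ d ∈ D, Metric.ball d (r / 2)) = Set.univ := by
      refine Set.eq_univ_of_forall fun y => ?_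
      obtain ⟨d, hd, hyd⟩ := Metric.dense_iff.1 hDd y (r / 2) (by linarith)
      exact Set.mem_biUnion hyd (by rw [Metric.mem_ball, dist_comm]; exact hd)
    have : μ.map (η 0) Set.univ = 0 := by
      rw [← hcov]
      exact (measure_biUnion_null_iff hDc).2 fun d _ => hcon d
    simp at this
  obtain ⟨s, hs⟩ : ∃ s : Finset ℕ, ‖(∑ j ∈ s, e.repr (z - z₀) j • e j) - (z - z₀)‖ < r / 2 := by
    have := (e.hasSum_repr (z - z₀)).eventually (Metric.ball_mem_nhds _ (half_pos hr))
    obtain ⟨s, hs⟩ := this.exists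
    exact ⟨s, by simpa [dist_eq_norm] using hs⟩
  have hshift : ∀ s : Finset ℕ, μ.map (η 0)
      ((fun y => y + ∑ j ∈ s, e.repr (z - z₀) j • e j) ⁻¹' Metric.ball z r) = 0 := by
    intro s
    induction s using Finset.induction_on with
    | empty => simpa using h0
    | insert j s hj ih =>
      have hm : MeasurableSet
          ((fun y => y + ∑ j ∈ s, e.repr (z - z₀) j • e j) ⁻¹' Metric.ball z r) :=
        measurableSet_ball.preimage (by fun_prop)
      have := hC.map_preimage_smul_eq_zero (hb j) (e.repr (z - z₀) j) hm ih
      rw [← Set.preimage_comp] at this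
      convert this using 3
      funext y
      simp [Finset.sum_insert hj, add_assoc]
  refine hz₀ (measure_mono_null (fun y hy => ?_) (hshift s))
  rw [Metric.mem_ball, dist_eq_norm] at hy
  rw [Set.mem_preimage, Metric.mem_ball, dist_eq_norm]
  calc ‖y + ∑ j ∈ s, e.repr (z - z₀) j • e j - z‖
      = ‖(y - z₀) + ((∑ j ∈ s, e.repr (z - z₀) j • e j) - (z - z₀))‖ := by congr 1; abel
    _ ≤ _ := norm_add_le _ _
    _ < r := by linarith

/-- The law of the kick depends on a shift along `H_M` in a Lipschitz way, in total variation. -/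
theorem NoiseCondition.exists_map_le_preimage_add (hC : NoiseCondition μ Φ p γ e b dens ξ η)
    (hb : ∀ j, b j ≠ 0) (M : ℕ) :
    ∃ C : ℝ, 0 ≤ C ∧ ∀ a ∈ coordSpan e M, ∀ A : Set H, MeasurableSet A →
      μ.map (η 0) A ≤ μ.map (η 0) ((fun y => y + a) ⁻¹' A) + ENNReal.ofReal (C * ‖a‖) := by
  refine ⟨∑ i : Fin M, |b i|⁻¹, Finset.sum_nonneg fun i _ => by positivity, fun a ha A hA => ?_⟩
  obtain ⟨c, rfl⟩ := (Submodule.mem_span_range_iff_exists_fun ℝ).1 ha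
  have ho : Orthonormal ℝ fun i : Fin M => e i := e.orthonormal.comp _ Fin.val_injective
  have hc : ∀ i, |c i| ≤ ‖∑ i, c i • e i‖ := fun i => by
    rw [← ho.inner_right_fintype c i]
    simpa [ho.1 i] using abs_real_inner_le_norm (e i) (∑ i : Fin M, c i • e i)
  have hshift : ∀ s : Finset (Fin M), μ.map (η 0) A
      ≤ μ.map (η 0) ((fun y => y + ∑ i ∈ s, c i • e i) ⁻¹' A)
        + ENNReal.ofReal (∑ i ∈ s, |b i|⁻¹ * |c i|) := by
    intro s
    induction s using Finset.induction_on with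
    | empty => simp
    | insert j s hj ih =>
      have hm : MeasurableSet ((fun y => y + ∑ i ∈ s, c i • e i) ⁻¹' A) :=
        hA.preimage (by fun_prop)
      have h1 := hC.map_le_preimage_add_smul (hb j) (c j) hm
      rw [← Set.preimage_comp] at h1
      have h2 : (fun y => y + ∑ i ∈ insert j s, c i • e i)
          = (fun y => y + ∑ i ∈ s, c i • e i) ∘ fun y => y + c j • e j := by
        funext y
        simp [Finset.sum_insert hj, add_assoc]
      rw [h2, Finset.sum_insert hj, ENNReal.ofReal_add (by positivity)
        (Finset.sum_nonneg fun i _ => by positivity), ← add_assoc]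
      exact ih.trans (add_le_add h1 le_rfl)
  refine (hshift Finset.univ).trans (add_le_add le_rfl (ENNReal.ofReal_le_ofReal ?_))
  rw [Finset.sum_mul]
  exact Finset.sum_le_sum fun i _ => mul_le_mul_of_nonneg_left (hc i) (by positivity)

end Noise

/-- A probability measure that changes little in total variation under the shift by `a` can be
coupled with its shift: it splits into a part `ν` that is moved by the shift inside the measure,
and a small remainder. -/
theorem exists_shift_coupling {H : Type*} [NormedAddCommGroup H] [MeasurableSpace H] [BorelSpace H]
    {lam : Measure H} [IsProbabilityMeasure lam] {a : H} {ε : ℝ≥0∞}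
    (h : ∀ A, MeasurableSet A → lam A ≤ lam ((fun y => y + -a) ⁻¹' A) + ε) :
    ∃ ν μ₁ μ₂ : Measure H, lam = ν + μ₁ ∧ lam = ν.map (fun y => y + a) + μ₂ ∧
      μ₁ Set.univ ≤ ε ∧ μ₂ Set.univ ≤ ε := by
  have hplus : Measurable fun y : H => y + a := (continuous_add_const a).measurable
  have hminus : Measurable fun y : H => y + -a := (continuous_add_const (-a)).measurable
  have hcomp' : (fun y : H => y + a) ∘ (fun y => y + -a) = id := by funext y; simp
  set lam' := lam.map fun y => y + -a with hlam'
  have : IsProbabilityMeasure lam' := Measure.isProbabilityMeasure_map hminus.aemeasurable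
  -- `ν` is the minimum of `lam` and `lam'`, by the Hahn decomposition
  obtain ⟨s, hs, h1, h2⟩ := hahn_decomposition lam lam'
  let ν := lam'.restrict s + lam.restrict sᶜ
  have hν : ν ≤ lam := by
    rw [← Measure.restrict_add_restrict_compl (μ := lam) hs]
    refine add_le_add (Measure.le_iff.2 fun t ht => ?_) le_rfl
    rw [Measure.restrict_apply ht, Measure.restrict_apply ht]
    exact h1 _ (ht.inter hs) Set.inter_subset_right
  have hν' : ν ≤ lam' := by
    rw [← Measure.restrict_add_restrict_compl (μ := lam') hs]
    refine add_le_add le_rfl (Measure.le_iff.2 fun t ht => ?_)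
    rw [Measure.restrict_apply ht, Measure.restrict_apply ht]
    exact h2 _ (ht.inter hs.compl) Set.inter_subset_right
  have hνa : ν.map (fun y => y + a) ≤ lam := by
    refine (Measure.map_mono hν' hplus).trans (le_of_eq ?_)
    rw [hlam', Measure.map_map hplus hminus, hcomp', Measure.map_id]
  have : IsFiniteMeasure ν := isFiniteMeasure_of_le lam hν
  have hmass : lam Set.univ ≤ ν Set.univ + ε := by
    have h3 : lam s ≤ lam' s + ε := by
      rw [hlam', Measure.map_apply hminus hs]
      exact h s hs
    simp only [ν, Measure.add_apply, Measure.restrict_apply_univ]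
    rw [← measure_add_measure_compl hs]
    calc lam s + lam sᶜ ≤ lam' s + ε + lam sᶜ := add_le_add h3 le_rfl
      _ = _ := by ring
  refine ⟨ν, lam - ν, lam - ν.map (fun y => y + a), ?_, ?_, ?_, ?_⟩
  · rw [add_comm, Measure.sub_add_cancel_of_le hν]
  · rw [add_comm, Measure.sub_add_cancel_of_le hνa]
  · rw [Measure.sub_apply .univ hν]
    exact tsub_le_iff_left.2 hmass
  · rw [Measure.sub_apply .univ hνa, Measure.map_apply hplus .univ, Set.preimage_univ]
    exact tsub_le_iff_left.2 hmass

/-! ### The Markov property -/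

/-- One step of the `ℓ`-process, `[v¹, …, v^ℓ] ↦ [v², …, v^ℓ, S(v^ℓ) + y]`. -/
def blockStep {H : Type*} [NormedAddCommGroup H] (S : H → H) {ℓ : ℕ} (u : Fin ℓ → H) (y : H) :
    Fin ℓ → H := fun i =>
  if h : (i : ℕ) + 1 < ℓ then u ⟨(i : ℕ) + 1, h⟩ else S (u i) + y

/-- The one-step Feynman–Kac operator, for kicks of law `lam`. -/
noncomputable def fkOp {H : Type*} [NormedAddCommGroup H] [MeasurableSpace H] (lam : Measure H)
    (S : H → H) {ℓ : ℕ} (V g : (Fin ℓ → H) → ℝ) (u : Fin ℓ → H) : ℝ :=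
  ∫ y, g (blockStep S u y) * Real.exp (V (blockStep S u y)) ∂lam

/-- The one-step operator of the weight `exp (δ p)`, for kicks of law `lam`. -/
noncomputable def weightOp {H : Type*} [NormedAddCommGroup H] [MeasurableSpace H]
    (lam : Measure H) (S : H → H) (p : H → ℝ) (δ : ℝ) (g : H → ℝ≥0∞) (x : H) : ℝ≥0∞ :=
  ∫⁻ y, ENNReal.ofReal (Real.exp (δ * p (S x + y))) * g (S x + y) ∂lam

section Noise

variable {H : Type*} [NormedAddCommGroup H] [InnerProductSpace ℝ H] [CompleteSpace H]
  [TopologicalSpace.SeparableSpace H] [MeasurableSpace H] [BorelSpace H]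
  {Ω : Type*} [MeasurableSpace Ω] {μ : Measure Ω} [IsProbabilityMeasure μ]
  {Φ p : H → ℝ} {γ : ℕ → ℝ} {e : HilbertBasis ℕ ℝ H} {b : ℕ → ℝ} {dens : ℕ → ℝ → ℝ}
  {ξ : ℕ → ℕ → Ω → ℝ} {η : ℕ → Ω → H} {S : H → H}

theorem measurable_blockStep (hS : Continuous S) {ℓ : ℕ} :
    Measurable fun z : (Fin ℓ → H) × H => blockStep S z.1 z.2 := by
  refine measurable_pi_lambda _ fun i => ?_
  unfold blockStep
  split_ifs with h
  · fun_prop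
  · have := hS.measurable
    fun_prop

/-- A chain driven by the kicks: its state and the next kick are independent. -/
theorem NoiseCondition.map_chain_succ (hC : NoiseCondition μ Φ p γ e b dens ξ η)
    {Z : Type*} [MeasurableSpace Z] {G : Z × H → Z} (hG : Measurable G) {z : Z}
    {X : ℕ → Ω → Z} (h0 : ∀ ω, X 0 ω = z) (hX : ∀ k ω, X (k + 1) ω = G (X k ω, η k ω)) (k : ℕ) :
    Measurable (X k) ∧
      μ.map (X (k + 1)) = ((μ.map (X k)).prod (μ.map (η 0))).map G := by
  have hrep : ∀ k, ∃ g : (Fin k → H) → Z, Measurable g ∧ ∀ ω, X k ω = g fun i => η i ω := by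
    intro k
    induction k with
    | zero => exact ⟨fun _ => z, measurable_const, h0⟩
    | succ k ih =>
      obtain ⟨g, hg, hgX⟩ := ih
      refine ⟨fun y => G (g fun i => y i.castSucc, y (Fin.last k)), by fun_prop, fun ω => ?_⟩
      rw [hX, hgX]
      rfl
  have hηm : Measurable fun ω (i : Fin k) => η i ω :=
    measurable_pi_lambda _ fun i => hC.measurable_kick i
  obtain ⟨g, hg, hgX⟩ := hrep k
  have hXk : X k = g ∘ fun ω (i : Fin k) => η i ω := funext hgX
  have hm : Measurable (X k) := hXk ▸ hg.comp hηm
  have hind : IndepFun (X k) (η k) μ := by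
    rw [hXk]
    exact (hC.indepFun_past k).comp hg measurable_id
  have hprod := (indepFun_iff_map_prod_eq_prod_map_map hm.aemeasurable
    (hC.measurable_kick k).aemeasurable).1 hind
  refine ⟨hm, ?_⟩
  rw [← hC.map_kick_eq k, ← hprod, Measure.map_map hG (hm.prodMk (hC.measurable_kick k))]
  exact congrArg (μ.map ·) (funext (hX k))

theorem measurable_fkOp (lam : Measure H) [IsProbabilityMeasure lam] (hS : Continuous S) {ℓ : ℕ}
    {V g : (Fin ℓ → H) → ℝ} (hV : Measurable V) (hg : Measurable g) :
    Measurable (fkOp lam S V g) := by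
  have hm := measurable_blockStep hS (ℓ := ℓ)
  have : StronglyMeasurable fun z : (Fin ℓ → H) × H =>
      g (blockStep S z.1 z.2) * Real.exp (V (blockStep S z.1 z.2)) :=
    ((hg.comp hm).mul (hV.comp hm).exp).stronglyMeasurable
  exact this.integral_prod_right.measurable

theorem integrable_fkOp (lam : Measure H) [IsProbabilityMeasure lam] (hS : Continuous S) {ℓ : ℕ}
    {V g : (Fin ℓ → H) → ℝ} (hV : Measurable V) (hg : Measurable g) {A B : ℝ}
    (hVA : ∀ u, V u ≤ A) (hgB : ∀ u, |g u| ≤ B) (u : Fin ℓ → H) :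
    Integrable (fun y => g (blockStep S u y) * Real.exp (V (blockStep S u y))) lam := by
  have hm : Measurable fun y => blockStep S u y :=
    (measurable_blockStep hS).comp measurable_prodMk_left
  refine Integrable.of_bound ((hg.comp hm).mul (hV.comp hm).exp).aestronglyMeasurable
    (B * Real.exp A) (ae_of_all _ fun y => ?_)
  rw [norm_mul, Real.norm_eq_abs, Real.norm_eq_abs, Real.abs_exp]
  exact mul_le_mul (hgB _) (Real.exp_le_exp.2 (hVA _)) (Real.exp_pos _).le
    ((abs_nonneg _).trans (hgB u))

theorem abs_fkOp_le (lam : Measure H) [IsProbabilityMeasure lam] {ℓ : ℕ}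
    {V g : (Fin ℓ → H) → ℝ} {A B : ℝ}
    (hVA : ∀ u, V u ≤ A) (hgB : ∀ u, |g u| ≤ B) (u : Fin ℓ → H) :
    |fkOp lam S V g u| ≤ B * Real.exp A := by
  have := norm_integral_le_of_norm_le_const (μ := lam) (C := B * Real.exp A)
    (f := fun y => g (blockStep S u y) * Real.exp (V (blockStep S u y)))
    (ae_of_all _ fun y => by
      rw [norm_mul, Real.norm_eq_abs, Real.norm_eq_abs, Real.abs_exp]
      exact mul_le_mul (hgB _) (Real.exp_le_exp.2 (hVA _)) (Real.exp_pos _).le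
        ((abs_nonneg _).trans (hgB u)))
  simpa [fkOp] using this

theorem iterate_fkOp_spec (lam : Measure H) [IsProbabilityMeasure lam] (hS : Continuous S) {ℓ : ℕ}
    {V g : (Fin ℓ → H) → ℝ} (hV : Measurable V) (hg : Measurable g) {A B : ℝ}
    (hVA : ∀ u, V u ≤ A) (hgB : ∀ u, |g u| ≤ B) (k : ℕ) :
    Measurable ((fkOp lam S V)^[k] g) ∧
      ∀ u, |(fkOp lam S V)^[k] g u| ≤ B * Real.exp (k * A) := by
  induction k with
  | zero => simpa using ⟨hg, hgB⟩
  | succ k ih =>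
    rw [Function.iterate_succ_apply']
    refine ⟨measurable_fkOp lam hS hV ih.1, fun u => ?_⟩
    refine (abs_fkOp_le lam hVA ih.2 u).trans (le_of_eq ?_)
    rw [mul_assoc, ← Real.exp_add]
    push_cast
    ring_nf

/-- The Feynman–Kac semigroup consists of the iterates of the one-step operator. -/
theorem NoiseCondition.fkSemigroup_eq_iterate (hC : NoiseCondition μ Φ p γ e b dens ξ η)
    (hS : Continuous S) {ℓ : ℕ} {V : (Fin ℓ → H) → ℝ} (hV : Measurable V) {A : ℝ}
    (hVA : ∀ u, |V u| ≤ A) (k : ℕ) {f : (Fin ℓ → H) → ℝ} (hf : Measurable f) {B : ℝ}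
    (hfB : ∀ u, |f u| ≤ B) :
    fkSemigroup μ S η V k f = (fkOp (μ.map (η 0)) S V)^[k] f := by
  have : IsProbabilityMeasure (μ.map (η 0)) :=
    Measure.isProbabilityMeasure_map (hC.measurable_kick 0).aemeasurable
  induction k generalizing f B with
  | zero => funext u; simp [fkSemigroup, blockTraj]
  | succ k ih =>
    rw [Function.iterate_succ_apply, ← ih (measurable_fkOp _ hS hV hf)
      (abs_fkOp_le _ (fun u => (le_abs_self _).trans (hVA u)) hfB)]
    funext u
    -- the chain consisting of the state and of the accumulated potential
    let X : ℕ → Ω → (Fin ℓ → H) × ℝ := fun k ω =>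
      (blockTraj S η u k ω, ∑ n ∈ Finset.Icc 1 k, V (blockTraj S η u n ω))
    let G : ((Fin ℓ → H) × ℝ) × H → (Fin ℓ → H) × ℝ := fun z =>
      (blockStep S z.1.1 z.2, z.1.2 + V (blockStep S z.1.1 z.2))
    have hstep : Measurable fun z : ((Fin ℓ → H) × ℝ) × H => blockStep S z.1.1 z.2 :=
      (measurable_blockStep hS).comp (measurable_fst.fst.prodMk measurable_snd)
    have hG : Measurable G := hstep.prodMk (measurable_fst.snd.add (hV.comp hstep))
    have hX : ∀ k ω, X (k + 1) ω = G (X k ω, η k ω) := fun k ω => by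
      simp only [X, G, Finset.sum_Icc_succ_top (Nat.le_add_left 1 k)]
      rfl
    have hchain := hC.map_chain_succ hG (z := (u, 0)) (X := X)
      (fun ω => by simp [X, blockTraj]) hX
    let φ : (Fin ℓ → H) × ℝ → ℝ := fun z => f z.1 * Real.exp z.2
    have hφ : Measurable φ := (hf.comp measurable_fst).mul measurable_snd.exp
    have hint : Integrable φ (μ.map (X (k + 1))) := by
      rw [integrable_map_measure hφ.aestronglyMeasurable (hchain (k + 1)).1.aemeasurable]
      refine Integrable.of_bound (hφ.comp (hchain (k + 1)).1).aestronglyMeasurable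
        (B * Real.exp (∑ n ∈ Finset.Icc 1 (k + 1), A)) (ae_of_all _ fun ω => ?_)
      simp only [Function.comp, φ, X]
      rw [norm_mul, Real.norm_eq_abs, Real.norm_eq_abs, Real.abs_exp]
      exact mul_le_mul (hfB _) (Real.exp_le_exp.2
        (Finset.sum_le_sum fun n _ => (le_abs_self _).trans (hVA _))) (Real.exp_pos _).le
        ((abs_nonneg _).trans (hfB u))
    have hint' := hint
    rw [(hchain k).2, integrable_map_measure hφ.aestronglyMeasurable hG.aemeasurable] at hint'
    have : IsProbabilityMeasure (μ.map (X k)) :=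
      Measure.isProbabilityMeasure_map (hchain k).1.aemeasurable
    calc fkSemigroup μ S η V (k + 1) f u = ∫ ω, φ (X (k + 1) ω) ∂μ := rfl
      _ = ∫ z, φ z ∂(μ.map (X (k + 1))) :=
        (integral_map (hchain (k + 1)).1.aemeasurable hφ.aestronglyMeasurable).symm
      _ = ∫ z, φ (G z) ∂((μ.map (X k)).prod (μ.map (η 0))) := by
        rw [(hchain k).2, integral_map hG.aemeasurable hφ.aestronglyMeasurable]
      _ = ∫ z, ∫ y, φ (G (z, y)) ∂(μ.map (η 0)) ∂(μ.map (X k)) := integral_prod _ hint'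
      _ = ∫ z, fkOp (μ.map (η 0)) S V f z.1 * Real.exp z.2 ∂(μ.map (X k)) := by
        refine integral_congr_ae (ae_of_all _ fun z => ?_)
        simp only [fkOp, φ, G]
        rw [← integral_mul_const]
        refine integral_congr_ae (ae_of_all _ fun y => ?_)
        simp only [Real.exp_add]
        ring
      _ = _ := integral_map (hchain k).1.aemeasurable
        (((measurable_fkOp _ hS hV hf).comp measurable_fst).mul
          measurable_snd.exp).aestronglyMeasurable

theorem measurable_weightOp (lam : Measure H) [IsProbabilityMeasure lam] (hS : Continuous S)
    (hp : Continuous p) (δ : ℝ) {g : H → ℝ≥0∞} (hg : Measurable g) :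
    Measurable (weightOp lam S p δ g) := by
  have hm : Measurable fun z : H × H => S z.1 + z.2 :=
    (hS.measurable.comp measurable_fst).add measurable_snd
  have : Measurable fun z : H × H =>
      ENNReal.ofReal (Real.exp (δ * p (S z.1 + z.2))) * g (S z.1 + z.2) :=
    (((hp.measurable.comp hm).const_mul δ).exp.ennreal_ofReal).mul (hg.comp hm)
  exact this.lintegral_prod_right

theorem NoiseCondition.lintegral_exp_sum_eq_iterate (hC : NoiseCondition μ Φ p γ e b dens ξ η)
    (hS : Continuous S) (hp : Continuous p) (δ : ℝ) (k : ℕ) {g : H → ℝ≥0∞} (hg : Measurable g)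
    (x : H) :
    ∫⁻ ω, ENNReal.ofReal (Real.exp (δ * ∑ n ∈ Finset.Icc 1 k, p (traj S η x n ω)))
        * g (traj S η x k ω) ∂μ = (weightOp (μ.map (η 0)) S p δ)^[k] g x := by
  have : IsProbabilityMeasure (μ.map (η 0)) :=
    Measure.isProbabilityMeasure_map (hC.measurable_kick 0).aemeasurable
  induction k generalizing g with
  | zero => simp [traj]
  | succ k ih =>
    rw [Function.iterate_succ_apply, ← ih (measurable_weightOp _ hS hp δ hg)]
    let X : ℕ → Ω → H × ℝ := fun k ω =>
      (traj S η x k ω, ∑ n ∈ Finset.Icc 1 k, p (traj S η x n ω))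
    let G : (H × ℝ) × H → H × ℝ := fun z =>
      (S z.1.1 + z.2, z.1.2 + p (S z.1.1 + z.2))
    have hstep : Measurable fun z : (H × ℝ) × H => S z.1.1 + z.2 :=
      (hS.measurable.comp measurable_fst.fst).add measurable_snd
    have hG : Measurable G := hstep.prodMk (measurable_fst.snd.add (hp.measurable.comp hstep))
    have hX : ∀ k ω, X (k + 1) ω = G (X k ω, η k ω) := fun k ω => by
      simp only [X, G, Finset.sum_Icc_succ_top (Nat.le_add_left 1 k)]
      rfl
    have hchain := hC.map_chain_succ hG (z := (x, 0)) (X := X)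
      (fun ω => by simp [X, traj]) hX
    let φ : H × ℝ → ℝ≥0∞ := fun z => ENNReal.ofReal (Real.exp (δ * z.2)) * g z.1
    have hφ : Measurable φ :=
      ((measurable_snd.const_mul δ).exp.ennreal_ofReal).mul (hg.comp measurable_fst)
    have : IsProbabilityMeasure (μ.map (X k)) :=
      Measure.isProbabilityMeasure_map (hchain k).1.aemeasurable
    calc _ = ∫⁻ ω, φ (X (k + 1) ω) ∂μ := rfl
      _ = ∫⁻ z, φ z ∂(μ.map (X (k + 1))) := (lintegral_map hφ (hchain (k + 1)).1).symm
      _ = ∫⁻ z, φ (G z) ∂((μ.map (X k)).prod (μ.map (η 0))) := by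
        rw [(hchain k).2, lintegral_map hφ hG]
      _ = ∫⁻ z, ∫⁻ y, φ (G (z, y)) ∂(μ.map (η 0)) ∂(μ.map (X k)) :=
        lintegral_prod _ (hφ.comp hG).aemeasurable
      _ = ∫⁻ z, ENNReal.ofReal (Real.exp (δ * z.2)) *
            weightOp (μ.map (η 0)) S p δ g z.1 ∂(μ.map (X k)) := by
        refine lintegral_congr fun z => ?_
        simp only [weightOp, φ, G]
        rw [← lintegral_const_mul]
        · refine lintegral_congr fun y => ?_
          rw [mul_add, Real.exp_add, ENNReal.ofReal_mul (Real.exp_pos _).le, mul_assoc]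
        · have hm : Measurable fun y => S z.1 + y := measurable_const.add measurable_id
          exact (((hp.measurable.comp hm).const_mul δ).exp.ennreal_ofReal).mul (hg.comp hm)
      _ = _ := lintegral_map (((measurable_snd.const_mul δ).exp.ennreal_ofReal).mul
          ((measurable_weightOp _ hS hp δ hg).comp measurable_fst)) (hchain k).1

end Noise

/-! ### Lyapunov functions -/

/-- A pair of weights for the chain `x ↦ S x + y`, `y` of law `lam`: the weight `m` controls the
growth of the Feynman–Kac semigroup, and the second moment of the larger weight `ω` gains the factor
`exp (-2 θ p)` that pays for the expansion of distances in one step. -/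
structure IsWeightPair {H : Type*} [NormedAddCommGroup H] [MeasurableSpace H] (lam : Measure H)
    (S : H → H) (p : H → ℝ) (m ω : H → ℝ) (θ C : ℝ) : Prop where
  theta_pos : 0 < θ
  theta_le : θ ≤ 1 / 2
  const_pos : 0 < C
  measurable_small : Measurable m
  measurable_large : Measurable ω
  one_le_small : ∀ x, 1 ≤ m x
  small_le_large : ∀ x, m x ≤ ω x
  exp_le_large : ∀ x, Real.exp (θ * p x) ≤ ω x
  bounded_on_balls : ∀ R : ℝ, ∃ B : ℝ, ∀ x, ‖x‖ ≤ R → ω x ≤ B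
  integrable_sq : ∀ x, Integrable (fun y => ω (S x + y) ^ 2) lam
  integral_sq_le : ∀ x, ∫ y, ω (S x + y) ^ 2 ∂lam ≤ C * Real.exp (-(2 * θ * p x)) * ω x ^ 2

theorem integrable_and_integral_le_of_lintegral_le {α : Type*} [MeasurableSpace α] {μ : Measure α}
    {f : α → ℝ} (hf : Measurable f) (h0 : ∀ x, 0 ≤ f x) {c : ℝ} (hc : 0 ≤ c)
    (h : ∫⁻ x, ENNReal.ofReal (f x) ∂μ ≤ ENNReal.ofReal c) :
    Integrable f μ ∧ ∫ x, f x ∂μ ≤ c := by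
  refine ⟨⟨hf.aestronglyMeasurable, ?_⟩, ?_⟩
  · rw [hasFiniteIntegral_iff_ofReal (ae_of_all _ h0)]
    exact h.trans_lt ENNReal.ofReal_lt_top
  · rw [integral_eq_lintegral_of_nonneg_ae (ae_of_all _ h0) hf.aestronglyMeasurable]
    simpa [ENNReal.toReal_ofReal hc] using ENNReal.toReal_mono ENNReal.ofReal_ne_top h

section Noise

variable {H : Type*} [NormedAddCommGroup H] [InnerProductSpace ℝ H] [CompleteSpace H]
  [TopologicalSpace.SeparableSpace H] [MeasurableSpace H] [BorelSpace H]
  {Ω : Type*} [MeasurableSpace Ω] {μ : Measure Ω} [IsProbabilityMeasure μ]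
  {Φ p : H → ℝ} {γ : ℕ → ℝ} {e : HilbertBasis ℕ ℝ H} {b : ℕ → ℝ} {dens : ℕ → ℝ → ℝ}
  {ξ : ℕ → ℕ → Ω → ℝ} {η : ℕ → Ω → H} {S : H → H}

/-- Stabilisability in the form of a Lyapunov function: the discounted sum of the exponential
moments of `p` along the trajectory. -/
theorem NoiseCondition.exists_lyapunov_of_stabilisable
    (hC : NoiseCondition μ Φ p γ e b dens ξ η) (hS : Continuous S) (hp : Continuous p)
    {Q : ℝ≥0 → ℝ≥0} (hQ : StabilisableWith μ S η p Q) :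
    ∃ (δ C : ℝ) (W : H → ℝ), 0 < δ ∧ 0 < C ∧ Measurable W ∧ (∀ x, 1 ≤ W x) ∧
      (∀ R : ℝ, ∃ B : ℝ, ∀ x, ‖x‖ ≤ R → W x ≤ B) ∧
      ∀ x, ∫⁻ y, ENNReal.ofReal (Real.exp (δ * p (S x + y)) * W (S x + y)) ∂(μ.map (η 0))
        ≤ ENNReal.ofReal (C * W x) := by
  obtain ⟨-, hQm, c, δ, hc, hδ, hbound⟩ := hQ
  have : IsProbabilityMeasure (μ.map (η 0)) :=
    Measure.isProbabilityMeasure_map (hC.measurable_kick 0).aemeasurable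
  set L := weightOp (μ.map (η 0)) S p δ with hL
  let M : ℕ → H → ℝ≥0∞ := fun k => L^[k] fun _ => 1
  have hM0 : ∀ x, M 0 x = 1 := fun x => rfl
  have hMs : ∀ k, M (k + 1) = L (M k) := fun k => Function.iterate_succ_apply' _ _ _
  have hMm : ∀ k, Measurable (M k) := by
    intro k
    induction k with
    | zero => exact measurable_const
    | succ k ih => rw [hMs]; exact measurable_weightOp _ hS hp δ ih
  have hMb : ∀ k x, M k x ≤ ((Q ‖x‖₊ + 1 : ℝ≥0) : ℝ≥0∞) * ENNReal.ofReal (Real.exp (c * k)) := by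
    intro k x
    rcases Nat.eq_zero_or_pos k with rfl | hk
    · simp [hM0]
    · have h1 := hC.lintegral_exp_sum_eq_iterate hS hp δ k (g := fun _ => 1) measurable_const x
      simp only [mul_one] at h1
      change L^[k] (fun _ => 1) x ≤ _
      rw [hL, ← h1]
      refine (hbound k hk x).trans (mul_le_mul_left ?_ _)
      exact_mod_cast le_self_add
  let a : ℕ → ℝ≥0∞ := fun k => ENNReal.ofReal (Real.exp (-(2 * c * k)))
  let W : H → ℝ≥0∞ := fun x => ∑' k, a k * M k x
  have hWm : Measurable W := Measurable.tsum fun k => (hMm k).const_mul _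
  have hr : (ENNReal.ofReal (Real.exp (-c))) < 1 := by
    rw [← ENNReal.ofReal_one]
    exact (ENNReal.ofReal_lt_ofReal_iff one_pos).2 (by simpa using hc)
  have hWb : ∀ x, W x ≤ ((Q ‖x‖₊ + 1 : ℝ≥0) : ℝ≥0∞) * (1 - ENNReal.ofReal (Real.exp (-c)))⁻¹ := by
    intro x
    rw [← ENNReal.tsum_geometric, ← ENNReal.tsum_mul_left]
    refine ENNReal.tsum_le_tsum fun k => ?_
    calc a k * M k x ≤ a k * (((Q ‖x‖₊ + 1 : ℝ≥0) : ℝ≥0∞) * ENNReal.ofReal (Real.exp (c * k))) :=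
          mul_le_mul_right (hMb k x) _
      _ = ((Q ‖x‖₊ + 1 : ℝ≥0) : ℝ≥0∞) * (a k * ENNReal.ofReal (Real.exp (c * k))) := by ring
      _ = _ := by
        rw [← ENNReal.ofReal_mul (Real.exp_pos _).le, ← Real.exp_add,
          ← ENNReal.ofReal_pow (Real.exp_pos _).le, ← Real.exp_nat_mul]
        congr 3
        ring
  have hsub : (1 - ENNReal.ofReal (Real.exp (-c)))⁻¹ ≠ ∞ :=
    ENNReal.inv_ne_top.2 (tsub_pos_of_lt hr).ne'
  have hWtop : ∀ x, W x ≠ ∞ := fun x =>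
    ne_top_of_le_ne_top (ENNReal.mul_ne_top ENNReal.coe_ne_top hsub) (hWb x)
  have hW1 : ∀ x, 1 ≤ W x := fun x => by
    refine le_trans ?_ (ENNReal.le_tsum 0)
    simp [a, hM0]
  refine ⟨δ, Real.exp (2 * c), fun x => (W x).toReal, hδ, Real.exp_pos _, hWm.ennreal_toReal,
    fun x => ?_, fun R => ?_, fun x => ?_⟩
  · simpa using ENNReal.toReal_mono (hWtop x) (hW1 x)
  · refine ⟨(((Q R.toNNReal + 1 : ℝ≥0) : ℝ≥0∞) *
      (1 - ENNReal.ofReal (Real.exp (-c)))⁻¹).toReal, fun x hx => ?_⟩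
    refine ENNReal.toReal_mono (ENNReal.mul_ne_top ENNReal.coe_ne_top hsub)
      ((hWb x).trans (mul_le_mul_left ?_ _))
    have : ‖x‖₊ ≤ R.toNNReal := by
      rw [← norm_toNNReal]
      exact Real.toNNReal_le_toNNReal hx
    exact_mod_cast add_le_add (hQm this) le_rfl
  · calc ∫⁻ y, ENNReal.ofReal (Real.exp (δ * p (S x + y)) * (W (S x + y)).toReal) ∂(μ.map (η 0))
        = ∫⁻ y, ∑' k, ENNReal.ofReal (Real.exp (δ * p (S x + y))) * (a k * M k (S x + y))
            ∂(μ.map (η 0)) := by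
          refine lintegral_congr fun y => ?_
          rw [ENNReal.ofReal_mul (Real.exp_pos _).le, ENNReal.ofReal_toReal (hWtop _),
            ENNReal.tsum_mul_left]
      _ = ∑' k, a k * M (k + 1) x := by
          have hm : Measurable fun y => S x + y := measurable_const.add measurable_id
          have hpm : Measurable fun y => ENNReal.ofReal (Real.exp (δ * p (S x + y))) :=
            ((hp.measurable.comp hm).const_mul δ).exp.ennreal_ofReal
          have hk : ∀ k, Measurable fun y => ENNReal.ofReal (Real.exp (δ * p (S x + y))) *
              (a k * M k (S x + y)) := fun k => hpm.mul (((hMm k).comp hm).const_mul _)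
          rw [lintegral_tsum fun k => (hk k).aemeasurable]
          refine tsum_congr fun k => ?_
          rw [hMs, hL]
          simp only [weightOp]
          rw [← lintegral_const_mul' _ _ ENNReal.ofReal_ne_top]
          refine lintegral_congr fun y => ?_
          ring
      _ = ∑' k, ENNReal.ofReal (Real.exp (2 * c)) * (a (k + 1) * M (k + 1) x) := by
          refine tsum_congr fun k => ?_
          rw [← mul_assoc, ← ENNReal.ofReal_mul (Real.exp_pos _).le, ← Real.exp_add]
          simp only [a]
          congr 4
          push_cast
          ring
      _ ≤ ENNReal.ofReal (Real.exp (2 * c)) * W x := by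
          rw [ENNReal.tsum_mul_left]
          refine mul_le_mul_right ?_ _
          exact ENNReal.tsum_comp_le_tsum_of_injective (add_left_injective 1)
            fun k => a k * M k x
      _ = _ := by
          rw [ENNReal.ofReal_mul (Real.exp_pos _).le, ENNReal.ofReal_toReal (hWtop x)]

/-- Dissipativity in terms of exponential moments of `Φ`: the exponent is damped by the factor `q`
in one step. -/
theorem NoiseCondition.exists_exp_moment_le (hC : NoiseCondition μ Φ p γ e b dens ξ η)
    (hA : Dissipative S Φ) (hp0 : ∀ u, 0 ≤ p u) :
    ∃ κ C q : ℝ, 0 < κ ∧ 0 < C ∧ 0 < q ∧ q < 1 ∧ ∀ t, 0 ≤ t → t ≤ κ → ∀ x,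
      ∫⁻ y, ENNReal.ofReal (Real.exp (t * Φ (S x + y))) ∂(μ.map (η 0))
        ≤ ENNReal.ofReal (C * Real.exp (t * (q * Φ x))) := by
  obtain ⟨α, β, C, q, -, -, hCpos, hq0, hq1, hΦ, hdiss⟩ := hA.bounds
  obtain ⟨δ, hδ, hmom⟩ := hC.exp_moment
  have hΦ0 : ∀ u, 0 ≤ Φ u := fun u => by
    have := (hΦ u).1
    have := Real.rpow_nonneg (norm_nonneg u) α
    linarith
  set K := ∫⁻ u, ENNReal.ofReal (Real.exp (δ * (Φ u + p u))) ∂(μ.map (η 0)) with hK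
  refine ⟨δ / C, K.toReal + 1, q, by positivity, by positivity, hq0, hq1, fun t ht htκ x => ?_⟩
  have htC : t * C ≤ δ := by rwa [le_div_iff₀ hCpos] at htκ
  calc ∫⁻ y, ENNReal.ofReal (Real.exp (t * Φ (S x + y))) ∂(μ.map (η 0))
      ≤ ∫⁻ y, ENNReal.ofReal (Real.exp (t * (q * Φ x))) *
          ENNReal.ofReal (Real.exp (δ * (Φ y + p y))) ∂(μ.map (η 0)) := by
        refine lintegral_mono fun y => ?_
        rw [← ENNReal.ofReal_mul (Real.exp_pos _).le, ← Real.exp_add]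
        refine ENNReal.ofReal_le_ofReal (Real.exp_le_exp.2 ?_)
        have h1 := mul_le_mul_of_nonneg_left (hdiss x y) ht
        have h2 := mul_le_mul_of_nonneg_right htC (hΦ0 y)
        have h3 := mul_nonneg hδ.le (hp0 y)
        nlinarith
    _ = ENNReal.ofReal (Real.exp (t * (q * Φ x))) * K :=
        lintegral_const_mul' _ _ ENNReal.ofReal_ne_top
    _ ≤ _ := by
        rw [mul_comm, ENNReal.ofReal_mul (by positivity)]
        refine mul_le_mul_left ?_ _
        rw [← ENNReal.ofReal_toReal hmom.ne]
        exact ENNReal.ofReal_le_ofReal (by rw [ENNReal.ofReal_toReal hmom.ne]; linarith)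

/-- The weights exist, and the small weight is a Lyapunov function with an arbitrarily strong
drift outside the sublevel sets of `Φ`. -/
theorem NoiseCondition.exists_weightPair (hC : NoiseCondition μ Φ p γ e b dens ξ η)
    (hA : Dissipative S Φ) (hS : Continuous S) (hp : Continuous p) (hp0 : ∀ u, 0 ≤ p u)
    (hpb : ∀ R : ℝ, BddAbove (p '' Metric.closedBall 0 R))
    {Q : ℝ≥0 → ℝ≥0} (hQ : StabilisableWith μ S η p Q) :
    ∃ (m ω : H → ℝ) (θ C : ℝ), IsWeightPair (μ.map (η 0)) S p m ω θ C ∧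
      ∀ A : ℝ, ∃ R : ℝ, ∀ R' ≥ R, ∀ x, R' < Φ x →
        (∫ y, m (S x + y) ∂(μ.map (η 0))) * Real.exp A ≤ m x := by
  obtain ⟨δ, C₁, W, hδ, hC₁, hWm, hW1, hWb, hW⟩ :=
    hC.exists_lyapunov_of_stabilisable hS hp hQ
  obtain ⟨κ, C₂, q, hκ, hC₂, hq0, hq1, hexp⟩ := hC.exists_exp_moment_le hA hp0
  obtain ⟨α, β, C₀, -, hα, hβ, hC₀, -, -, hΦ, -⟩ := hA.bounds
  have hΦ0 : ∀ u, 0 ≤ Φ u := fun u => by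
    have := (hΦ u).1
    have := Real.rpow_nonneg (norm_nonneg u) α
    linarith
  have hW0 : ∀ x, 0 < W x := fun x => one_pos.trans_le (hW1 x)
  set θ := min (1 / 2) (δ / 4) with hθ
  have hθ0 : 0 < θ := by positivity
  have hθδ : 4 * θ ≤ δ := by have := min_le_right (1 / 2) (δ / 4); linarith
  -- the square of the large weight is the product of `f` and `g`
  let f : H → ℝ := fun x => Real.exp (2 * θ * p x) * Real.sqrt (W x)
  let g : H → ℝ := fun x => Real.exp (2 * (κ / 4) * Φ x)
  let ω : H → ℝ := fun x => Real.sqrt (f x * g x)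
  have hf0 : ∀ x, 0 ≤ f x := fun x => by positivity
  have hg0 : ∀ x, 0 ≤ g x := fun x => by positivity
  have hω2 : ∀ x, ω x ^ 2 = f x * g x := fun x => Real.sq_sqrt (mul_nonneg (hf0 x) (hg0 x))
  have hfm : Measurable f := ((hp.measurable.const_mul _).exp).mul hWm.sqrt
  have hgm : Measurable g := (hA.continuous.measurable.const_mul _).exp
  have hsW : ∀ x, 1 ≤ Real.sqrt (W x) := fun x => Real.one_le_sqrt.2 (hW1 x)
  have hf1 : ∀ x, Real.exp (2 * θ * p x) ≤ f x := fun x =>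
    le_mul_of_one_le_right (Real.exp_pos _).le (hsW x)
  have hg1 : ∀ x, 1 ≤ g x := fun x => Real.one_le_exp (by have := hΦ0 x; positivity)
  have hpx : ∀ x, 1 ≤ Real.exp (2 * θ * p x) := fun x =>
    Real.one_le_exp (by have := hp0 x; positivity)
  have hmS : ∀ x, Measurable fun y => S x + y := fun x => measurable_const.add measurable_id
  have hmoment : ∀ x, ∫⁻ y, ENNReal.ofReal (ω (S x + y) ^ 2) ∂(μ.map (η 0))
      ≤ ENNReal.ofReal (Real.sqrt (C₁ * C₂) * Real.exp (-(2 * θ * p x)) * ω x ^ 2) := by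
    intro x
    have hH := ENNReal.lintegral_mul_le_Lp_mul_Lq (μ.map (η 0)) Real.HolderConjugate.two_two
      (f := fun y => ENNReal.ofReal (f (S x + y))) (g := fun y => ENNReal.ofReal (g (S x + y)))
      (hfm.comp (hmS x)).ennreal_ofReal.aemeasurable (hgm.comp (hmS x)).ennreal_ofReal.aemeasurable
    have h1 : ∫⁻ y, ENNReal.ofReal (f (S x + y)) ^ (2 : ℝ) ∂(μ.map (η 0))
        ≤ ENNReal.ofReal (C₁ * W x) := by
      refine le_trans (lintegral_mono fun y => ?_) (hW x)
      rw [ENNReal.ofReal_rpow_of_nonneg (hf0 _) (by norm_num)]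
      refine ENNReal.ofReal_le_ofReal ?_
      rw [Real.rpow_two]
      simp only [f]
      rw [mul_pow, Real.sq_sqrt (hW0 _).le, ← Real.exp_nat_mul]
      refine mul_le_mul_of_nonneg_right (Real.exp_le_exp.2 ?_) (hW0 _).le
      push_cast
      nlinarith [hp0 (S x + y)]
    have h2 : ∫⁻ y, ENNReal.ofReal (g (S x + y)) ^ (2 : ℝ) ∂(μ.map (η 0))
        ≤ ENNReal.ofReal (C₂ * g x ^ 2) := by
      refine le_trans (lintegral_mono fun y => ?_) ((hexp κ hκ.le le_rfl x).trans ?_)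
      · rw [ENNReal.ofReal_rpow_of_nonneg (hg0 _) (by norm_num)]
        refine ENNReal.ofReal_le_ofReal ?_
        rw [Real.rpow_two]
        simp only [g]
        rw [← Real.exp_nat_mul]
        refine Real.exp_le_exp.2 (le_of_eq ?_)
        push_cast
        ring
      · refine ENNReal.ofReal_le_ofReal (mul_le_mul_of_nonneg_left ?_ hC₂.le)
        simp only [g]
        rw [← Real.exp_nat_mul]
        refine Real.exp_le_exp.2 ?_
        push_cast
        have : q * Φ x ≤ Φ x := mul_le_of_le_one_left (hΦ0 x) hq1.le
        nlinarith
    calc ∫⁻ y, ENNReal.ofReal (ω (S x + y) ^ 2) ∂(μ.map (η 0))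
        = ∫⁻ y, ENNReal.ofReal (f (S x + y)) * ENNReal.ofReal (g (S x + y)) ∂(μ.map (η 0)) := by
          refine lintegral_congr fun y => ?_
          rw [hω2, ENNReal.ofReal_mul (hf0 _)]
      _ ≤ _ := hH
      _ ≤ ENNReal.ofReal (C₁ * W x) ^ (1 / 2 : ℝ) * ENNReal.ofReal (C₂ * g x ^ 2) ^ (1 / 2 : ℝ) :=
          mul_le_mul' (ENNReal.rpow_le_rpow h1 (by norm_num))
            (ENNReal.rpow_le_rpow h2 (by norm_num))
      _ = _ := by
          have := hW0 x
          have := hg0 x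
          rw [ENNReal.ofReal_rpow_of_nonneg (by positivity) (by norm_num),
            ENNReal.ofReal_rpow_of_nonneg (by positivity) (by norm_num),
            ← ENNReal.ofReal_mul (by positivity), ← Real.sqrt_eq_rpow, ← Real.sqrt_eq_rpow,
            Real.sqrt_mul hC₁.le, Real.sqrt_mul hC₂.le, Real.sqrt_mul hC₁.le,
            Real.sqrt_sq (hg0 x), hω2]
          simp only [f]
          rw [Real.exp_neg]
          congr 1
          field_simp
  have hωm : Measurable ω := (hfm.mul hgm).sqrt
  have hbb := fun x => integrable_and_integral_le_of_lintegral_le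
    (((hωm.comp (hmS x)).pow_const 2)) (fun y => sq_nonneg (ω (S x + y)))
    (by positivity) (hmoment x)
  refine ⟨fun x => Real.exp (κ / 4 * Φ x), ω, θ, Real.sqrt (C₁ * C₂),
    { theta_pos := hθ0
      theta_le := min_le_left _ _
      const_pos := by positivity
      measurable_small := (hA.continuous.measurable.const_mul _).exp
      measurable_large := hωm
      one_le_small := fun x => Real.one_le_exp (by have := hΦ0 x; positivity)
      small_le_large := fun x => ?_
      exp_le_large := fun x => ?_
      bounded_on_balls := fun R => ?_
      integrable_sq := fun x => (hbb x).1
      integral_sq_le := fun x => (hbb x).2 }, fun A => ?_⟩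
  · refine Real.le_sqrt_of_sq_le ?_
    rw [← Real.exp_nat_mul]
    calc Real.exp ((2 : ℕ) * (κ / 4 * Φ x)) = 1 * g x := by
          simp only [g, one_mul]; congr 1; push_cast; ring
      _ ≤ f x * g x := mul_le_mul_of_nonneg_right ((hpx x).trans (hf1 x)) (hg0 x)
  · refine Real.le_sqrt_of_sq_le ?_
    rw [← Real.exp_nat_mul]
    calc Real.exp ((2 : ℕ) * (θ * p x)) = Real.exp (2 * θ * p x) * 1 := by
          rw [mul_one]; congr 1; push_cast; ring
      _ ≤ f x * g x := mul_le_mul (hf1 x) (hg1 x) zero_le_one (hf0 x)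
  · obtain ⟨B₁, hB₁⟩ := hWb R
    obtain ⟨B₂, hB₂⟩ := hpb R
    refine ⟨Real.sqrt (Real.exp (2 * θ * B₂) * Real.sqrt B₁ *
      Real.exp (2 * (κ / 4) * (C₀ * (1 + R) ^ β))), fun x hx => Real.sqrt_le_sqrt ?_⟩
    have h1 : p x ≤ B₂ := hB₂ ⟨x, by simpa using hx, rfl⟩
    have h2 : Φ x ≤ C₀ * (1 + R) ^ β := (hΦ x).2.trans (mul_le_mul_of_nonneg_left
      (Real.rpow_le_rpow (by positivity) (by linarith) hβ.le) hC₀.le)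
    have h3 := hB₁ x hx
    simp only [f, g]
    gcongr
  · -- `C₂ exp (κ/4 · q Φ + A) ≤ exp (κ/4 · Φ)` as soon as `Φ` is large
    refine ⟨(Real.log C₂ + A) / (κ / 4 * (1 - q)), fun R' hR' x hx => ?_⟩
    have h1 := integrable_and_integral_le_of_lintegral_le
      ((hA.continuous.measurable.comp (hmS x)).const_mul (κ / 4)).exp
      (fun y => (Real.exp_pos _).le) (by positivity) (hexp (κ / 4) (by positivity) (by linarith) x)
    refine (mul_le_mul_of_nonneg_right h1.2 (Real.exp_pos _).le).trans ?_
    have h2 : (Real.log C₂ + A) / (κ / 4 * (1 - q)) < Φ x := lt_of_le_of_lt hR' hx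
    rw [div_lt_iff₀ (mul_pos (by positivity) (by linarith))] at h2
    nth_rewrite 1 [← Real.exp_log hC₂]
    rw [← Real.exp_add, ← Real.exp_add]
    exact Real.exp_le_exp.2 (by nlinarith)

end Noise

/-! ### Growth of the Feynman–Kac semigroup -/

theorem le_supNormOn {α : Type*} {X : Set α} {g : α → ℝ} {B : ℝ} (hB : ∀ u ∈ X, |g u| ≤ B)
    {u : α} (hu : u ∈ X) : |g u| ≤ supNormOn X g :=
  le_csSup ⟨B, by rintro _ ⟨v, hv, rfl⟩; exact hB v hv⟩ ⟨u, hu, rfl⟩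

theorem supNormOn_le {α : Type*} {X : Set α} {g : α → ℝ} {B : ℝ} (h0 : 0 ≤ B)
    (hB : ∀ u ∈ X, |g u| ≤ B) : supNormOn X g ≤ B :=
  Real.sSup_le (by rintro _ ⟨v, hv, rfl⟩; exact hB v hv) h0

section BlockStep

variable {H : Type*} [NormedAddCommGroup H] (S : H → H) {n : ℕ} (u : Fin (n + 1) → H) (y : H)

@[simp] theorem blockStep_last : blockStep S u y (Fin.last n) = S (u (Fin.last n)) + y := by
  simp [blockStep]

@[simp] theorem blockStep_castSucc (i : Fin n) : blockStep S u y i.castSucc = u i.succ := by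
  simp [blockStep, Fin.succ]

end BlockStep

/-- The standing assumptions on the Feynman–Kac operator: a potential with values in `[0, A]`, a
pair of weights, and a drift of the small weight outside `{Φ ≤ R}` that beats the potential. -/
structure FKSetup {H : Type*} [NormedAddCommGroup H] [MeasurableSpace H] (lam : Measure H)
    (S : H → H) (Φ p m ω : H → ℝ) (θ C : ℝ) {n : ℕ} (V : (Fin (n + 1) → H) → ℝ) (A R : ℝ) :
    Prop where
  continuous_map : Continuous S
  weights : IsWeightPair lam S p m ω θ C
  measurable_potential : Measurable V
  potential_nonneg : ∀ u, 0 ≤ V u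
  potential_le : ∀ u, V u ≤ A
  drift : ∀ x, R < Φ x → (∫ y, m (S x + y) ∂lam) * Real.exp A ≤ m x

section Semigroup

variable {H : Type*} [NormedAddCommGroup H] [InnerProductSpace ℝ H] [CompleteSpace H]
  [TopologicalSpace.SeparableSpace H] [MeasurableSpace H] [BorelSpace H]
  {lam : Measure H} [IsProbabilityMeasure lam] {S : H → H} {Φ p m ω : H → ℝ} {θ C : ℝ} {n : ℕ}
  {V : (Fin (n + 1) → H) → ℝ} {A R : ℝ}

theorem IsWeightPair.one_le_large (hw : IsWeightPair lam S p m ω θ C) (x : H) : 1 ≤ ω x :=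
  (hw.one_le_small x).trans (hw.small_le_large x)

theorem IsWeightPair.integrable_large (hw : IsWeightPair lam S p m ω θ C) (x : H) :
    Integrable (fun y => ω (S x + y)) lam := by
  have hm : Measurable fun y => S x + y := measurable_const.add measurable_id
  refine (hw.integrable_sq x).mono' (hw.measurable_large.comp hm).aestronglyMeasurable
    (ae_of_all _ fun y => ?_)
  have := hw.one_le_large (S x + y)
  rw [Real.norm_of_nonneg (by linarith)]
  nlinarith

theorem IsWeightPair.integrable_small (hw : IsWeightPair lam S p m ω θ C) (x : H) :
    Integrable (fun y => m (S x + y)) lam := by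
  have hm : Measurable fun y => S x + y := measurable_const.add measurable_id
  refine (hw.integrable_large x).mono' (hw.measurable_small.comp hm).aestronglyMeasurable
    (ae_of_all _ fun y => ?_)
  have := hw.one_le_small (S x + y)
  rw [Real.norm_of_nonneg (by linarith)]
  exact hw.small_le_large _

namespace FKSetup

theorem potential_bound_nonneg (h : FKSetup lam S Φ p m ω θ C V A R) : 0 ≤ A :=
  (h.potential_nonneg 0).trans (h.potential_le 0)

theorem integrable (h : FKSetup lam S Φ p m ω θ C V A R) {g : (Fin (n + 1) → H) → ℝ}
    (hg : Measurable g) {B : ℝ} (hB : ∀ u, |g u| ≤ B) (u : Fin (n + 1) → H) :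
    Integrable (fun y => g (blockStep S u y) * Real.exp (V (blockStep S u y))) lam :=
  integrable_fkOp lam h.continuous_map h.measurable_potential hg h.potential_le hB u

theorem fkOp_mono (h : FKSetup lam S Φ p m ω θ C V A R) {f g : (Fin (n + 1) → H) → ℝ}
    (hf : Measurable f) (hg : Measurable g) {B : ℝ} (hfB : ∀ u, |f u| ≤ B) (hgB : ∀ u, |g u| ≤ B)
    (hfg : ∀ u, f u ≤ g u) (u : Fin (n + 1) → H) : fkOp lam S V f u ≤ fkOp lam S V g u :=
  integral_mono (h.integrable hf hfB u) (h.integrable hg hgB u) fun _ =>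
    mul_le_mul_of_nonneg_right (hfg _) (Real.exp_pos _).le

theorem fkOp_const_mul (c : ℝ) (g : (Fin (n + 1) → H) → ℝ) (u : Fin (n + 1) → H) :
    fkOp lam S V (fun v => c * g v) u = c * fkOp lam S V g u := by
  simp only [fkOp, mul_assoc]
  exact integral_const_mul c _

theorem iterate_spec (h : FKSetup lam S Φ p m ω θ C V A R) {g : (Fin (n + 1) → H) → ℝ}
    (hg : Measurable g) {B : ℝ} (hB : ∀ u, |g u| ≤ B) (k : ℕ) :
    Measurable ((fkOp lam S V)^[k] g) ∧
      ∀ u, |(fkOp lam S V)^[k] g u| ≤ B * Real.exp (k * A) :=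
  iterate_fkOp_spec lam h.continuous_map h.measurable_potential hg h.potential_le hB k

theorem one_spec (h : FKSetup lam S Φ p m ω θ C V A R) (k : ℕ) :
    Measurable ((fkOp lam S V)^[k] fun _ => 1) ∧
      ∀ u, |(fkOp lam S V)^[k] (fun _ => 1) u| ≤ Real.exp (k * A) := by
  simpa using h.iterate_spec (g := fun _ => (1 : ℝ)) measurable_const (B := 1) (by simp) k

theorem le_iterate_succ (h : FKSetup lam S Φ p m ω θ C V A R) (k : ℕ) (u : Fin (n + 1) → H) :
    (fkOp lam S V)^[k] (fun _ => 1) u ≤ (fkOp lam S V)^[k + 1] (fun _ => 1) u := by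
  induction k generalizing u with
  | zero =>
    have : ∫ _, (1 : ℝ) ∂lam ≤ fkOp lam S V (fun _ => 1) u :=
      integral_mono (integrable_const _) (h.integrable measurable_const (B := 1) (by simp) u)
        fun y => by simpa using h.potential_nonneg _
    simpa using this
  | succ k ih =>
    rw [Function.iterate_succ_apply', Function.iterate_succ_apply' (n := k + 1)]
    have hA := h.potential_bound_nonneg
    refine h.fkOp_mono (h.one_spec k).1 (h.one_spec (k + 1)).1 (fun v => ?_)
      (h.one_spec (k + 1)).2 ih u
    refine ((h.one_spec k).2 v).trans (Real.exp_le_exp.2 ?_)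
    push_cast
    linarith

theorem one_le_iterate (h : FKSetup lam S Φ p m ω θ C V A R) (k : ℕ) (u : Fin (n + 1) → H) :
    1 ≤ (fkOp lam S V)^[k] (fun _ => 1) u := by
  induction k with
  | zero => simp
  | succ k ih => exact ih.trans (h.le_iterate_succ k u)

theorem iterate_succ_le (h : FKSetup lam S Φ p m ω θ C V A R) (k : ℕ) (u : Fin (n + 1) → H) :
    (fkOp lam S V)^[k + 1] (fun _ => 1) u
      ≤ Real.exp A * (fkOp lam S V)^[k] (fun _ => 1) u := by
  induction k generalizing u with
  | zero =>
    have := (le_abs_self _).trans ((h.one_spec 1).2 u)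
    simpa using this
  | succ k ih =>
    have key := h.fkOp_mono (B := Real.exp A * Real.exp (((k + 1 : ℕ) : ℝ) * A)) (h.one_spec _).1
      ((h.one_spec k).1.const_mul _) (fun v => ?_) (fun v => ?_) ih u
    · simpa only [fkOp_const_mul, Function.iterate_succ_apply'] using key
    · refine ((h.one_spec _).2 v).trans (le_mul_of_one_le_left (Real.exp_pos _).le ?_)
      exact Real.one_le_exp h.potential_bound_nonneg
    · rw [abs_mul, Real.abs_exp]
      refine mul_le_mul_of_nonneg_left (((h.one_spec k).2 v).trans (Real.exp_le_exp.2 ?_))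
        (Real.exp_pos _).le
      have := h.potential_bound_nonneg
      push_cast
      linarith

theorem abs_iterate_le (h : FKSetup lam S Φ p m ω θ C V A R) {f : (Fin (n + 1) → H) → ℝ}
    (hf : Measurable f) {B : ℝ} (hB : ∀ u, |f u| ≤ B) (k : ℕ) (u : Fin (n + 1) → H) :
    |(fkOp lam S V)^[k] f u| ≤ B * (fkOp lam S V)^[k] (fun _ => 1) u := by
  induction k generalizing u with
  | zero => simpa using hB u
  | succ k ih =>
    have hB0 : 0 ≤ B := (abs_nonneg _).trans (hB u)
    have hb : ∀ v, |B * (fkOp lam S V)^[k] (fun _ => 1) v| ≤ B * Real.exp (k * A) := fun v => by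
      rw [abs_mul, abs_of_nonneg hB0]
      exact mul_le_mul_of_nonneg_left ((h.one_spec k).2 v) hB0
    rw [Function.iterate_succ_apply', Function.iterate_succ_apply', ← fkOp_const_mul, abs_le,
      ← neg_one_mul (fkOp lam S V _ u), ← fkOp_const_mul]
    constructor
    · refine h.fkOp_mono (((h.one_spec k).1.const_mul B).const_mul _) (h.iterate_spec hf hB k).1
        (fun v => ?_) (h.iterate_spec hf hB k).2 (fun v => ?_) u
      · rw [abs_mul, abs_neg, abs_one, one_mul]
        exact hb v
      · have := (abs_le.1 (ih v)).1
        linarith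
    · exact h.fkOp_mono (h.iterate_spec hf hB k).1 ((h.one_spec k).1.const_mul B)
        (h.iterate_spec hf hB k).2 hb (fun v => (abs_le.1 (ih v)).2) u

/-- The supremum of the `k`-th iterate of the Feynman–Kac operator on `1` over the states whose last
component lies in `{Φ ≤ R}`. -/
noncomputable def sup (_ : FKSetup lam S Φ p m ω θ C V A R) (k : ℕ) : ℝ :=
  supNormOn {u : Fin (n + 1) → H | Φ (u (Fin.last n)) ≤ R} ((fkOp lam S V)^[k] fun _ => 1)

theorem le_sup (h : FKSetup lam S Φ p m ω θ C V A R) (k : ℕ) {u : Fin (n + 1) → H}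
    (hu : Φ (u (Fin.last n)) ≤ R) : (fkOp lam S V)^[k] (fun _ => 1) u ≤ h.sup k :=
  (le_abs_self _).trans (le_supNormOn (fun v _ => (h.one_spec k).2 v)
    (X := {u : Fin (n + 1) → H | Φ (u (Fin.last n)) ≤ R}) hu)

theorem sup_le (h : FKSetup lam S Φ p m ω θ C V A R) (k : ℕ) {B : ℝ} (hB0 : 0 ≤ B)
    (hB : ∀ u : Fin (n + 1) → H, Φ (u (Fin.last n)) ≤ R → (fkOp lam S V)^[k] (fun _ => 1) u ≤ B) :
    h.sup k ≤ B :=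
  supNormOn_le hB0 fun u hu => by
    rw [abs_of_nonneg (zero_le_one.trans (h.one_le_iterate k u))]
    exact hB u hu

theorem one_le_sup (h : FKSetup lam S Φ p m ω θ C V A R) (h0 : Φ 0 ≤ R) (k : ℕ) : 1 ≤ h.sup k :=
  (h.one_le_iterate k 0).trans (h.le_sup k h0)

theorem sup_le_succ (h : FKSetup lam S Φ p m ω θ C V A R) (h0 : Φ 0 ≤ R) (k : ℕ) :
    h.sup k ≤ h.sup (k + 1) :=
  h.sup_le k (zero_le_one.trans (h.one_le_sup h0 _)) fun u hu =>
    (h.le_iterate_succ k u).trans (h.le_sup _ hu)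

/-- The growth condition: the small weight dominates the semigroup, relative to its supremum over
the states with last component in `{Φ ≤ R}`. -/
theorem iterate_le_sup_mul (h : FKSetup lam S Φ p m ω θ C V A R) (h0 : Φ 0 ≤ R) (k : ℕ)
    (u : Fin (n + 1) → H) :
    (fkOp lam S V)^[k] (fun _ => 1) u ≤ h.sup k * m (u (Fin.last n)) := by
  have hsup : ∀ k, 0 ≤ h.sup k := fun k => zero_le_one.trans (h.one_le_sup h0 k)
  induction k generalizing u with
  | zero =>
    exact one_le_mul_of_one_le_of_one_le (h.one_le_sup h0 0) (h.weights.one_le_small _)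
  | succ k ih =>
    by_cases hu : Φ (u (Fin.last n)) ≤ R
    · exact (h.le_sup _ hu).trans (le_mul_of_one_le_right (hsup _) (h.weights.one_le_small _))
    · rw [Function.iterate_succ_apply']
      calc fkOp lam S V ((fkOp lam S V)^[k] fun _ => 1) u
          ≤ ∫ y, h.sup k * Real.exp A * m (S (u (Fin.last n)) + y) ∂lam := by
            refine integral_mono (h.integrable (h.one_spec k).1 (h.one_spec k).2 u)
              ((h.weights.integrable_small _).const_mul _) fun y => ?_
            have h1 := ih (blockStep S u y)
            rw [blockStep_last] at h1
            have h2 := Real.exp_le_exp.2 (h.potential_le (blockStep S u y))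
            have h3 := zero_le_one.trans (h.one_le_iterate k (blockStep S u y))
            calc _ ≤ h.sup k * m (S (u (Fin.last n)) + y) * Real.exp A :=
                  mul_le_mul h1 h2 (Real.exp_pos _).le (h3.trans h1)
              _ = _ := by ring
        _ = h.sup k * ((∫ y, m (S (u (Fin.last n)) + y) ∂lam) * Real.exp A) := by
            rw [integral_const_mul]; ring
        _ ≤ h.sup k * m (u (Fin.last n)) :=
            mul_le_mul_of_nonneg_left (h.drift _ (not_le.1 hu)) (hsup k)
        _ ≤ _ := mul_le_mul_of_nonneg_right (h.sup_le_succ h0 k)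
            (zero_le_one.trans (h.weights.one_le_small _))

end FKSetup

end Semigroup

/-! ### The Hölder estimate -/

theorem integral_mul_le_sqrt_mul_sqrt {α : Type*} [MeasurableSpace α] {μ : Measure α}
    {f g : α → ℝ} (hf : Measurable f) (hg : Measurable g) (hf0 : ∀ x, 0 ≤ f x)
    (hg0 : ∀ x, 0 ≤ g x) (hf2 : Integrable (fun x => f x ^ 2) μ)
    (hg2 : Integrable (fun x => g x ^ 2) μ) :
    ∫ x, f x * g x ∂μ ≤ Real.sqrt (∫ x, f x ^ 2 ∂μ) * Real.sqrt (∫ x, g x ^ 2 ∂μ) := by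
  have hf' : MemLp f (ENNReal.ofReal 2) μ := by
    simpa using (memLp_two_iff_integrable_sq hf.aestronglyMeasurable).2 hf2
  have hg' : MemLp g (ENNReal.ofReal 2) μ := by
    simpa using (memLp_two_iff_integrable_sq hg.aestronglyMeasurable).2 hg2
  have := integral_mul_le_Lp_mul_Lq_of_nonneg Real.HolderConjugate.two_two (ae_of_all _ hf0)
    (ae_of_all _ hg0) hf' hg'
  simpa [Real.sqrt_eq_rpow] using this

theorem integrable_mul_of_sq {α : Type*} [MeasurableSpace α] {μ : Measure α}
    {f g : α → ℝ} (hf : Measurable f) (hg : Measurable g)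
    (hf2 : Integrable (fun x => f x ^ 2) μ)
    (hg2 : Integrable (fun x => g x ^ 2) μ) : Integrable (fun x => f x * g x) μ :=
  ((memLp_two_iff_integrable_sq hf.aestronglyMeasurable).2 hf2).integrable_mul
    ((memLp_two_iff_integrable_sq hg.aestronglyMeasurable).2 hg2)

/-- The square root of a quantity below `1` is dominated by any power with exponent in
`[0, 1/2]`. -/
theorem sqrt_le_rpow {t z θ : ℝ} (ht1 : t ≤ 1) (htz : t ≤ z) (hz : 0 ≤ z) (hθ0 : 0 ≤ θ)
    (hθ : θ ≤ 1 / 2) : Real.sqrt t ≤ z ^ θ := by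
  rcases le_or_gt z 1 with h | h
  · refine (Real.sqrt_le_sqrt htz).trans ?_
    rw [Real.sqrt_eq_rpow]
    rcases hz.eq_or_lt with rfl | hz'
    · rw [Real.zero_rpow (by norm_num)]
      exact Real.rpow_nonneg le_rfl _
    · exact Real.rpow_le_rpow_of_exponent_ge hz' h hθ
  · exact (Real.sqrt_le_one.2 ht1).trans (Real.one_le_rpow h.le hθ0)

/-- A Hölder-type distance on `H^ℓ` with geometric weights, which the shift of the components
contracts. -/
noncomputable def blockDist {H : Type*} [NormedAddCommGroup H] (θ Γ : ℝ) {ℓ : ℕ}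
    (u v : Fin ℓ → H) : ℝ :=
  ∑ i : Fin ℓ, Γ ^ (i : ℕ) * ‖u i - v i‖ ^ θ

theorem blockDist_nonneg {H : Type*} [NormedAddCommGroup H] {θ Γ : ℝ} (hΓ : 0 ≤ Γ) {ℓ : ℕ}
    (u v : Fin ℓ → H) : 0 ≤ blockDist θ Γ u v :=
  Finset.sum_nonneg fun _ _ => mul_nonneg (pow_nonneg hΓ _) (Real.rpow_nonneg (norm_nonneg _) _)

theorem blockDist_one_le {H : Type*} [NormedAddCommGroup H] {θ Γ : ℝ} (hΓ : 1 ≤ Γ) {ℓ : ℕ}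
    (u v : Fin ℓ → H) : blockDist θ 1 u v ≤ blockDist θ Γ u v := by
  refine Finset.sum_le_sum fun i _ => mul_le_mul_of_nonneg_right ?_
    (Real.rpow_nonneg (norm_nonneg _) _)
  rw [one_pow]
  exact one_le_pow₀ hΓ

theorem blockDist_blockStep_le {H : Type*} [NormedAddCommGroup H] (S : H → H) {θ Γ : ℝ} (hΓ : 0 < Γ)
    {n : ℕ} (u v : Fin (n + 1) → H) (y a : H) :
    blockDist θ Γ (blockStep S u y) (blockStep S v (y + a))
      ≤ Γ⁻¹ * blockDist θ Γ u v
        + Γ ^ n * ‖S (u (Fin.last n)) - S (v (Fin.last n)) - a‖ ^ θ := by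
  have h1 : S (u (Fin.last n)) + y - (S (v (Fin.last n)) + (y + a))
      = S (u (Fin.last n)) - S (v (Fin.last n)) - a := by abel
  rw [blockDist, blockDist, Fin.sum_univ_castSucc,
    Fin.sum_univ_succ (f := fun i : Fin (n + 1) => Γ ^ (i : ℕ) * ‖u i - v i‖ ^ θ), mul_add,
    Finset.mul_sum]
  simp only [blockStep_castSucc, blockStep_last, Fin.val_castSucc, Fin.val_last, h1]
  refine add_le_add (le_add_of_nonneg_of_le (by positivity)
    (Finset.sum_le_sum fun i _ => ?_)) le_rfl
  rw [Fin.val_succ, pow_succ', mul_assoc Γ, inv_mul_cancel_left₀ hΓ.ne']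

/-- The kick `y` for the first trajectory can be coupled with the kick `y + a` for the second one
so that the images of two points get close to each other, at the price of a remainder whose mass
is controlled by the distance of the points. -/
def SqueezingCoupling {H : Type*} [NormedAddCommGroup H] [MeasurableSpace H] (lam : Measure H)
    (S : H → H) (p : H → ℝ) : Prop :=
  ∀ ε : ℝ, 0 < ε → ∃ K : ℝ, 0 ≤ K ∧ ∀ x y : H, ∃ (a : H) (ν μ₁ μ₂ : Measure H),
    lam = ν + μ₁ ∧ lam = ν.map (fun z => z + a) + μ₂ ∧
    μ₁ Set.univ ≤ ENNReal.ofReal (K * (Real.exp (p x + p y) * ‖x - y‖)) ∧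
    μ₂ Set.univ ≤ ENNReal.ofReal (K * (Real.exp (p x + p y) * ‖x - y‖)) ∧
    ‖S x - S y - a‖ ≤ ε * (Real.exp (p x + p y) * ‖x - y‖)

section Semigroup

variable {H : Type*} [NormedAddCommGroup H] [InnerProductSpace ℝ H] [CompleteSpace H]
  [TopologicalSpace.SeparableSpace H] [MeasurableSpace H] [BorelSpace H]
  {lam : Measure H} [IsProbabilityMeasure lam] {S : H → H} {Φ p m ω : H → ℝ} {θ C : ℝ} {n : ℕ}
  {V : (Fin (n + 1) → H) → ℝ} {A R : ℝ}

theorem IsWeightPair.sqrt_integral_le (hw : IsWeightPair lam S p m ω θ C) (x : H) {ρ : Measure H}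
    (hρ : ρ ≤ lam) :
    Real.sqrt (∫ y, ω (S x + y) ^ 2 ∂ρ) ≤ Real.sqrt C * Real.exp (-(θ * p x)) * ω x := by
  have h1 : ∫ y, ω (S x + y) ^ 2 ∂ρ ≤ ∫ y, ω (S x + y) ^ 2 ∂lam :=
    integral_mono_measure hρ (ae_of_all _ fun y => sq_nonneg _) (hw.integrable_sq x)
  have hω := zero_le_one.trans (hw.one_le_large x)
  refine (Real.sqrt_le_sqrt (h1.trans (hw.integral_sq_le x))).trans (le_of_eq ?_)
  have : C * Real.exp (-(2 * θ * p x)) * ω x ^ 2 = C * (Real.exp (-(θ * p x)) * ω x) ^ 2 := by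
    rw [mul_pow, ← Real.exp_nat_mul]
    push_cast
    ring_nf
  rw [this, Real.sqrt_mul hw.const_pos.le, Real.sqrt_sq (by positivity)]
  ring

/-- The contribution of the remainder of a coupling. -/
theorem IsWeightPair.integral_small_le (hw : IsWeightPair lam S p m ω θ C) (x : H) {ρ : Measure H}
    (hρ : ρ ≤ lam) {z : ℝ} (hz : 0 ≤ z) (hmass : ρ Set.univ ≤ ENNReal.ofReal z) :
    ∫ y, m (S x + y) ∂ρ ≤ Real.sqrt C * Real.exp (-(θ * p x)) * ω x * z ^ θ := by
  have : IsFiniteMeasure ρ := isFiniteMeasure_of_le lam hρ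
  have hm : Measurable fun y => S x + y := measurable_const.add measurable_id
  have hω0 : ∀ x, 0 ≤ ω x := fun x => zero_le_one.trans (hw.one_le_large x)
  have hint := (hw.integrable_sq x).mono_measure hρ
  have h1 : ∫ y, m (S x + y) ∂ρ ≤ ∫ y, ω (S x + y) * 1 ∂ρ := by
    simp only [mul_one]
    exact integral_mono ((hw.integrable_small x).mono_measure hρ)
      ((hw.integrable_large x).mono_measure hρ) fun y => hw.small_le_large _
  have h2 := integral_mul_le_sqrt_mul_sqrt (μ := ρ) (hw.measurable_large.comp hm)
    (measurable_const (a := (1 : ℝ))) (fun y => hω0 _) (fun _ => zero_le_one) hint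
    (integrable_const _)
  have h3 : Real.sqrt (∫ _, (1 : ℝ) ^ 2 ∂ρ) ≤ z ^ θ := by
    simp only [one_pow, integral_const, smul_eq_mul, mul_one]
    refine sqrt_le_rpow ?_ ?_ hz hw.theta_pos.le hw.theta_le
    · simpa [Measure.real] using ENNReal.toReal_mono ENNReal.one_ne_top
        ((hρ Set.univ).trans_eq measure_univ)
    · exact ENNReal.toReal_le_of_le_ofReal hz hmass
  refine h1.trans (h2.trans (mul_le_mul (hw.sqrt_integral_le x hρ) h3 (Real.sqrt_nonneg _) ?_))
  have := hω0 x
  positivity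

/-- The contribution of the coupled part: the product of the large weights has an expectation
that gains the factor `exp (-θ (p x + p y))`. -/
theorem IsWeightPair.integral_mul_large_le (hw : IsWeightPair lam S p m ω θ C) (x y a : H)
    {ν : Measure H} (hν : ν ≤ lam) (hνa : ν.map (fun z => z + a) ≤ lam) :
    Integrable (fun z => ω (S x + z) * ω (S y + (z + a))) ν ∧
    ∫ z, ω (S x + z) * ω (S y + (z + a)) ∂ν
      ≤ C * Real.exp (-(θ * (p x + p y))) * (ω x * ω y) := by
  have hm : ∀ x, Measurable fun y => S x + y := fun x => measurable_const.add measurable_id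
  have ha : Measurable fun z : H => z + a := measurable_id.add measurable_const
  have hω0 : ∀ x, 0 ≤ ω x := fun x => zero_le_one.trans (hw.one_le_large x)
  have hsq : Measurable fun z => ω (S y + z) ^ 2 := (hw.measurable_large.comp (hm y)).pow_const 2
  have hi1 := (hw.integrable_sq x).mono_measure hν
  have hi2 := (hw.integrable_sq y).mono_measure hνa
  have h2 : ∫ z, ω (S y + (z + a)) ^ 2 ∂ν = ∫ z, ω (S y + z) ^ 2 ∂(ν.map fun z => z + a) :=
    (integral_map ha.aemeasurable hsq.aestronglyMeasurable).symm
  rw [integrable_map_measure hsq.aestronglyMeasurable ha.aemeasurable] at hi2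
  have hm1 : Measurable fun z => ω (S x + z) := hw.measurable_large.comp (hm x)
  have hm2 : Measurable fun z => ω (S y + (z + a)) := hw.measurable_large.comp ((hm y).comp ha)
  refine ⟨integrable_mul_of_sq hm1 hm2 hi1 hi2, ?_⟩
  refine (integral_mul_le_sqrt_mul_sqrt hm1 hm2 (fun _ => hω0 _) (fun _ => hω0 _) hi1 hi2).trans ?_
  rw [h2]
  have h3 := hω0 x
  refine (mul_le_mul (hw.sqrt_integral_le x hν) (hw.sqrt_integral_le y hνa) (Real.sqrt_nonneg _)
    (by positivity)).trans (le_of_eq ?_)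
  have : Real.exp (-(θ * (p x + p y))) = Real.exp (-(θ * p x)) * Real.exp (-(θ * p y)) := by
    rw [← Real.exp_add]; ring_nf
  rw [this]
  nth_rewrite 3 [← Real.mul_self_sqrt hw.const_pos.le]
  ring

theorem abs_integral_sub_integral_le {F G : H → ℝ} (hF : Integrable F lam) (hG : Integrable G lam)
    (hGm : Measurable G)
    {a : H} {ν μ₁ μ₂ : Measure H} (h1 : lam = ν + μ₁) (h2 : lam = ν.map (fun z => z + a) + μ₂) :
    |∫ y, F y ∂lam - ∫ y, G y ∂lam|
      ≤ ∫ y, |F y - G (y + a)| ∂ν + ∫ y, |F y| ∂μ₁ + ∫ y, |G y| ∂μ₂ := by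
  have ha : Measurable fun z : H => z + a := measurable_id.add measurable_const
  have hF' := hF
  have hG' := hG
  rw [h1, integrable_add_measure] at hF'
  rw [h2, integrable_add_measure, integrable_map_measure hGm.aestronglyMeasurable
    ha.aemeasurable] at hG'
  have e1 : ∫ y, F y ∂lam = ∫ y, F y ∂ν + ∫ y, F y ∂μ₁ := by
    conv_lhs => rw [h1]
    exact integral_add_measure hF'.1 hF'.2
  have e2 : ∫ y, G y ∂lam = ∫ y, G (y + a) ∂ν + ∫ y, G y ∂μ₂ := by
    conv_lhs => rw [h2]
    rw [integral_add_measure ((integrable_map_measure hGm.aestronglyMeasurable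
      ha.aemeasurable).2 hG'.1) hG'.2, integral_map ha.aemeasurable hGm.aestronglyMeasurable]
  have e3 : ∫ y, F y - G (y + a) ∂ν = ∫ y, F y ∂ν - ∫ y, G (y + a) ∂ν :=
    integral_sub hF'.1 hG'.1
  have e4 : ∫ y, F y ∂lam - ∫ y, G y ∂lam
      = ∫ y, (F y - G (y + a)) ∂ν + ∫ y, F y ∂μ₁ - ∫ y, G y ∂μ₂ := by
    rw [e1, e2, e3]; ring
  rw [e4]
  have i1 := abs_integral_le_integral_abs (μ := ν) (f := fun y => F y - G (y + a))
  have i2 := abs_integral_le_integral_abs (μ := μ₁) (f := F)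
  have i3 := abs_integral_le_integral_abs (μ := μ₂) (f := G)
  have i4 := abs_sub (∫ y, (F y - G (y + a)) ∂ν + ∫ y, F y ∂μ₁) (∫ y, G y ∂μ₂)
  have i5 := abs_add_le (∫ y, (F y - G (y + a)) ∂ν) (∫ y, F y ∂μ₁)
  linarith

/-- One step of the Hölder estimate: the constant in front of `blockDist` is divided by `Γ`, and the
constant in front of the distance of the last components is multiplied by `ε ^ θ`, up to terms that
do not depend on that constant. -/
theorem FKSetup.abs_fkOp_sub_le (h : FKSetup lam S Φ p m ω θ C V A R) (hp0 : ∀ x, 0 ≤ p x)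
    {g : (Fin (n + 1) → H) → ℝ} (hg : Measurable g) {B : ℝ} (hB : ∀ w, |g w| ≤ B)
    {K κ κ' Γ L ε Kc : ℝ} (hK : 0 ≤ K) (hκ : 0 ≤ κ) (hκ' : 0 ≤ κ') (hΓ : 1 ≤ Γ) (hL : 0 ≤ L)
    (hε : 0 ≤ ε) (hKc : 0 ≤ Kc)
    (hgm : ∀ w, |g w| ≤ K * m (w (Fin.last n)))
    (hgD : ∀ w w', |g w - g w'| ≤ K * (ω (w (Fin.last n)) * ω (w' (Fin.last n)) *
      (κ * blockDist θ Γ w w' + κ' * ‖w (Fin.last n) - w' (Fin.last n)‖ ^ θ)))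
    (hVL : ∀ w w', |Real.exp (V w) - Real.exp (V w')| ≤ L * blockDist θ 1 w w')
    (u v : Fin (n + 1) → H) {x y : H} (hx : u (Fin.last n) = x) (hy : v (Fin.last n) = y)
    {a : H} {ν μ₁ μ₂ : Measure H} (h1 : lam = ν + μ₁) (h2 : lam = ν.map (fun z => z + a) + μ₂)
    (hμ₁ : μ₁ Set.univ ≤ ENNReal.ofReal (Kc * (Real.exp (p x + p y) * ‖x - y‖)))
    (hμ₂ : μ₂ Set.univ ≤ ENNReal.ofReal (Kc * (Real.exp (p x + p y) * ‖x - y‖)))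
    (ha : ‖S x - S y - a‖ ≤ ε * (Real.exp (p x + p y) * ‖x - y‖)) :
    |fkOp lam S V g u - fkOp lam S V g v| ≤ K * (ω x * ω y *
      (C * (Real.exp A * κ + L) * (Γ⁻¹ * blockDist θ Γ u v) +
        (C * (Real.exp A * κ + L) * (Γ ^ n * ε ^ θ) + C * (Real.exp A * κ') * ε ^ θ
          + 2 * (Real.exp A * Real.sqrt C * Kc ^ θ)) * ‖x - y‖ ^ θ)) := by
  have hw := h.weights
  have hC := hw.const_pos
  have hθ := hw.theta_pos
  have hω1 := hw.one_le_large
  have hω0 : ∀ x, 0 ≤ ω x := fun x => zero_le_one.trans (hω1 x)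
  have hΓ0 : 0 < Γ := one_pos.trans_le hΓ
  have hA : 0 < Real.exp A := Real.exp_pos A
  set d := ‖x - y‖ ^ θ with hd
  have hd0 : 0 ≤ d := Real.rpow_nonneg (norm_nonneg _) _
  set D := ‖S x - S y - a‖ ^ θ with hD
  have hD0 : 0 ≤ D := Real.rpow_nonneg (norm_nonneg _) _
  set P := Real.exp (θ * (p x + p y)) with hP
  have hPq : Real.exp (-(θ * (p x + p y))) * P = 1 := by
    rw [hP, ← Real.exp_add]; simp
  have hpow : ∀ c, 0 ≤ c → (c * (Real.exp (p x + p y) * ‖x - y‖)) ^ θ = c ^ θ * (P * d) := by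
    intro c hc
    rw [Real.mul_rpow hc (by positivity), Real.mul_rpow (Real.exp_pos _).le (norm_nonneg _),
      ← Real.exp_mul, hP, mul_comm θ]
  have hDε : D ≤ ε ^ θ * (P * d) := by
    rw [← hpow ε hε]
    exact Real.rpow_le_rpow (norm_nonneg _) ha hθ.le
  set q := Real.exp (-(θ * (p x + p y))) with hq
  have hq0 : 0 < q := Real.exp_pos _
  have hq1 : q ≤ 1 := Real.exp_le_one_iff.2 (by
    have := hp0 x
    have := hp0 y
    have : 0 ≤ θ * (p x + p y) := by positivity
    linarith)
  have hqD : q * D ≤ ε ^ θ * d := by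
    calc q * D ≤ q * (ε ^ θ * (P * d)) := mul_le_mul_of_nonneg_left hDε hq0.le
      _ = (q * P) * (ε ^ θ * d) := by ring
      _ = _ := by rw [hPq, one_mul]
  set F : H → ℝ := fun z => g (blockStep S u z) * Real.exp (V (blockStep S u z)) with hF
  set G : H → ℝ := fun z => g (blockStep S v z) * Real.exp (V (blockStep S v z)) with hG
  have hGm : Measurable G := by
    have hm : Measurable fun z => blockStep S v z :=
      (measurable_blockStep h.continuous_map).comp measurable_prodMk_left
    exact (hg.comp hm).mul (h.measurable_potential.comp hm).exp
  have hsplit := abs_integral_sub_integral_le (h.integrable hg hB u) (h.integrable hg hB v) hGm h1 h2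
  have hν : ν ≤ lam := h1 ▸ Measure.le_add_right le_rfl
  have hνa : ν.map (fun z => z + a) ≤ lam := by
    conv_rhs => rw [h2]
    exact Measure.le_add_right le_rfl
  have hμ₁' : μ₁ ≤ lam := h1 ▸ Measure.le_add_left le_rfl
  have hμ₂' : μ₂ ≤ lam := by
    conv_rhs => rw [h2]
    exact Measure.le_add_left le_rfl
  -- the coupled part
  set T := Γ⁻¹ * blockDist θ Γ u v + Γ ^ n * D with hT
  have hpart : ∫ z, |F z - G (z + a)| ∂ν
      ≤ K * ((Real.exp A * κ + L) * T + Real.exp A * κ' * D) * (C * q * (ω x * ω y)) := by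
    obtain ⟨hi, hle⟩ := hw.integral_mul_large_le x y a hν hνa
    have hpt : ∀ z, |F z - G (z + a)| ≤ K * ((Real.exp A * κ + L) * T + Real.exp A * κ' * D)
        * (ω (S x + z) * ω (S y + (z + a))) := by
      intro z
      set w := blockStep S u z with hw_def
      set w' := blockStep S v (z + a) with hw'_def
      have hwl : w (Fin.last n) = S x + z := by rw [hw_def, blockStep_last, hx]
      have hwl' : w' (Fin.last n) = S y + (z + a) := by rw [hw'_def, blockStep_last, hy]
      have hT_le : blockDist θ Γ w w' ≤ T := by
        have := blockDist_blockStep_le S (θ := θ) hΓ0 u v z a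
        rwa [hx, hy] at this
      have hlast : ‖w (Fin.last n) - w' (Fin.last n)‖ ^ θ = D := by
        rw [hwl, hwl', hD]
        congr 2
        abel
      have e1 := hgD w w'
      rw [hlast, hwl, hwl'] at e1
      have e2 := hgm w'
      rw [hwl'] at e2
      have e3 := (hVL w w').trans (mul_le_mul_of_nonneg_left ((blockDist_one_le hΓ w w').trans hT_le) hL)
      have e4 : Real.exp (V w) ≤ Real.exp A := Real.exp_le_exp.2 (h.potential_le w)
      have e5 : m (S y + (z + a)) ≤ ω (S x + z) * ω (S y + (z + a)) :=
        (hw.small_le_large _).trans (le_mul_of_one_le_left (hω0 _) (hω1 _))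
      have hωω : 0 ≤ ω (S x + z) * ω (S y + (z + a)) := mul_nonneg (hω0 _) (hω0 _)
      have hT0 : 0 ≤ T := (blockDist_nonneg hΓ0.le w w').trans hT_le
      calc |F z - G (z + a)|
          = |(g w - g w') * Real.exp (V w) + g w' * (Real.exp (V w) - Real.exp (V w'))| := by
            simp only [hF, hG, ← hw_def, ← hw'_def]; ring_nf
        _ ≤ |g w - g w'| * Real.exp (V w) + |g w'| * |Real.exp (V w) - Real.exp (V w')| := by
            refine (abs_add_le _ _).trans (le_of_eq ?_)
            rw [abs_mul, abs_mul, Real.abs_exp]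
        _ ≤ (K * (ω (S x + z) * ω (S y + (z + a)) * (κ * T + κ' * D))) * Real.exp A
            + (K * (ω (S x + z) * ω (S y + (z + a)))) * (L * T) := by
            refine add_le_add (mul_le_mul (e1.trans ?_) e4 (Real.exp_pos _).le ?_)
              (mul_le_mul (e2.trans (mul_le_mul_of_nonneg_left e5 hK)) e3 (abs_nonneg _) ?_)
            · gcongr
            · positivity
            · positivity
        _ = _ := by ring
    calc ∫ z, |F z - G (z + a)| ∂ν
        ≤ ∫ z, K * ((Real.exp A * κ + L) * T + Real.exp A * κ' * D)
            * (ω (S x + z) * ω (S y + (z + a))) ∂ν :=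
          integral_mono_of_nonneg (ae_of_all _ fun _ => abs_nonneg _) (hi.const_mul _)
            (ae_of_all _ hpt)
      _ = K * ((Real.exp A * κ + L) * T + Real.exp A * κ' * D)
            * ∫ z, ω (S x + z) * ω (S y + (z + a)) ∂ν := integral_const_mul _ _
      _ ≤ _ := by
          have : 0 ≤ T := by
            have := blockDist_nonneg (θ := θ) hΓ0.le u v
            positivity
          exact mul_le_mul_of_nonneg_left hle (by positivity)
  -- the remainders
  have hrest : ∀ (w : Fin (n + 1) → H) (x y : H), w (Fin.last n) = x →
      Real.exp (-(θ * p x)) * P ≤ ω y → ∀ ρ : Measure H, ρ ≤ lam →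
      ρ Set.univ ≤ ENNReal.ofReal (Kc * (Real.exp (p (u (Fin.last n)) + p (v (Fin.last n))) *
        ‖u (Fin.last n) - v (Fin.last n)‖)) →
      ∫ z, |g (blockStep S w z) * Real.exp (V (blockStep S w z))| ∂ρ
        ≤ K * (ω x * ω y * (Real.exp A * Real.sqrt C * Kc ^ θ * d)) := by
    intro w x' y' hwx hxy ρ hρ hmass
    rw [hx, hy] at hmass
    have e1 := hw.integral_small_le x' hρ (by positivity) hmass
    rw [hpow Kc hKc] at e1
    calc ∫ z, |g (blockStep S w z) * Real.exp (V (blockStep S w z))| ∂ρ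
        ≤ ∫ z, K * Real.exp A * m (S x' + z) ∂ρ := by
          refine integral_mono_of_nonneg (ae_of_all _ fun _ => abs_nonneg _)
            (((hw.integrable_small x').mono_measure hρ).const_mul _) (ae_of_all _ fun z => ?_)
          have e2 := hgm (blockStep S w z)
          rw [blockStep_last, hwx] at e2
          have e3 := Real.exp_le_exp.2 (h.potential_le (blockStep S w z))
          simp only [abs_mul, Real.abs_exp]
          calc _ ≤ K * m (S x' + z) * Real.exp A :=
                mul_le_mul e2 e3 (Real.exp_pos _).le ((abs_nonneg _).trans e2)
            _ = _ := by ring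
      _ = K * Real.exp A * ∫ z, m (S x' + z) ∂ρ := integral_const_mul _ _
      _ ≤ K * Real.exp A * (Real.sqrt C * Real.exp (-(θ * p x')) * ω x' * (Kc ^ θ * (P * d))) :=
          mul_le_mul_of_nonneg_left e1 (by positivity)
      _ = K * Real.exp A * Real.sqrt C * ω x' * Kc ^ θ * d * (Real.exp (-(θ * p x')) * P) := by ring
      _ ≤ K * Real.exp A * Real.sqrt C * ω x' * Kc ^ θ * d * ω y' := by
          have := hω0 x'
          exact mul_le_mul_of_nonneg_left hxy (by positivity)
      _ = _ := by ring
  have hr1 := hrest u x y hx (by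
    rw [hP, ← Real.exp_add]
    refine le_of_eq_of_le ?_ (hw.exp_le_large y)
    congr 1; ring) μ₁ hμ₁' (by rw [hx, hy]; exact hμ₁)
  have hr2 := hrest v y x hy (by
    rw [hP, ← Real.exp_add]
    refine le_of_eq_of_le ?_ (hw.exp_le_large x)
    congr 1; ring) μ₂ hμ₂' (by rw [hx, hy]; exact hμ₂)
  have hqT : q * ((Real.exp A * κ + L) * T + Real.exp A * κ' * D)
      ≤ (Real.exp A * κ + L) * (Γ⁻¹ * blockDist θ Γ u v + Γ ^ n * (ε ^ θ * d))
        + Real.exp A * κ' * (ε ^ θ * d) := by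
    have hb := blockDist_nonneg (θ := θ) hΓ0.le u v
    calc q * ((Real.exp A * κ + L) * T + Real.exp A * κ' * D)
        = (Real.exp A * κ + L) * (q * (Γ⁻¹ * blockDist θ Γ u v) + Γ ^ n * (q * D))
          + Real.exp A * κ' * (q * D) := by rw [hT]; ring
      _ ≤ _ := by
        have : q * (Γ⁻¹ * blockDist θ Γ u v) ≤ Γ⁻¹ * blockDist θ Γ u v :=
          mul_le_of_le_one_left (by positivity) hq1
        gcongr
  have hωxy : 0 ≤ ω x * ω y := mul_nonneg (hω0 x) (hω0 y)
  have hfinal := mul_le_mul_of_nonneg_left hqT (mul_nonneg (mul_nonneg hK hC.le) hωxy)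
  calc |fkOp lam S V g u - fkOp lam S V g v| ≤ _ := hsplit
    _ ≤ K * ((Real.exp A * κ + L) * T + Real.exp A * κ' * D) * (C * q * (ω x * ω y))
        + K * (ω x * ω y * (Real.exp A * Real.sqrt C * Kc ^ θ * d))
        + K * (ω y * ω x * (Real.exp A * Real.sqrt C * Kc ^ θ * d)) :=
        add_le_add (add_le_add hpart hr1) hr2
    _ = K * C * (ω x * ω y) * (q * ((Real.exp A * κ + L) * T + Real.exp A * κ' * D))
        + 2 * (K * (ω x * ω y * (Real.exp A * Real.sqrt C * Kc ^ θ * d))) := by ring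
    _ ≤ _ := add_le_add hfinal le_rfl
    _ = _ := by ring

/-- The Hölder estimate for the iterates of the Feynman–Kac operator, uniform in time after
normalisation by the supremum of the semigroup. -/
theorem FKSetup.exists_holder (h : FKSetup lam S Φ p m ω θ C V A R) (hp0 : ∀ x, 0 ≤ p x)
    (h0 : Φ 0 ≤ R) (hsq : SqueezingCoupling lam S p) {L : ℝ} (hL : 0 ≤ L)
    (hVL : ∀ w w', |Real.exp (V w) - Real.exp (V w')| ≤ L * blockDist θ 1 w w')
    {f : (Fin (n + 1) → H) → ℝ} (hf : Measurable f) {B : ℝ} (hB : ∀ w, |f w| ≤ B) {Lf : ℝ}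
    (hLf : 0 ≤ Lf) (hfL : ∀ w w', |f w - f w'| ≤ Lf * blockDist θ 1 w w') :
    ∃ Γ K : ℝ, 0 ≤ Γ ∧ 0 ≤ K ∧ ∀ (k : ℕ) (u v : Fin (n + 1) → H),
      |(fkOp lam S V)^[k] f u - (fkOp lam S V)^[k] f v|
        ≤ h.sup k * (ω (u (Fin.last n)) * ω (v (Fin.last n)) * (K * blockDist θ Γ u v)) := by
  have hw := h.weights
  have hC := hw.const_pos
  have hθ := hw.theta_pos
  have hω1 := hw.one_le_large
  have hω0 : ∀ x, 0 ≤ ω x := fun x => zero_le_one.trans (hω1 x)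
  have hA : 0 < Real.exp A := Real.exp_pos A
  -- `Γ` absorbs the expansion of the estimate in the components that are only shifted, and `ε`
  -- makes the estimate contract in the last component
  set Γ := C * (Real.exp A + 1) + 1 with hΓ
  have hΓ1 : 1 ≤ Γ := by rw [hΓ]; have : 0 ≤ C * (Real.exp A + 1) := by positivity
                         linarith
  have hΓ0 : 0 < Γ := one_pos.trans_le hΓ1
  set ε := (1 / (2 * (C * Real.exp A))) ^ θ⁻¹ with hεdef
  have hε : 0 < ε := by positivity
  have hεθ : ε ^ θ = 1 / (2 * (C * Real.exp A)) := by
    rw [hεdef, ← Real.rpow_mul (by positivity), inv_mul_cancel₀ hθ.ne', Real.rpow_one]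
  obtain ⟨Kc, hKc, hcouple⟩ := hsq ε hε
  set κ := L + Lf with hκdef
  have hκ : 0 ≤ κ := add_nonneg hL hLf
  set J := C * (Real.exp A * κ + L) * (Γ ^ n * ε ^ θ) + 2 * (Real.exp A * Real.sqrt C * Kc ^ θ)
    with hJ
  have hJ0 : 0 ≤ J := by positivity
  set B' := max B 1 with hB'
  have hB'1 : 1 ≤ B' := le_max_right _ _
  have hsup : ∀ k, 1 ≤ h.sup k := h.one_le_sup h0
  have main : ∀ (k : ℕ) (u v : Fin (n + 1) → H),
      |(fkOp lam S V)^[k] f u - (fkOp lam S V)^[k] f v|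
        ≤ (h.sup k * B') * (ω (u (Fin.last n)) * ω (v (Fin.last n)) *
          (κ * blockDist θ Γ u v + 2 * J * ‖u (Fin.last n) - v (Fin.last n)‖ ^ θ)) := by
    intro k
    induction k with
    | zero =>
      intro u v
      have hb := blockDist_nonneg (θ := θ) hΓ0.le u v
      have e1 : |f u - f v| ≤ κ * blockDist θ Γ u v :=
        (hfL u v).trans (mul_le_mul (by linarith) (blockDist_one_le hΓ1 u v)
          (blockDist_nonneg zero_le_one u v) hκ)
      refine e1.trans ?_
      have e2 : 1 ≤ ω (u (Fin.last n)) * ω (v (Fin.last n)) :=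
        one_le_mul_of_one_le_of_one_le (hω1 _) (hω1 _)
      have e3 : 1 ≤ h.sup 0 * B' := one_le_mul_of_one_le_of_one_le (hsup 0) hB'1
      have e4 : 0 ≤ 2 * J * ‖u (Fin.last n) - v (Fin.last n)‖ ^ θ := by positivity
      calc κ * blockDist θ Γ u v
          ≤ κ * blockDist θ Γ u v + 2 * J * ‖u (Fin.last n) - v (Fin.last n)‖ ^ θ := by linarith
        _ ≤ _ := (le_mul_of_one_le_left (by positivity) e2)
        _ ≤ _ := (le_mul_of_one_le_left (by positivity) e3)
    | succ k ih =>
      intro u v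
      rw [Function.iterate_succ_apply']
      obtain ⟨a, ν, μ₁, μ₂, h1, h2, hμ₁, hμ₂, ha⟩ := hcouple (u (Fin.last n)) (v (Fin.last n))
      have hgm : ∀ w, |(fkOp lam S V)^[k] f w| ≤ (h.sup k * B') * m (w (Fin.last n)) := fun w => by
        have e1 := h.abs_iterate_le hf (fun w => (hB w).trans (le_max_left B 1)) k w
        have e2 := h.iterate_le_sup_mul h0 k w
        calc _ ≤ _ := e1
          _ ≤ B' * (h.sup k * m (w (Fin.last n))) := mul_le_mul_of_nonneg_left e2 (by linarith)
          _ = _ := by ring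
      have hsupk := zero_le_one.trans (hsup k)
      have hstep := h.abs_fkOp_sub_le hp0 (h.iterate_spec hf hB k).1 (h.iterate_spec hf hB k).2
        (mul_nonneg hsupk (by linarith)) hκ (by positivity : 0 ≤ 2 * J) hΓ1 hL
        hε.le hKc hgm ih hVL u v rfl rfl h1 h2 hμ₁ hμ₂ ha
      refine hstep.trans ?_
      have hb := blockDist_nonneg (θ := θ) hΓ0.le u v
      have hωω := mul_nonneg (hω0 (u (Fin.last n))) (hω0 (v (Fin.last n)))
      have e1 : C * (Real.exp A * κ + L) * (Γ⁻¹ * blockDist θ Γ u v) ≤ κ * blockDist θ Γ u v := by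
        rw [← mul_assoc]
        refine mul_le_mul_of_nonneg_right ?_ hb
        rw [mul_inv_le_iff₀ hΓ0]
        have : C * (Real.exp A * κ + L) ≤ C * (Real.exp A * κ + κ) :=
          mul_le_mul_of_nonneg_left (by linarith) hC.le
        rw [hΓ]
        nlinarith
      have e2 : C * (Real.exp A * κ + L) * (Γ ^ n * ε ^ θ) + C * (Real.exp A * (2 * J)) * ε ^ θ
          + 2 * (Real.exp A * Real.sqrt C * Kc ^ θ) = 2 * J := by
        have : C * (Real.exp A * (2 * J)) * ε ^ θ = J := by
          rw [hεθ]; field_simp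
        rw [this, hJ]; ring
      rw [e2]
      refine mul_le_mul (mul_le_mul_of_nonneg_right (h.sup_le_succ h0 k) (by linarith)) ?_
        (by positivity) (mul_nonneg (zero_le_one.trans (hsup _)) (by linarith))
      exact mul_le_mul_of_nonneg_left (add_le_add e1 le_rfl) hωω
  refine ⟨Γ, B' * (κ + 2 * J), hΓ0.le, mul_nonneg (by linarith) (by linarith), fun k u v => ?_⟩
  refine (main k u v).trans ?_
  have hb := blockDist_nonneg (θ := θ) hΓ0.le u v
  have e1 : ‖u (Fin.last n) - v (Fin.last n)‖ ^ θ ≤ blockDist θ Γ u v := by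
    refine le_trans ?_ (Finset.single_le_sum
      (f := fun i : Fin (n + 1) => Γ ^ (i : ℕ) * ‖u i - v i‖ ^ θ)
      (fun i _ => mul_nonneg (pow_nonneg hΓ0.le _) (Real.rpow_nonneg (norm_nonneg _) _))
      (Finset.mem_univ (Fin.last n)))
    exact le_mul_of_one_le_left (Real.rpow_nonneg (norm_nonneg _) _) (one_le_pow₀ hΓ1)
  have hωω := mul_nonneg (hω0 (u (Fin.last n))) (hω0 (v (Fin.last n)))
  have hsupk := zero_le_one.trans (hsup k)
  calc h.sup k * B' * (ω (u (Fin.last n)) * ω (v (Fin.last n)) *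
          (κ * blockDist θ Γ u v + 2 * J * ‖u (Fin.last n) - v (Fin.last n)‖ ^ θ))
      ≤ h.sup k * B' * (ω (u (Fin.last n)) * ω (v (Fin.last n)) *
          (κ * blockDist θ Γ u v + 2 * J * blockDist θ Γ u v)) := by gcongr
    _ = _ := by ring

end Semigroup

/-! ### A Harnack inequality -/

section Semigroup

variable {H : Type*} [NormedAddCommGroup H] [InnerProductSpace ℝ H] [CompleteSpace H]
  [TopologicalSpace.SeparableSpace H] [MeasurableSpace H] [BorelSpace H]
  {lam : Measure H} [IsProbabilityMeasure lam] {S : H → H} {Φ p m ω : H → ℝ} {θ C : ℝ} {n : ℕ}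
  {V : (Fin (n + 1) → H) → ℝ} {A R : ℝ}

/-- Up to a constant, the semigroup on `1` depends on the last component only. -/
theorem FKSetup.iterate_le_of_last_eq (h : FKSetup lam S Φ p m ω θ C V A R) (k : ℕ)
    {u v : Fin (n + 1) → H} (huv : u (Fin.last n) = v (Fin.last n)) :
    (fkOp lam S V)^[k] (fun _ => 1) u ≤ Real.exp (n * A) * (fkOp lam S V)^[k] (fun _ => 1) v := by
  have hA := h.potential_bound_nonneg
  have key : ∀ d : ℕ, d ≤ n → ∀ (k : ℕ) (u v : Fin (n + 1) → H),
      (∀ i : Fin (n + 1), d ≤ i → u i = v i) →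
      (fkOp lam S V)^[k] (fun _ => 1) u
        ≤ Real.exp (d * A) * (fkOp lam S V)^[k] (fun _ => 1) v := by
    intro d
    induction d with
    | zero =>
      intro _ k u v huv
      have : u = v := funext fun i => huv i (Nat.zero_le _)
      simp [this]
    | succ d ih =>
      intro hd k u v huv
      cases k with
      | zero => simpa using Real.one_le_exp (by positivity)
      | succ k =>
        have hlast : u (Fin.last n) = v (Fin.last n) := huv _ (by simpa using hd)
        rw [Function.iterate_succ_apply', fkOp, fkOp, ← integral_const_mul]
        refine integral_mono (h.integrable (h.one_spec k).1 (h.one_spec k).2 u)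
          ((h.integrable (h.one_spec k).1 (h.one_spec k).2 v).const_mul _) fun y => ?_
        have e1 := ih (by omega) k (blockStep S u y) (blockStep S v y) fun i hi => by
          refine Fin.lastCases ?_ (fun j hj => ?_) i hi
          · intro _
            rw [blockStep_last, blockStep_last, hlast]
          · rw [blockStep_castSucc, blockStep_castSucc]
            exact huv _ (by simpa using hj)
        have e2 := Real.exp_le_exp.2 (h.potential_le (blockStep S u y))
        have e3 := Real.one_le_exp (h.potential_nonneg (blockStep S v y))
        have e4 := zero_le_one.trans (h.one_le_iterate k (blockStep S v y))
        calc _ ≤ Real.exp (d * A) * (fkOp lam S V)^[k] (fun _ => 1) (blockStep S v y)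
              * Real.exp A := mul_le_mul e1 e2 (Real.exp_pos _).le (by positivity)
          _ = Real.exp ((d + 1 : ℕ) * A) * ((fkOp lam S V)^[k] (fun _ => 1) (blockStep S v y) * 1) := by
              push_cast
              rw [add_mul, one_mul, Real.exp_add]
              ring
          _ ≤ _ := by gcongr
  refine key n le_rfl k u v fun i hi => ?_
  have : i = Fin.last n := Fin.ext (by have := i.2; simp only [Fin.val_last]; omega)
  rw [this, huv]

theorem FKSetup.integrable_diag (h : FKSetup lam S Φ p m ω θ C V A R) (k : ℕ) (x : H) :
    Integrable (fun y => (fkOp lam S V)^[k] (fun _ => 1) fun _ => S x + y) lam := by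
  refine Integrable.of_bound ((h.one_spec k).1.comp (measurable_pi_lambda _ fun _ =>
    measurable_const.add measurable_id)).aestronglyMeasurable (Real.exp (k * A))
    (ae_of_all _ fun y => (h.one_spec k).2 _)

theorem FKSetup.iterate_succ_le_integral (h : FKSetup lam S Φ p m ω θ C V A R) (k : ℕ)
    (u : Fin (n + 1) → H) :
    (fkOp lam S V)^[k + 1] (fun _ => 1) u ≤ Real.exp A * Real.exp (n * A) *
      ∫ y, (fkOp lam S V)^[k] (fun _ => 1) (fun _ => S (u (Fin.last n)) + y) ∂lam := by
  rw [Function.iterate_succ_apply', fkOp, ← integral_const_mul]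
  refine integral_mono (h.integrable (h.one_spec k).1 (h.one_spec k).2 u)
    ((h.integrable_diag k _).const_mul _) fun y => ?_
  have e1 := h.iterate_le_of_last_eq k (u := blockStep S u y)
    (v := fun _ => S (u (Fin.last n)) + y) (by simp)
  have e2 := Real.exp_le_exp.2 (h.potential_le (blockStep S u y))
  have e3 := zero_le_one.trans (h.one_le_iterate k (blockStep S u y))
  calc _ ≤ _ := mul_le_mul e1 e2 (Real.exp_pos _).le (e3.trans e1)
    _ = _ := by ring

theorem FKSetup.integral_le_iterate_succ (h : FKSetup lam S Φ p m ω θ C V A R) (k : ℕ)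
    (u : Fin (n + 1) → H) :
    ∫ y, (fkOp lam S V)^[k] (fun _ => 1) (fun _ => S (u (Fin.last n)) + y) ∂lam
      ≤ Real.exp (n * A) * (fkOp lam S V)^[k + 1] (fun _ => 1) u := by
  rw [Function.iterate_succ_apply', fkOp, ← integral_const_mul]
  refine integral_mono (h.integrable_diag k _)
    ((h.integrable (h.one_spec k).1 (h.one_spec k).2 u).const_mul _) fun y => ?_
  have e1 := h.iterate_le_of_last_eq k (u := fun _ => S (u (Fin.last n)) + y)
    (v := blockStep S u y) (by simp)
  have e2 := Real.one_le_exp (h.potential_nonneg (blockStep S u y))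
  have e3 := zero_le_one.trans (h.one_le_iterate k (blockStep S u y))
  refine e1.trans (mul_le_mul_of_nonneg_left (le_mul_of_one_le_right e3 e2) (Real.exp_pos _).le)

/-- The supremum of the semigroup on `1` over the states with last component in `{Φ ≤ R}` is
comparable with the value at the origin. By compactness of `S` and the Hölder estimate the
supremum is attained, up to a constant, on a finite set of constant states that does not depend on
time; a neighbourhood of each of them is charged by the law of the chain started at the origin. -/
theorem FKSetup.exists_sup_le_mul (h : FKSetup lam S Φ p m ω θ C V A R) (hp0 : ∀ x, 0 ≤ p x)
    (h0 : Φ 0 ≤ R) (hbdd : ∃ ρ : ℝ, ∀ x, Φ x ≤ R → ‖x‖ ≤ ρ)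
    (htb : TotallyBounded (S '' {x | Φ x ≤ R}))
    (hpos : ∀ (z : H) (r : ℝ), 0 < r → 0 < lam (Metric.ball z r))
    {Γ K : ℝ} (hΓ : 0 ≤ Γ) (hK : 0 ≤ K)
    (hhol : ∀ (k : ℕ) (u v : Fin (n + 1) → H),
      |(fkOp lam S V)^[k] (fun _ => 1) u - (fkOp lam S V)^[k] (fun _ => 1) v|
        ≤ h.sup k * (ω (u (Fin.last n)) * ω (v (Fin.last n)) * (K * blockDist θ Γ u v))) :
    ∃ c : ℝ, 0 < c ∧ ∀ k, h.sup k ≤ c * (fkOp lam S V)^[k] (fun _ => 1) 0 := by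
  have hw := h.weights
  have hC := hw.const_pos
  have hθ := hw.theta_pos
  have hω0 : ∀ x, 0 ≤ ω x := fun x => zero_le_one.trans (hw.one_le_large x)
  have hA := h.potential_bound_nonneg
  obtain ⟨ρ, hρ⟩ := hbdd
  set G := ∑ i : Fin (n + 1), Γ ^ (i : ℕ) with hG
  have hG0 : 0 ≤ G := Finset.sum_nonneg fun i _ => pow_nonneg hΓ _
  set hd : ℕ → H → ℝ := fun k x => (fkOp lam S V)^[k] (fun _ => 1) fun _ => x with hd_def
  have hdhol : ∀ k x y, |hd k x - hd k y| ≤ h.sup k * (ω x * ω y * (K * G * ‖x - y‖ ^ θ)) := by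
    intro k x y
    have := hhol k (fun _ => x) fun _ => y
    have e : blockDist θ Γ (fun _ : Fin (n + 1) => x) (fun _ => y) = G * ‖x - y‖ ^ θ := by
      rw [blockDist, hG, Finset.sum_mul]
    rwa [e, ← mul_assoc K] at this
  have hsup1 : ∀ k, 1 ≤ h.sup k := h.one_le_sup h0
  set c₀ := Real.exp (n * A) with hc₀
  have hc₀1 : 1 ≤ c₀ := Real.one_le_exp (by positivity)
  have hsmall : ∀ D : ℝ, 0 ≤ D → ∃ r : ℝ, 0 < r ∧ r ≤ 1 ∧ D * r ^ θ ≤ 1 / 2 := by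
    intro D hD
    have hlim : Tendsto (fun r : ℝ => D * r ^ θ) (𝓝[>] 0) (𝓝 (D * 0 ^ θ)) :=
      ((Real.continuousAt_rpow_const 0 θ (Or.inr hθ.le)).tendsto.mono_left
        nhdsWithin_le_nhds).const_mul D
    rw [Real.zero_rpow hθ.ne', mul_zero] at hlim
    have hev := hlim.eventually (ge_mem_nhds (by norm_num : (0 : ℝ) < 1 / 2))
    obtain ⟨r, hr1, hr3⟩ := (hev.and (Ioc_mem_nhdsGT one_pos)).exists
    exact ⟨r, hr3.1, hr3.2, hr1⟩
  -- a finite set of constant states on which the supremum is attained up to a constant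
  obtain ⟨B, hB⟩ := hw.bounded_on_balls ρ
  have hB0 : 0 ≤ B := (hω0 0).trans (hB 0 (hρ 0 h0))
  set c₁ := 2 * (Real.exp A * c₀ * c₀) with hc₁
  have hc₁1 : 1 ≤ c₁ := by
    have := Real.one_le_exp hA
    have : 1 ≤ Real.exp A * c₀ * c₀ :=
      one_le_mul_of_one_le_of_one_le (one_le_mul_of_one_le_of_one_le this hc₀1) hc₀1
    linarith
  obtain ⟨F, hFne, hFΦ, hF⟩ : ∃ F : Finset H, F.Nonempty ∧ (∀ z ∈ F, Φ z ≤ R) ∧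
      ∀ k, ∃ z ∈ F, h.sup k ≤ c₁ * hd k z := by
    obtain ⟨r, hr0, -, hr⟩ := hsmall (Real.exp A * c₀ * (K * G * (C * (B * B)))) (by positivity)
    obtain ⟨t, htsub, htfin, htcov⟩ := Metric.finite_approx_of_totallyBounded htb r hr0
    lift t to Finset H using htfin
    classical
    obtain ⟨F, hFsub, rfl⟩ := Finset.subset_set_image_iff.1 htsub
    have hcov : ∀ x, Φ x ≤ R → ∃ z ∈ F, ‖S x - S z‖ < r := by
      intro x hx
      have := htcov ⟨x, hx, rfl⟩
      simp only [Set.mem_iUnion] at this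
      obtain ⟨y, hy, hxy⟩ := this
      obtain ⟨z, hz, rfl⟩ := Finset.mem_image.1 (Finset.mem_coe.1 hy)
      exact ⟨z, hz, by rwa [Metric.mem_ball, dist_eq_norm] at hxy⟩
    have hFne : F.Nonempty := let ⟨z, hz, _⟩ := hcov 0 h0; ⟨z, hz⟩
    refine ⟨F, hFne, fun z hz => hFsub hz, fun k => ?_⟩
    cases k with
    | zero =>
      obtain ⟨z, hz⟩ := hFne
      refine ⟨z, hz, h.sup_le 0 (by simp [hd_def]; linarith) fun u _ => ?_⟩
      simpa [hd_def] using hc₁1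
    | succ k =>
      obtain ⟨z, hz, hmax⟩ := F.exists_max_image (hd (k + 1)) hFne
      refine ⟨z, hz, ?_⟩
      have hN : h.sup (k + 1) ≤ Real.exp A * c₀ * c₀ * hd (k + 1) z + h.sup (k + 1) / 2 := by
        have hdz : 0 ≤ hd (k + 1) z := zero_le_one.trans (h.one_le_iterate _ _)
        have hs1 := zero_le_one.trans (hsup1 (k + 1))
        have hs0 := zero_le_one.trans (hsup1 k)
        refine h.sup_le (k + 1) (by positivity) fun u hu => ?_
        obtain ⟨z', hz', hdist⟩ := hcov _ hu
        set x := u (Fin.last n) with hx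
        have hmul := hw.integral_mul_large_le (ν := lam) x z' 0 le_rfl (by simp)
        simp only [add_zero] at hmul
        have hq : Real.exp (-(θ * (p x + p z'))) ≤ 1 := Real.exp_le_one_iff.2 (by
          have := mul_nonneg hθ.le (add_nonneg (hp0 x) (hp0 z'))
          linarith)
        have hprod : ∫ y, ω (S x + y) * ω (S z' + y) ∂lam ≤ C * (B * B) := by
          refine hmul.2.trans ?_
          have f1 := hB x (hρ x hu)
          have f2 := hB z' (hρ z' (hFsub hz'))
          have f3 := hω0 x
          have f4 := hω0 z'
          calc _ ≤ C * 1 * (B * B) := by gcongr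
            _ = _ := by ring
        have hdiff : ∫ y, hd k (S x + y) ∂lam
            ≤ ∫ y, hd k (S z' + y) ∂lam + h.sup k * (K * G * r ^ θ) * (C * (B * B)) := by
          calc ∫ y, hd k (S x + y) ∂lam
              ≤ ∫ y, (hd k (S z' + y)
                  + h.sup k * (K * G * r ^ θ) * (ω (S x + y) * ω (S z' + y))) ∂lam := by
                refine integral_mono (h.integrable_diag k _)
                  ((h.integrable_diag k _).add (hmul.1.const_mul _)) fun y => ?_
                have f1 := (abs_le.1 (hdhol k (S x + y) (S z' + y))).2
                have f2 : ‖S x + y - (S z' + y)‖ ^ θ ≤ r ^ θ := by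
                  rw [add_sub_add_right_eq_sub]
                  exact Real.rpow_le_rpow (norm_nonneg _) hdist.le hθ.le
                have f3 : h.sup k * (ω (S x + y) * ω (S z' + y) *
                    (K * G * ‖S x + y - (S z' + y)‖ ^ θ))
                    ≤ h.sup k * (ω (S x + y) * ω (S z' + y) * (K * G * r ^ θ)) := by
                  have f4 := hω0 (S x + y)
                  have f5 := hω0 (S z' + y)
                  gcongr
                simp only
                linarith
            _ = ∫ y, hd k (S z' + y) ∂lam + h.sup k * (K * G * r ^ θ) *
                  ∫ y, ω (S x + y) * ω (S z' + y) ∂lam := by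
                rw [integral_add (h.integrable_diag k _) (hmul.1.const_mul _), integral_const_mul]
            _ ≤ _ := by gcongr
        have hlow := h.integral_le_iterate_succ k fun _ => z'
        have hexpA := Real.exp_pos A
        calc (fkOp lam S V)^[k + 1] (fun _ => 1) u
            ≤ Real.exp A * c₀ * ∫ y, hd k (S x + y) ∂lam := h.iterate_succ_le_integral k u
          _ ≤ Real.exp A * c₀ * (c₀ * hd (k + 1) z
                + h.sup k * (K * G * r ^ θ) * (C * (B * B))) := by
              refine mul_le_mul_of_nonneg_left (hdiff.trans (add_le_add (hlow.trans ?_) le_rfl))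
                (by positivity)
              exact mul_le_mul_of_nonneg_left (hmax z' hz') (by positivity)
          _ = Real.exp A * c₀ * c₀ * hd (k + 1) z
                + h.sup k * (Real.exp A * c₀ * (K * G * (C * (B * B))) * r ^ θ) := by ring
          _ ≤ Real.exp A * c₀ * c₀ * hd (k + 1) z + h.sup (k + 1) * (1 / 2) := by
              have := h.sup_le_succ h0 k
              gcongr
          _ = _ := by ring
      rw [hc₁]
      linarith
  -- the chain started at the origin charges a neighbourhood of each of these states
  obtain ⟨B', hB'⟩ := hw.bounded_on_balls (ρ + 1)
  have hB'0 : 0 ≤ B' := (hω0 0).trans (hB' 0 ((hρ 0 h0).trans (by linarith)))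
  obtain ⟨r, hr0, hr1, hr⟩ := hsmall (c₁ * (B' * B' * (K * G))) (by positivity)
  obtain ⟨z₀, hz₀F, hz₀⟩ := F.exists_min_image (fun z => lam.real (Metric.ball (z - S 0) r)) hFne
  have hz₀pos : 0 < lam.real (Metric.ball (z₀ - S 0) r) :=
    ENNReal.toReal_pos (hpos _ _ hr0).ne' (measure_ne_top _ _)
  refine ⟨2 * c₁ * c₀ * Real.exp A * (lam.real (Metric.ball (z₀ - S 0) r))⁻¹, by positivity,
    fun k => ?_⟩
  obtain ⟨z, hzF, hz⟩ := hF k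
  have hzρ := hρ z (hFΦ z hzF)
  have hlow : ∀ y ∈ Metric.ball (z - S 0) r, hd k z / 2 ≤ hd k (S 0 + y) := by
    intro y hy
    have hy' : ‖z - (S 0 + y)‖ < r := by
      rw [Metric.mem_ball, dist_comm, dist_eq_norm] at hy
      rwa [sub_add_eq_sub_sub]
    have hyρ : ‖S 0 + y‖ ≤ ρ + 1 := by
      have e1 : S 0 + y = z - (z - (S 0 + y)) := by abel
      rw [e1]
      exact (norm_sub_le _ _).trans (by linarith)
    have e2 := (abs_le.1 (hdhol k z (S 0 + y))).2
    have e3 : h.sup k * (ω z * ω (S 0 + y) * (K * G * ‖z - (S 0 + y)‖ ^ θ)) ≤ hd k z / 2 := by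
      have hdz : 0 ≤ hd k z := zero_le_one.trans (h.one_le_iterate k _)
      have f1 : ω z ≤ B' := hB' z (by linarith)
      have f2 := hB' _ hyρ
      have f3 : ‖z - (S 0 + y)‖ ^ θ ≤ r ^ θ := Real.rpow_le_rpow (norm_nonneg _) hy'.le hθ.le
      have f4 := hω0 z
      have f5 := hω0 (S 0 + y)
      calc _ ≤ (c₁ * hd k z) * (B' * B' * (K * G * r ^ θ)) := by gcongr
        _ = hd k z * (c₁ * (B' * B' * (K * G)) * r ^ θ) := by ring
        _ ≤ hd k z * (1 / 2) := by gcongr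
        _ = _ := by ring
    linarith
  have hint := h.integrable_diag k 0
  have hball : lam.real (Metric.ball (z - S 0) r) * (hd k z / 2) ≤ ∫ y, hd k (S 0 + y) ∂lam := by
    calc lam.real (Metric.ball (z - S 0) r) * (hd k z / 2)
        = ∫ y in Metric.ball (z - S 0) r, hd k z / 2 ∂lam := by
          rw [setIntegral_const, smul_eq_mul]
      _ ≤ ∫ y in Metric.ball (z - S 0) r, hd k (S 0 + y) ∂lam :=
          setIntegral_mono_on (integrableOn_const (measure_ne_top _ _)) hint.integrableOn
            measurableSet_ball hlow
      _ ≤ _ := setIntegral_le_integral hint (ae_of_all _ fun y =>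
            zero_le_one.trans (h.one_le_iterate k _))
  have hup := h.integral_le_iterate_succ k (0 : Fin (n + 1) → H)
  have hup' := h.iterate_succ_le k (0 : Fin (n + 1) → H)
  have hdz : 0 ≤ hd k z := zero_le_one.trans (h.one_le_iterate k _)
  have hchain : lam.real (Metric.ball (z₀ - S 0) r) * (hd k z / 2)
      ≤ c₀ * (Real.exp A * (fkOp lam S V)^[k] (fun _ => 1) 0) :=
    (mul_le_mul_of_nonneg_right (hz₀ z hzF) (by positivity)).trans
      (hball.trans (hup.trans (mul_le_mul_of_nonneg_left hup' (by positivity))))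
  calc h.sup k ≤ c₁ * hd k z := hz
    _ = 2 * c₁ * (lam.real (Metric.ball (z₀ - S 0) r))⁻¹ *
        (lam.real (Metric.ball (z₀ - S 0) r) * (hd k z / 2)) := by
        field_simp
    _ ≤ 2 * c₁ * (lam.real (Metric.ball (z₀ - S 0) r))⁻¹ *
        (c₀ * (Real.exp A * (fkOp lam S V)^[k] (fun _ => 1) 0)) := by gcongr
    _ = _ := by ring

end Semigroup

/-! ### Consequences of the compactness condition -/

section Contraction

variable {H : Type*} [NormedAddCommGroup H] [InnerProductSpace ℝ H] [CompleteSpace H]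
  {S : H → H} {p : H → ℝ} {γ : ℕ → ℝ} {E : ℕ → Submodule ℝ H} [∀ N, FiniteDimensional ℝ (E N)]

theorem coordSpan_mono (e : HilbertBasis ℕ ℝ H) : Monotone (coordSpan e) := fun M N hMN =>
  Submodule.span_mono <| by
    rintro _ ⟨i, rfl⟩
    exact ⟨⟨i, i.2.trans_le hMN⟩, rfl⟩

theorem tendsto_coordSpan_starProjection (e : HilbertBasis ℕ ℝ H) (x : H) :
    Tendsto (fun M => (coordSpan e M).starProjection x) atTop (𝓝 x) := by
  refine Submodule.starProjection_tendsto_self _ (coordSpan_mono e) x ?_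
  rw [← e.dense_span]
  refine Submodule.topologicalClosure_mono (Submodule.span_le.2 ?_)
  rintro _ ⟨i, rfl⟩
  exact Submodule.mem_iSup_of_mem (i + 1) (Submodule.subset_span ⟨⟨i, i.lt_succ_self⟩, rfl⟩)

theorem norm_sub_starProjection_le (K : Submodule ℝ H) [K.HasOrthogonalProjection] (x : H) :
    ‖x - K.starProjection x‖ ≤ ‖x‖ := by
  rw [← Submodule.starProjection_orthogonal_val]
  exact Kᗮ.norm_starProjection_apply_le x

/-- On a finite-dimensional subspace the coordinate projections converge to the identity
uniformly. -/
theorem exists_norm_sub_coordSpan_le (e : HilbertBasis ℕ ℝ H) (F : Submodule ℝ H)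
    [FiniteDimensional ℝ F] {ε : ℝ} (hε : 0 < ε) :
    ∃ M, ∀ w ∈ F, ‖w - (coordSpan e M).starProjection w‖ ≤ ε * ‖w‖ := by
  set f := stdOrthonormalBasis ℝ F
  have hlim : Tendsto (fun M => ∑ i, ‖(f i : H) - (coordSpan e M).starProjection (f i)‖)
      atTop (𝓝 0) := by
    have : Tendsto (fun M => ∑ i, ‖(f i : H) - (coordSpan e M).starProjection (f i)‖)
        atTop (𝓝 (∑ i, ‖(f i : H) - f i‖)) :=
      tendsto_finsetSum _ fun i _ =>
        (tendsto_const_nhds.sub (tendsto_coordSpan_starProjection e (f i : H))).norm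
    simpa using this
  obtain ⟨M, hM⟩ := (hlim.eventually (gt_mem_nhds hε)).exists
  refine ⟨M, fun w hw => ?_⟩
  have hrep : w = ∑ i, (inner ℝ (f i) (⟨w, hw⟩ : F)) • (f i : H) := by
    have := congrArg (Subtype.val) (f.sum_repr' ⟨w, hw⟩)
    simpa using this.symm
  have hsub : w - (coordSpan e M).starProjection w
      = ∑ i, (inner ℝ (f i) (⟨w, hw⟩ : F)) • ((f i : H) - (coordSpan e M).starProjection (f i)) := by
    conv_lhs => rw [hrep]
    simp [map_sum, smul_sub, Finset.sum_sub_distrib]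
  rw [hsub]
  calc _ ≤ ∑ i, ‖w‖ * ‖(f i : H) - (coordSpan e M).starProjection (f i)‖ := by
        refine (norm_sum_le _ _).trans (Finset.sum_le_sum fun i _ => ?_)
        rw [norm_smul]
        refine mul_le_mul_of_nonneg_right ?_ (norm_nonneg _)
        have := norm_inner_le_norm (𝕜 := ℝ) (f i) (⟨w, hw⟩ : F)
        rwa [f.orthonormal.1 i, one_mul] at this
    _ = (∑ i, ‖(f i : H) - (coordSpan e M).starProjection (f i)‖) * ‖w‖ := by
        rw [← Finset.mul_sum, mul_comm]
    _ ≤ _ := mul_le_mul_of_nonneg_right hM.le (norm_nonneg _)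

theorem CompactnessCondition.norm_sub_le (hB : CompactnessCondition S p γ E) (x y : H) :
    ‖S x - S y‖ ≤ (γ 0)⁻¹ * (Real.exp (p x + p y) * ‖x - y‖) := by
  have := hB.contraction x y 0
  have hbot : ∀ w ∈ E 0, w = 0 := fun w hw => by rwa [hB.space_zero, Submodule.mem_bot] at hw
  have h0 : (E 0).starProjection (S x - S y) = 0 :=
    hbot _ ((E 0).starProjection_apply_mem (S x - S y))
  rwa [h0, sub_zero, mul_assoc] at this

/-- The contraction in the high modes, with the coordinate projections of the noise in place of the
projections of the compactness condition. -/
theorem CompactnessCondition.exists_coordSpan_contraction (hB : CompactnessCondition S p γ E)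
    (e : HilbertBasis ℕ ℝ H) {ε : ℝ} (hε : 0 < ε) :
    ∃ M, ∀ x y, ‖S x - S y - (coordSpan e M).starProjection (S x - S y)‖
      ≤ ε * (Real.exp (p x + p y) * ‖x - y‖) := by
  obtain ⟨N, hN⟩ := ((tendsto_inv_atTop_zero.comp hB.gamma_tendsto).eventually
    (gt_mem_nhds (half_pos hε))).exists
  have hγ := hB.gamma_pos 0
  obtain ⟨M, hM⟩ := exists_norm_sub_coordSpan_le e (E N) (ε := ε / 2 * γ 0) (by positivity)
  refine ⟨M, fun x y => ?_⟩
  set z := S x - S y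
  set D := Real.exp (p x + p y) * ‖x - y‖ with hD
  have hD0 : 0 ≤ D := by positivity
  set P := (coordSpan e M).starProjection
  set Q := (E N).starProjection
  have h1 : ‖(z - Q z) - P (z - Q z)‖ ≤ ε / 2 * D := by
    refine (norm_sub_starProjection_le _ _).trans ((hB.contraction x y N).trans ?_)
    rw [mul_assoc]
    exact mul_le_mul_of_nonneg_right hN.le hD0
  have h2 : ‖Q z - P (Q z)‖ ≤ ε / 2 * D := by
    calc ‖Q z - P (Q z)‖ ≤ ε / 2 * γ 0 * ‖Q z‖ := hM _ ((E N).starProjection_apply_mem z)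
      _ ≤ ε / 2 * γ 0 * ((γ 0)⁻¹ * D) :=
        mul_le_mul_of_nonneg_left (((E N).norm_starProjection_apply_le z).trans
          (hB.norm_sub_le x y)) (by positivity)
      _ = _ := by field_simp
  calc ‖z - P z‖ = ‖((z - Q z) - P (z - Q z)) + (Q z - P (Q z))‖ := by
        rw [map_sub P z (Q z)]; congr 1; abel
    _ ≤ _ := norm_add_le _ _
    _ ≤ ε * D := by linarith

/-- The kick is shifted by the projection of `S x - S y` onto the first modes, so that only the
contracted high modes of the difference remain. -/
theorem CompactnessCondition.squeezingCoupling [TopologicalSpace.SeparableSpace H]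
    [MeasurableSpace H] [BorelSpace H] {Ω : Type*} [MeasurableSpace Ω] {μ : Measure Ω}
    [IsProbabilityMeasure μ] {Φ : H → ℝ} {e : HilbertBasis ℕ ℝ H} {b : ℕ → ℝ}
    {dens : ℕ → ℝ → ℝ} {ξ : ℕ → ℕ → Ω → ℝ} {η : ℕ → Ω → H}
    (hB : CompactnessCondition S p γ E) (hC : NoiseCondition μ Φ p γ e b dens ξ η)
    (hb : ∀ j, b j ≠ 0) : SqueezingCoupling (μ.map (η 0)) S p := by
  have : IsProbabilityMeasure (μ.map (η 0)) :=
    Measure.isProbabilityMeasure_map (hC.measurable_kick 0).aemeasurable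
  intro ε hε
  obtain ⟨M, hM⟩ := hB.exists_coordSpan_contraction e hε
  obtain ⟨K, hK, hshift⟩ := hC.exists_map_le_preimage_add hb M
  have hγ := hB.gamma_pos 0
  refine ⟨K * (γ 0)⁻¹, by positivity, fun x y => ?_⟩
  set a := (coordSpan e M).starProjection (S x - S y)
  have ha : K * ‖-a‖ ≤ K * (γ 0)⁻¹ * (Real.exp (p x + p y) * ‖x - y‖) := by
    rw [norm_neg, mul_assoc]
    exact mul_le_mul_of_nonneg_left (((coordSpan e M).norm_starProjection_apply_le _).trans
      (hB.norm_sub_le x y)) hK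
  have hmem : -a ∈ coordSpan e M :=
    (coordSpan e M).neg_mem ((coordSpan e M).starProjection_apply_mem _)
  obtain ⟨ν, μ₁, μ₂, h1, h2, h3, h4⟩ := exists_shift_coupling (hshift (-a) hmem)
  exact ⟨a, ν, μ₁, μ₂, h1, h2, h3.trans (ENNReal.ofReal_le_ofReal ha),
    h4.trans (ENNReal.ofReal_le_ofReal ha), hM x y⟩

/-- `S` maps bounded sets to totally bounded ones. -/
theorem CompactnessCondition.totallyBounded_image (hB : CompactnessCondition S p γ E) {X : Set H}
    {ρ : ℝ} (hX : ∀ x ∈ X, ‖x‖ ≤ ρ) : TotallyBounded (S '' X) := by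
  obtain ⟨B, hBp⟩ := hB.bounded_on_balls ρ
  have hp : ∀ x ∈ X, p x ≤ B := fun x hx => hBp ⟨x, by simpa using hX x hx, rfl⟩
  set D := Real.exp (B + p 0) * |ρ| with hD
  have hDx : ∀ x ∈ X, Real.exp (p x + p 0) * ‖x - 0‖ ≤ D := fun x hx => by
    rw [sub_zero]
    have := hp x hx
    have := (hX x hx).trans (le_abs_self ρ)
    rw [hD]
    gcongr
  rw [Metric.totallyBounded_iff]
  intro r hr
  have hlim : Tendsto (fun N => (γ N)⁻¹ * D) atTop (𝓝 (0 * D)) :=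
    (tendsto_inv_atTop_zero.comp hB.gamma_tendsto).mul_const D
  rw [zero_mul] at hlim
  obtain ⟨N, hN⟩ := (hlim.eventually (gt_mem_nhds (half_pos hr))).exists
  have hcpt : IsCompact ((fun w : E N => (w : H)) '' Metric.closedBall 0 ((γ 0)⁻¹ * D)) :=
    (isCompact_closedBall _ _).image continuous_subtype_val
  obtain ⟨t, ht, hcov⟩ := Metric.totallyBounded_iff.1 hcpt.totallyBounded (r / 2) (half_pos hr)
  refine ⟨(fun w => S 0 + w) '' t, ht.image _, ?_⟩
  rintro _ ⟨x, hx, rfl⟩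
  set w := (E N).starProjection (S x - S 0) with hw
  have hmem : w ∈ (fun w : E N => (w : H)) '' Metric.closedBall 0 ((γ 0)⁻¹ * D) := by
    refine ⟨⟨w, (E N).starProjection_apply_mem _⟩, ?_, rfl⟩
    rw [mem_closedBall_zero_iff]
    refine ((E N).norm_starProjection_apply_le _).trans ((hB.norm_sub_le x 0).trans ?_)
    exact mul_le_mul_of_nonneg_left (hDx x hx) (inv_nonneg.2 (hB.gamma_pos 0).le)
  obtain ⟨y, hy, hwy⟩ := Set.mem_iUnion₂.1 (hcov hmem)
  refine Set.mem_iUnion₂.2 ⟨S 0 + y, ⟨y, hy, rfl⟩, ?_⟩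
  rw [Metric.mem_ball, dist_eq_norm] at hwy ⊢
  have h1 : ‖S x - S 0 - w‖ < r / 2 := by
    refine lt_of_le_of_lt ((hB.contraction x 0 N).trans ?_) hN
    rw [mul_assoc]
    exact mul_le_mul_of_nonneg_left (hDx x hx) (inv_nonneg.2 (hB.gamma_pos N).le)
  calc ‖S x - (S 0 + y)‖ = ‖(S x - S 0 - w) + (w - y)‖ := by congr 1; abel
    _ ≤ _ := norm_add_le _ _
    _ < r := by linarith

end Contraction

/-! ### The interpolation norm -/

theorem norm_HC_eq (x : HC) : ‖x‖ = Real.sqrt (∑' j, ‖x j‖ ^ 2) := by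
  rw [lp.norm_eq_tsum_rpow (by simp) x, Real.sqrt_eq_rpow]
  simp

section Interpolation

variable {H : Type*} [NormedAddCommGroup H] [InnerProductSpace ℝ H] [CompleteSpace H]
  {γ : ℕ → ℝ}

/-- The embedding of `H_s` into `H` is bounded, by the three lines theorem. -/
theorem norm_le_of_interpNorm_le (hγ : 0 < γ 0) (e : HilbertBasis ℕ ℝ H) {s : ℝ}
    (hs : s ∈ Set.Ioc (0 : ℝ) 1) {u : H} {R : ℕ} (hu : interpNorm γ e s u ≤ R) :
    ‖u‖ ≤ max ((R : ℝ) + 1) ((R + 1) / γ 0) := by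
  have hlt : interpNorm γ e s u < (R + 1 : ℕ) :=
    hu.trans_lt (by exact_mod_cast R.lt_succ_self)
  simp only [interpNorm, iInf_lt_iff] at hlt
  obtain ⟨f, hf, hfs, hmax⟩ := hlt
  obtain ⟨hl, hr⟩ := max_lt_iff.1 hmax
  have hleft : ∀ t : ℝ, ‖f (t * Complex.I)‖ ≤ R + 1 := fun t => by
    have h1 := (le_iSup (fun t : ℝ => ‖f (t * Complex.I)‖ₑ) t).trans hl.le
    rw [← ofReal_norm] at h1
    have := ENNReal.toReal_le_of_le_ofReal (b := (R : ℝ) + 1) (by positivity)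
      (h1.trans_eq (by rw [ENNReal.ofReal_add (by positivity) zero_le_one]; simp))
    rwa [ENNReal.toReal_ofReal (norm_nonneg _)] at this
  have hright : ∀ t : ℝ, ‖f (1 + t * Complex.I)‖ ≤ (R + 1) / γ 0 := fun t => by
    have h1 := (le_iSup (fun t : ℝ => normUC γ (f (1 + t * Complex.I))) t).trans hr.le
    have h2 := (le_iSup (fun N : ℕ => ENNReal.ofReal
      (γ N * Real.sqrt (∑' j : ℕ, ‖f (1 + t * Complex.I) (N + j)‖ ^ 2))) 0).trans h1
    simp only [zero_add] at h2
    rw [← norm_HC_eq] at h2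
    have := ENNReal.toReal_le_of_le_ofReal (b := (R : ℝ) + 1) (by positivity)
      (h2.trans_eq (by rw [ENNReal.ofReal_add (by positivity) zero_le_one]; simp))
    rw [ENNReal.toReal_ofReal (by positivity)] at this
    rwa [le_div_iff₀ hγ, mul_comm]
  obtain ⟨C, hC⟩ := hf.bounded
  have hfs' : ‖f (s : ℂ)‖ ≤ max ((R : ℝ) + 1) ((R + 1) / γ 0) := by
    refine PhragmenLindelof.vertical_strip (a := 0) (b := 1) ?_ ?_ ?_ ?_ ?_ ?_
    · refine ⟨hf.holomorphic, hf.continuousOn.mono ?_⟩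
      refine closure_minimal (fun z hz => ⟨hz.1.le, hz.2.le⟩) ?_
      exact (isClosed_le continuous_const Complex.continuous_re).inter
        (isClosed_le Complex.continuous_re continuous_const)
    · refine ⟨0, by simpa using Real.pi_pos, 0, Asymptotics.IsBigO.of_bound C ?_⟩
      refine eventually_inf_principal.2 (Eventually.of_forall fun z hz => ?_)
      simpa using hC z hz.1.le hz.2.le
    · intro z hz
      have : z = (z.im : ℝ) * Complex.I := by apply Complex.ext <;> simp [hz]
      rw [this]
      exact (hleft _).trans (le_max_left _ _)
    · intro z hz
      have : z = 1 + (z.im : ℝ) * Complex.I := by apply Complex.ext <;> simp [hz]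
      rw [this]
      exact (hright _).trans (le_max_right _ _)
    · simpa using hs.1.le
    · simpa using hs.2
  refine le_trans (le_of_eq ?_) hfs'
  rw [norm_HC_eq, ← e.repr.norm_map u, lp.norm_eq_tsum_rpow (by simp), Real.sqrt_eq_rpow]
  simp [hfs, e.repr_apply_apply]

theorem interpNorm_zero (γ : ℕ → ℝ) (e : HilbertBasis ℕ ℝ H) (s : ℝ) :
    interpNorm γ e s (0 : H) = 0 := by
  have hU : normUC γ (0 : HC) = 0 := by simp [normUC]
  refine le_antisymm (iInf₂_le_of_le (fun _ => 0) ?_ (iInf_le_of_le (fun j => by simp) ?_)) zero_le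
  · exact
      { holomorphic := differentiableOn_const _
        continuousOn := continuousOn_const
        bounded := ⟨0, fun _ _ _ => by simp⟩
        bounded_right := ⟨0, fun _ => by simp [hU]⟩
        continuous_right := fun _ => by simp [hU] }
  · simp [hU]

end Interpolation

/-! ### Cylinder functions and the conclusion -/

section Cylinder

variable {H : Type*} [NormedAddCommGroup H] [InnerProductSpace ℝ H] [CompleteSpace H]
  {e : HilbertBasis ℕ ℝ H} {ℓ : ℕ} {V : (Fin ℓ → H) → ℝ}

theorem IsCylinder.continuous (hV : IsCylinder e V) : Continuous V := by
  obtain ⟨N, -, F, hF, -, -, hVF⟩ := hV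
  rw [show V = fun u => F fun i => (coordSpan e N).orthogonalProjectionOnto (u i) from funext hVF]
  exact hF.continuous.comp (continuous_pi fun i =>
    (ContinuousLinearMap.continuous _).comp (continuous_apply i))

theorem IsCylinder.bounded (hV : IsCylinder e V) : ∃ B : ℝ, ∀ u, |V u| ≤ B := by
  obtain ⟨N, -, F, -, ⟨B, hB⟩, -, hVF⟩ := hV
  exact ⟨B, fun u => by rw [hVF]; exact hB _⟩

/-- A bounded Lipschitz function is Hölder for every exponent in `(0, 1]`. -/
theorem IsCylinder.exists_holder (hV : IsCylinder e V) :
    ∃ L : ℝ, 0 ≤ L ∧ ∀ θ : ℝ, 0 < θ → θ ≤ 1 → ∀ u v, |V u - V v| ≤ L * blockDist θ 1 u v := by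
  obtain ⟨B, hB⟩ := hV.bounded
  obtain ⟨N, -, F, hF, -, ⟨C, hC⟩, hVF⟩ := hV
  have hB0 : 0 ≤ B := (abs_nonneg _).trans (hB 0)
  have hC0 : 0 ≤ C := (norm_nonneg (fderiv ℝ F 0)).trans (hC 0)
  refine ⟨C + 2 * B, by positivity, fun θ hθ hθ1 u v => ?_⟩
  have hterm : ∀ i, ‖u i - v i‖ ^ θ ≤ blockDist θ 1 u v := fun i => by
    have := Finset.single_le_sum (f := fun i : Fin ℓ => (1 : ℝ) ^ (i : ℕ) * ‖u i - v i‖ ^ θ)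
      (fun i _ => by positivity) (Finset.mem_univ i)
    simpa [blockDist] using this
  have hb : 0 ≤ blockDist θ 1 u v := blockDist_nonneg zero_le_one u v
  by_cases h : ∃ i, 1 ≤ ‖u i - v i‖
  · obtain ⟨i, hi⟩ := h
    have h1 : 1 ≤ blockDist θ 1 u v := (Real.one_le_rpow hi hθ.le).trans (hterm i)
    have h2 : |V u - V v| ≤ 2 * B := by
      have := abs_sub (V u) (V v)
      linarith [hB u, hB v]
    nlinarith
  · push Not at h
    have hlip : |V u - V v| ≤ C * ‖fun i => (coordSpan e N).orthogonalProjectionOnto (u i) -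
        (coordSpan e N).orthogonalProjectionOnto (v i)‖ := by
      rw [hVF, hVF]
      exact convex_univ.norm_image_sub_le_of_norm_fderiv_le
        (fun x _ => hF.differentiable one_ne_zero x) (fun x _ => hC x) (Set.mem_univ _)
        (Set.mem_univ _)
    have hnorm : ‖fun i => (coordSpan e N).orthogonalProjectionOnto (u i) -
        (coordSpan e N).orthogonalProjectionOnto (v i)‖ ≤ blockDist θ 1 u v := by
      refine (pi_norm_le_iff_of_nonneg hb).2 fun i => ?_
      rw [← map_sub]
      refine ((coordSpan e N).norm_orthogonalProjectionOnto_apply_le _).trans (le_trans ?_ (hterm i))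
      exact Real.self_le_rpow_of_le_one (norm_nonneg _) (h i).le hθ1
    calc |V u - V v| ≤ C * blockDist θ 1 u v :=
          hlip.trans (mul_le_mul_of_nonneg_left hnorm hC0)
      _ ≤ _ := mul_le_mul_of_nonneg_right (by linarith) hb

end Cylinder

theorem abs_exp_sub_exp_le {a b A : ℝ} (ha : a ≤ A) (hb : b ≤ A) :
    |Real.exp a - Real.exp b| ≤ Real.exp A * |a - b| := by
  wlog h : b ≤ a generalizing a b
  · rw [abs_sub_comm, abs_sub_comm a]
    exact this hb ha (le_of_not_ge h)
  rw [abs_of_nonneg (sub_nonneg.2 (Real.exp_le_exp.2 h)), abs_of_nonneg (sub_nonneg.2 h)]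
  have h1 : Real.exp b = Real.exp a * Real.exp (b - a) := by rw [← Real.exp_add]; ring_nf
  have h2 := Real.add_one_le_exp (b - a)
  calc Real.exp a - Real.exp b = Real.exp a * (1 - Real.exp (b - a)) := by rw [h1]; ring
    _ ≤ Real.exp a * (a - b) := mul_le_mul_of_nonneg_left (by linarith) (Real.exp_pos _).le
    _ ≤ _ := mul_le_mul_of_nonneg_right (Real.exp_le_exp.2 ha) (sub_nonneg.2 h)

theorem fkSemigroup_add_const {H Ω : Type*} [NormedAddCommGroup H] [MeasurableSpace Ω]
    (μ : Measure Ω) (S : H → H) (η : ℕ → Ω → H) {ℓ : ℕ} (V f : (Fin ℓ → H) → ℝ) (c : ℝ) (k : ℕ)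
    (u : Fin ℓ → H) :
    fkSemigroup μ S η (fun v => V v + c) k f u = Real.exp (k * c) * fkSemigroup μ S η V k f u := by
  rw [fkSemigroup, fkSemigroup, ← integral_const_mul]
  refine integral_congr_ae (ae_of_all _ fun ω => ?_)
  simp only [Finset.sum_add_distrib, Finset.sum_const, Nat.card_Icc, Nat.add_sub_cancel,
    nsmul_eq_mul, Real.exp_add]
  ring

end KickRDS

theorem theorem6p2
    {H : Type*} [NormedAddCommGroup H] [InnerProductSpace ℝ H] [CompleteSpace H]
    [TopologicalSpace.SeparableSpace H] [MeasurableSpace H] [BorelSpace H]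
    {Ω : Type*} [MeasurableSpace Ω] (μ : Measure Ω) [IsProbabilityMeasure μ]
    (S : H → H) (hS : Continuous S) (Φ p : H → ℝ) (γ : ℕ → ℝ)
    (E : ℕ → Submodule ℝ H) [∀ N, FiniteDimensional ℝ (E N)] (e : HilbertBasis ℕ ℝ H)
    (b : ℕ → ℝ) (dens : ℕ → ℝ → ℝ) (ξ : ℕ → ℕ → Ω → ℝ) (η : ℕ → Ω → H)
    (hA : KickRDS.Dissipative S Φ)
    (hB : KickRDS.CompactnessCondition S p γ E)
    (hC : KickRDS.NoiseCondition μ Φ p γ e b dens ξ η)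
    (hU : KickRDS.normU γ e (S 0) < ∞)
    (hstab : ∃ Q : ℝ≥0 → ℝ≥0, KickRDS.StabilisableWith μ S η p Q ∧
      ∃ ρ : ℝ, 0 < ρ ∧ ∀ u : H, (Q ‖u‖₊ : ℝ) ≤ Real.exp (ρ * Φ u))
    (hb : ∀ j, b j ≠ 0)
    (ℓ : ℕ) (hℓ : 1 ≤ ℓ) (s : ℝ) (hs : s ∈ Set.Ioc (0 : ℝ) 1)
    (V : (Fin ℓ → H) → ℝ) (hV : KickRDS.IsCylinder e V) :
    ∃ R₀ : ℕ, 1 ≤ R₀ ∧ ∀ f : (Fin ℓ → H) → ℝ, KickRDS.IsCylinder e f → ∀ R : ℕ, R₀ ≤ R →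
      UniformEquicontinuousOn
        (fun (k : ℕ) (u : Fin ℓ → H) =>
          (KickRDS.supNormOn (KickRDS.compactSet γ e p s ℓ R)
              (KickRDS.fkSemigroup μ S η V k fun _ => 1))⁻¹ *
            KickRDS.fkSemigroup μ S η V k f u)
        (KickRDS.compactSet γ e p s ℓ R) := by
  obtain ⟨n, rfl⟩ : ∃ n, ℓ = n + 1 := ⟨ℓ - 1, by omega⟩
  obtain ⟨Q, hQ, -⟩ := hstab
  refine ⟨max 1 ⌈p 0⌉₊, le_max_left _ _, fun f hf R hR => ?_⟩
  have hlam : IsProbabilityMeasure (μ.map (η 0)) :=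
    Measure.isProbabilityMeasure_map (hC.measurable_kick 0).aemeasurable
  set X := KickRDS.compactSet γ e p s (n + 1) R with hX
  -- the origin belongs to `X_R`
  have hX0 : (0 : Fin (n + 1) → H) ∈ X := fun i => by
    rw [Pi.zero_apply, KickRDS.interpNorm_zero]
    refine ⟨zero_le, (Nat.le_ceil _).trans ?_⟩
    exact_mod_cast (le_max_right _ _).trans hR
  obtain ⟨m, ω, θ, C, hw, hdrift⟩ :=
    hC.exists_weightPair hA hS hB.continuous hB.nonneg hB.bounded_on_balls hQ
  obtain ⟨α, β, C₀, q, hα, -, -, -, -, hΦ, -⟩ := hA.bounds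
  obtain ⟨c, hc⟩ := hV.bounded
  obtain ⟨R₁, hR₁⟩ := hdrift (2 * c)
  set R₂ := max R₁ (Φ 0) with hR₂
  have hVm : Measurable V := hV.continuous.measurable
  -- the potential is shifted to be nonnegative; this does not change the normalised semigroup
  have h : KickRDS.FKSetup (μ.map (η 0)) S Φ p m ω θ C (fun u => V u + c) (2 * c) R₂ :=
    { continuous_map := hS
      weights := hw
      measurable_potential := hVm.add_const c
      potential_nonneg := fun u => by linarith [(abs_le.1 (hc u)).1]
      potential_le := fun u => by linarith [(abs_le.1 (hc u)).2]
      drift := hR₁ R₂ (le_max_left _ _) }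
  have h0 : Φ 0 ≤ R₂ := le_max_right _ _
  have hθ := hw.theta_pos
  have hθ1 : θ ≤ 1 := hw.theta_le.trans (by norm_num)
  have hsq := hB.squeezingCoupling hC hb
  obtain ⟨L, hL, hVL⟩ := hV.exists_holder
  obtain ⟨Lf, hLf, hfL⟩ := hf.exists_holder
  obtain ⟨Bf, hBf⟩ := hf.bounded
  have hexpL : ∀ w w', |Real.exp (V w + c) - Real.exp (V w' + c)|
      ≤ Real.exp (2 * c) * L * KickRDS.blockDist θ 1 w w' := fun w w' => by
    refine (KickRDS.abs_exp_sub_exp_le (h.potential_le w) (h.potential_le w')).trans ?_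
    rw [mul_assoc, add_sub_add_right_eq_sub]
    exact mul_le_mul_of_nonneg_left (hVL θ hθ hθ1 w w') (Real.exp_pos _).le
  have hL' : 0 ≤ Real.exp (2 * c) * L := mul_nonneg (Real.exp_pos _).le hL
  obtain ⟨Γ₁, K₁, hΓ₁, hK₁, hhol₁⟩ := h.exists_holder hB.nonneg h0 hsq hL' hexpL
    (f := fun _ => 1) measurable_const (B := 1) (by simp) le_rfl (by simp)
  obtain ⟨Γ, K, hΓ, hK, hhol⟩ := h.exists_holder hB.nonneg h0 hsq hL' hexpL
    hf.continuous.measurable hBf hLf (hfL θ hθ hθ1)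
  have hbdd : ∀ x, Φ x ≤ R₂ → ‖x‖ ≤ R₂ ^ α⁻¹ := fun x hx => by
    have h1 : ‖x‖ ^ α ≤ R₂ := by linarith [(hΦ x).1]
    exact (Real.le_rpow_inv_iff_of_pos (norm_nonneg _)
      ((Real.rpow_nonneg (norm_nonneg _) _).trans h1) hα).2 h1
  obtain ⟨c₁, hc₁, hharnack⟩ := h.exists_sup_le_mul hB.nonneg h0 ⟨_, hbdd⟩
    (hB.totallyBounded_image hbdd) (fun z r hr => hC.map_ball_pos hb z hr) hΓ₁ hK₁ hhol₁
  -- the iterates of the one-step operator and the original semigroup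
  have hsemi : ∀ (k : ℕ) {g : (Fin (n + 1) → H) → ℝ}, Measurable g → ∀ {B : ℝ}, (∀ u, |g u| ≤ B) →
      ∀ u, (KickRDS.fkOp (μ.map (η 0)) S fun u => V u + c)^[k] g u
        = Real.exp (k * c) * KickRDS.fkSemigroup μ S η V k g u := by
    intro k g hg B hgB u
    rw [← KickRDS.fkSemigroup_add_const, hC.fkSemigroup_eq_iterate hS (hVm.add_const c)
      (A := 2 * c) (fun u => abs_le.2 ⟨?_, h.potential_le u⟩) k hg hgB]
    linarith [h.potential_nonneg u, h.potential_le u]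
  set P := fun k => KickRDS.fkSemigroup μ S η V k fun _ => 1 with hP
  have hPit : ∀ k u, (KickRDS.fkOp (μ.map (η 0)) S fun u => V u + c)^[k] (fun _ => 1) u
      = Real.exp (k * c) * P k u := fun k u => hsemi k measurable_const (B := 1) (by simp) u
  have hPpos : ∀ k u, 0 < P k u := fun k u => by
    have := zero_lt_one.trans_le (h.one_le_iterate k u)
    rw [hPit] at this
    exact pos_of_mul_pos_right this (Real.exp_pos _).le
  have hPsup : ∀ k, P k 0 ≤ KickRDS.supNormOn X (P k) := fun k => by
    refine (le_abs_self _).trans (KickRDS.le_supNormOn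
      (B := Real.exp (-(k * c)) * Real.exp (k * (2 * c))) (fun u _ => ?_) hX0)
    have h1 := (h.one_spec k).2 u
    rw [hPit, abs_mul, Real.abs_exp] at h1
    rw [Real.exp_neg]
    rwa [le_inv_mul_iff₀ (Real.exp_pos _)]
  -- the weights are bounded on `X_R`
  obtain ⟨Bω, hBω⟩ := hw.bounded_on_balls (max ((R : ℝ) + 1) ((R + 1) / γ 0))
  have hωX : ∀ u ∈ X, ω (u (Fin.last n)) ≤ Bω := fun u hu =>
    hBω _ (KickRDS.norm_le_of_interpNorm_le (hB.gamma_pos 0) e hs (hu _).1)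
  have hω0 : ∀ x, 0 ≤ ω x := fun x => zero_le_one.trans (hw.one_le_large x)
  set G := ∑ i : Fin (n + 1), Γ ^ (i : ℕ) with hG
  have hG0 : 0 ≤ G := Finset.sum_nonneg fun i _ => pow_nonneg hΓ _
  have hBω0 : 0 ≤ Bω := (hω0 _).trans (hωX 0 hX0)
  have hmain : ∀ (k : ℕ), ∀ u ∈ X, ∀ v ∈ X,
      |(KickRDS.supNormOn X (P k))⁻¹ * KickRDS.fkSemigroup μ S η V k f u
        - (KickRDS.supNormOn X (P k))⁻¹ * KickRDS.fkSemigroup μ S η V k f v|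
        ≤ c₁ * (Bω * Bω * (K * G)) * dist u v ^ θ := by
    intro k u hu v hv
    have hsupP : 0 < KickRDS.supNormOn X (P k) := (hPpos k 0).trans_le (hPsup k)
    have h1 := hhol k u v
    rw [hsemi k hf.continuous.measurable hBf, hsemi k hf.continuous.measurable hBf, ← mul_sub,
      abs_mul, Real.abs_exp] at h1
    have hD : KickRDS.blockDist θ Γ u v ≤ G * dist u v ^ θ := by
      rw [KickRDS.blockDist, hG, Finset.sum_mul]
      refine Finset.sum_le_sum fun i _ => mul_le_mul_of_nonneg_left ?_ (pow_nonneg hΓ _)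
      rw [← dist_eq_norm]
      exact Real.rpow_le_rpow dist_nonneg (dist_le_pi_dist u v i) hθ.le
    have hb0 := KickRDS.blockDist_nonneg (θ := θ) hΓ u v
    have h2 : Real.exp (k * c) *
        |KickRDS.fkSemigroup μ S η V k f u - KickRDS.fkSemigroup μ S η V k f v|
        ≤ c₁ * (Real.exp (k * c) * KickRDS.supNormOn X (P k)) *
          (Bω * Bω * (K * (G * dist u v ^ θ))) := by
      refine h1.trans ?_
      have f1 : h.sup k ≤ c₁ * (Real.exp (k * c) * KickRDS.supNormOn X (P k)) := by
        refine (hharnack k).trans (mul_le_mul_of_nonneg_left ?_ hc₁.le)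
        rw [hPit]
        exact mul_le_mul_of_nonneg_left (hPsup k) (Real.exp_pos _).le
      have f2 := hωX u hu
      have f3 := hωX v hv
      have f4 := hω0 (u (Fin.last n))
      have f5 := hω0 (v (Fin.last n))
      have f6 := zero_le_one.trans (h.one_le_sup h0 k)
      gcongr
    rw [← mul_sub, abs_mul, abs_of_pos (inv_pos.2 hsupP), inv_mul_le_iff₀ hsupP]
    refine le_of_mul_le_mul_left (h2.trans (le_of_eq ?_)) (Real.exp_pos (k * c))
    ring
  rw [UniformEquicontinuousOn]
  intro U hU'
  obtain ⟨ε, hε, hεU⟩ := Metric.mem_uniformity_dist.1 hU'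
  have hlim : Tendsto (fun r : ℝ => c₁ * (Bω * Bω * (K * G)) * r ^ θ) (𝓝 0)
      (𝓝 (c₁ * (Bω * Bω * (K * G)) * 0 ^ θ)) :=
    (Real.continuousAt_rpow_const 0 θ (Or.inr hθ.le)).tendsto.const_mul _
  rw [Real.zero_rpow hθ.ne', mul_zero] at hlim
  obtain ⟨r, hr, hr'⟩ := Metric.eventually_nhds_iff.1 (hlim.eventually (gt_mem_nhds hε))
  refine eventually_inf_principal.2 (mem_of_superset (Metric.dist_mem_uniformity hr) ?_)
  rintro ⟨u, v⟩ huv ⟨hu, hv⟩ k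
  refine hεU ?_
  rw [Real.dist_eq]
  refine (hmain k u hu v hv).trans_lt (hr' ?_)
  rwa [Real.dist_eq, sub_zero, abs_of_nonneg dist_nonneg]
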